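/- **Types and terms.** Fix a set of base types. Simple types: $\sigma::=a\mid\sigma\to\sigma$ with $a$ a base type. EAL formulas: $A::=a\mid A\multimap A\mid\,!A$; the erasure $\overline A$ deletes every $!$ and turns $\multimap$ into $\to$. $\lambda$-terms $M::=x\mid\lambda x.M\mid(M\,N)$ are taken up to $\alpha$-equivalence. A basis $\Gamma$ is a finite set of declarations $x:A$ with distinct variables $x$. **EAL typing.** The sequent calculus of (implicational) Elementary Affine Logic, where comma denotes union of bases with disjoint domains, has the rules - (ax) $x:A\vdash x:A$; - (cut) from $\Gamma\vdash N:A$ and $x:A,\Delta\vdash M:B$ infer $\Gamma,\Delta\vdash M\{N/x\}:B$; - (weak) from $\Gamma\vdash M:B$ infer $\Gamma,x:A\vdash M:B$; - (contr) from $\Gamma,x_1:!A,x_2:!A\vdash M:B$ infer $\Gamma,z:!A\vdash M\{z/x_1,z/x_2\}:B$; - ($\multimap R$) from $\Gamma,x:A\vdash M:B$ infer $\Gamma\vdash\lambda x.M:A\multimap B$; - ($\multimap L$) from $\Gamma\vdash N:A$ and $x:B,\Delta\vdash M:C$ infer $\Gamma,f:A\multimap B,\Delta\vdash M\{(f\,N)/x\}:C$;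 - ($!$) from $x_1:A_1,\dots,x_n:A_n\vdash M:B$ infer $x_1:!A_1,\dots,x_n:!A_n\vdash M:!B$. The sharing graph of a derivation is its term with each (contr) recorded by an explicit fan node $[M]_{P=x_1,x_2}$, which faces $P$ and whose two other ports are $x_1,x_2$ in $M$: (contr) yields $[M]_{z=x_1,x_2}$, the substitutions in (cut) and ($\multimap L$) act on graphs, and $!$ leaves the graph unchanged. Unfolding all fans, $[M]_{P=x_1,x_2}\mapsto M\{P/x_1,P/x_2\}$, gives the term of the derivation. Write $\Gamma\vdash_{\mathsf{EAL}}M:A$ iff there is a derivation of $\Gamma\vdash M:A$ in whose sharing graph fans share only variables, i.e. no fan faces the root of a subgraph that is an application (or an abstraction): for every fan $[N]_{P=x_1,x_2}$ the unfolding of $P$ is a variable. **General types and constraints.** General EAL-types are $\Theta::=\,!^{n_1+\cdots+n_k}a\mid\,!^{n_1+\cdots+n_k}(\Theta\multimap\Theta)$, $k\ge0$, with variables $n_i$ ranging over $\mathbb N$; $!^{n}!^{m}\Theta$ is identified with $!^{n+m}\Theta$. Constraints are $\sum\pm n_i=0$ and $\sum n_i\ge1$. A base is a multiset of pairs (variable,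 general type), one for each free variable occurrence; $\mathrm{FVO}(M)$ is the list of free variable occurrences of $M$. A critical point is a pair (equation of the current system, list of free variable occurrences); a slice is a set of critical points. An equation keeps its identity when it is modified, and different occurrences of a variable are distinguished. $X(\cdot)$ denotes instantiation by $X$. **Auxiliary functions** (all $p,b,c,n$ introduced are fresh). - $\mathcal P(a)=!^pa$, $\mathcal P(\sigma\to\tau)=!^p(\mathcal P(\sigma)\multimap\mathcal P(\tau))$. - $\mathcal U(\Theta_1,\dots,\Theta_h)$, for $h\ge2$ types with the same erasure: the equations $e_i-e_{i+1}=0$ ($1\le i<h$) between consecutive outermost exponents, followed, for types $!^{e_i}(\Theta_i'\multimap\Theta_i'')$, by $\mathcal U(\Theta_1',\dots,\Theta_h')$ and $\mathcal U(\Theta_1'',\dots,\Theta_h'')$. - $\mathcal C(\Theta)=\emptyset$; for $h\ge2$, $\mathcal C(\Theta_1,\dots,\Theta_h)=\{e_1\ge1\}\cup\mathcal U(\Theta_1,\dots,\Theta_h)$ with $e_1$ the outermost exponent of $\Theta_1$. - $\mathbb B(M,B,\Gamma,cpts,A)$: if $M$ is a variable, $\langle B,\Gamma,A\rangle$. Otherwise,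 for each slice $sl\in cpts$ in turn take a fresh $c$, replace $\Gamma$ by $!^c\Gamma$, put $!^c$ in front of the type of each occurrence in $B$ that is in no list of $sl$, and subtract $c$ from the left side of each equation of $A$ that is in $sl$; finally put $!^b$ in front of $\Gamma$ and of all types in $B$. - $cpts_1\Cup cpts_2=cpts_1\cup cpts_2\cup\{sl_1\cup sl_2: sl_i\in cpts_i\}$. **Synthesis.** $S$ works on a simple type derivation of $M:\sigma$ (the syntax tree of $M$ decorated with simple types) and returns $\langle$type, base, constraints, set of slices$\rangle$. - $S(x:\sigma)=\langle\Theta,\{x:\Theta\},\emptyset,\emptyset\rangle$ with $\Theta=\mathcal P(\sigma)$. - $S(\lambda x.M:\sigma\to\tau)$: let $S(M:\tau)=\langle\Gamma_1,B_1,A_1,cpts\rangle$ and $\mathbb B(M,B_1,\Gamma_1,cpts,A_1)=\langle B',\Gamma,A_2\rangle$. If $x$ occurs free in $M$, and $\Theta_1,\dots,\Theta_h$ are its types in $B'$ and $B$ is the rest of $B'$: $\langle\Theta_1\multimap\Gamma,\,B,\,A_2\cup\mathcal C(\Theta_1,\dots,\Theta_h),\,cpts'\rangle$, where $cpts'$ consists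 of the slices of $cpts$ none of whose lists contains an occurrence of $x$. If $x$ does not occur and $M$ is an application, and $\Gamma=!^{e}\Gamma'$ with outermost exponent $e$: $\langle\mathcal P(\sigma)\multimap!^n\Gamma',\,B',\,A_2\cup\{e-n=0\},\,cpts\cup\{\{(e-n=0,\mathrm{FVO}(M))\}\}\rangle$. If $x$ does not occur and $M$ is not an application: $\langle\mathcal P(\sigma)\multimap\Gamma,B',A_2,cpts\rangle$. - $S((M\,N):\tau)$: let $S(M:\sigma\to\tau)=\langle!^{e}(\Theta_1\multimap\Gamma),B_1,A_1,cpts_1\rangle$, $S(N:\sigma)=\langle\Theta_2,B_2,A_2,cpts_2\rangle$, $\mathbb B(N,B_2,\Theta_2,cpts_2,A_2)=\langle B_3,\Theta_3,A_3\rangle$, and $A_4=\mathcal U(\Theta_3,\Theta_1)$ if $N$ is an application, $A_4=\mathcal U(\Theta_1,\Theta_3)$ otherwise. If $M$ is an application add the slice $\{(e=0,\mathrm{FVO}(M))\}$ to $cpts_1$; if $N$ is an application add the slice $\{(A_4^1,\mathrm{FVO}(N))\}$ to $cpts_2$, where $A_4^1$ is the first equation of $A_4$. The result is $\langle\Gamma,B_1\cup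 B_3,A_1\cup A_3\cup A_4\cup\{e=0\},cpts_1\Cup cpts_2\rangle$. - The algorithm $\mathcal S(M:\sigma)$: let $S(M:\sigma)=\langle\Theta_1,B_1,A',cpts\rangle$ and $\mathbb B(M,B_1,\Theta_1,cpts,A')=\langle B_2,\Theta,A_0\rangle$. For each free variable $x_j$ of $M$ let $\Theta_{1_j},\dots,\Theta_{k_j}$ be its types in $B_2$. Then $\mathcal S(M:\sigma)=\langle\Theta,\ \{x_j:\Theta_{1_j}\}_j,\ A_0\cup\bigcup_j\mathcal C(\Theta_{1_j},\dots,\Theta_{k_j})\rangle$. **Theorem (Main theorem).** Let $M$ be a simply typeable $\lambda$-term. For every basis $\Gamma$ and EAL formula $C$: $\Gamma\vdash_{\mathsf{EAL}}M:C$ if and only if, for some simple type derivation of $M:\overline C$, the algorithm yields $\mathcal S(M:\overline C)=\langle\Theta,B,A\rangle$ where $A$ admits an integral solution $X$ (with values in $\mathbb N$) such that $X(B)\subseteq\Gamma$ and $C=X(\Theta)$. -/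

import Mathlib

namespace EAL

/-! ### Simple types, EAL formulas, type-free λ-terms -/

/-- Simple types over a set `ι` of base types. -/
inductive STy (ι : Type*) : Type _
  | atom (a : ι) : STy ι
  | arr (σ τ : STy ι) : STy ι

/-- Formulas of implicational Elementary Affine Logic. -/
inductive Formula (ι : Type*) : Type _
  | atom (a : ι) : Formula ι
  | lolli (A B : Formula ι) : Formula ι
  | bang (A : Formula ι) : Formula ι

/-- The erasure: forget every `!` and turn `⊸` into `→`. -/
def Formula.erase {ι : Type*} : Formula ι → STy ι
  | .atom a => .atom a
  | .lolli A B => .arr A.erase B.erase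
  | .bang A => A.erase

/-- Type-free λ-terms up to α-equivalence, in de Bruijn notation: `lam` binds the index `0`.
An index that points beyond all enclosing binders is a free variable. -/
inductive Term : Type
  | var (x : ℕ) : Term
  | lam (M : Term) : Term
  | app (M N : Term) : Term

def Term.isApp : Term → Bool
  | .app _ _ => true
  | _ => false

def Term.isVar : Term → Bool
  | .var _ => true
  | _ => false

/-- A renaming of free variables, pushed under one binder. -/
def liftRen (ρ : ℕ → ℕ) : ℕ → ℕ
  | 0 => 0
  | x + 1 => ρ x + 1

def Term.rename : Term → (ℕ → ℕ) → Term
  | .var x, ρ => .var (ρ x)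
  | .lam M, ρ => .lam (M.rename (liftRen ρ))
  | .app M N, ρ => .app (M.rename ρ) (N.rename ρ)

/-- A simultaneous substitution, pushed under one binder. -/
def Term.liftSub (s : ℕ → Term) : ℕ → Term
  | 0 => .var 0
  | x + 1 => (s x).rename Nat.succ

/-- Simultaneous capture-avoiding substitution. -/
def Term.subst : Term → (ℕ → Term) → Term
  | .var x, s => s x
  | .lam M, s => .lam (M.subst (Term.liftSub s))
  | .app M N, s => .app (M.subst s) (N.subst s)

/-! ### Sharing graphs

A sharing graph is written as a λ-term with explicit fan nodes: `share P N` is the graph `N`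
(in which the indices `0` and `1` are bound) where the two auxiliary ports of a fan are connected
to the variables `0` and `1` of `N`, and its principal port faces the root of `P`. -/

inductive Graph : Type
  | var (x : ℕ) : Graph
  | lam (G : Graph) : Graph
  | app (G H : Graph) : Graph
  | share (P N : Graph) : Graph

def Graph.rename : Graph → (ℕ → ℕ) → Graph
  | .var x, ρ => .var (ρ x)
  | .lam G, ρ => .lam (G.rename (liftRen ρ))
  | .app G H, ρ => .app (G.rename ρ) (H.rename ρ)
  | .share P N, ρ => .share (P.rename ρ) (N.rename (liftRen (liftRen ρ)))

def Graph.liftSub (s : ℕ → Graph) : ℕ → Graph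
  | 0 => .var 0
  | x + 1 => (s x).rename Nat.succ

def Graph.subst : Graph → (ℕ → Graph) → Graph
  | .var x, s => s x
  | .lam G, s => .lam (G.subst (Graph.liftSub s))
  | .app G H, s => .app (G.subst s) (H.subst s)
  | .share P N, s => .share (P.subst s) (N.subst (Graph.liftSub (Graph.liftSub s)))

/-- `H.plug G` is `H{G/x}` where `x` is the variable with index `0`; the other free variables
of `H` are renumbered accordingly. -/
def Graph.plug (H G : Graph) : Graph :=
  H.subst fun
    | 0 => G
    | x + 1 => .var x

/-- The λ-term that a sharing graph represents: every fan is unfolded. -/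
def Graph.readback : Graph → Term
  | .var x => .var x
  | .lam G => .lam G.readback
  | .app G H => .app G.readback H.readback
  | .share P N => N.readback.subst fun
      | 0 => P.readback
      | 1 => P.readback
      | x + 2 => .var x

/-- Fans share only variables: no fan faces (the root of) a subgraph which is an application or
an abstraction. -/
def Graph.SharesOnlyVariables : Graph → Prop
  | .var _ => True
  | .lam G => G.SharesOnlyVariables
  | .app G H => G.SharesOnlyVariables ∧ H.SharesOnlyVariables
  | .share P N =>
      (∃ x, P.readback = .var x) ∧ P.SharesOnlyVariables ∧ N.SharesOnlyVariables

/-! ### Sequent derivations of EAL -/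

/-- Contexts assign a formula to some of the free variables; a variable occurs at most once.
A basis is a context with finite domain. -/
abbrev Ctx (ι : Type*) : Type _ := ℕ → Option (Formula ι)

def Ctx.dom {ι : Type*} (Γ : Ctx ι) : Set ℕ := {x | Γ x ≠ none}

/-- The context `x : A`. -/
def Ctx.single {ι : Type*} (x : ℕ) (A : Formula ι) : Ctx ι :=
  Function.update (fun _ => none) x (some A)

/-- The context `Γ, x : A`. -/
def Ctx.add {ι : Type*} (Γ : Ctx ι) (x : ℕ) (A : Formula ι) : Ctx ι :=
  Function.update Γ x (some A)

/-- The context `Γ, Δ`; used only for contexts with disjoint domains. -/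
def Ctx.union {ι : Type*} (Γ Δ : Ctx ι) : Ctx ι := fun x => (Γ x).or (Δ x)

/-- The context under a binder: the bound variable has index `0` and type `A`. -/
def Ctx.cons {ι : Type*} (A : Formula ι) (Γ : Ctx ι) : Ctx ι
  | 0 => some A
  | x + 1 => Γ x

/-- The context `!Γ`. -/
def Ctx.bang {ι : Type*} (Γ : Ctx ι) : Ctx ι := fun x => (Γ x).map Formula.bang

/-- `Derives Γ G A`: there is a derivation of `Γ ⊢ M : A` in the sequent calculus of EAL whose
sharing graph is `G` (and hence whose term `M` is `G.readback`). -/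
inductive Derives {ι : Type*} : Ctx ι → Graph → Formula ι → Prop
  | ax (x : ℕ) (A : Formula ι) : Derives (Ctx.single x A) (.var x) A
  | cut {Γ Δ : Ctx ι} {G H : Graph} {A B : Formula ι} :
      Disjoint Γ.dom Δ.dom → Derives Γ G A → Derives (Ctx.cons A Δ) H B →
      Derives (Γ.union Δ) (H.plug G) B
  | weak {Γ : Ctx ι} {G : Graph} {B : Formula ι} (x : ℕ) (A : Formula ι) :
      x ∉ Γ.dom → Derives Γ G B → Derives (Γ.add x A) G B
  | contr {Γ : Ctx ι} {G : Graph} {A B : Formula ι} (z : ℕ) :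
      z ∉ Γ.dom → Derives (Ctx.cons A.bang (Ctx.cons A.bang Γ)) G B →
      Derives (Γ.add z A.bang) (.share (.var z) G) B
  | lolliR {Γ : Ctx ι} {G : Graph} {A B : Formula ι} :
      Derives (Ctx.cons A Γ) G B → Derives Γ (.lam G) (.lolli A B)
  | lolliL {Γ Δ : Ctx ι} {G H : Graph} {A B C : Formula ι} (f : ℕ) :
      Disjoint Γ.dom Δ.dom → f ∉ Γ.dom → f ∉ Δ.dom →
      Derives Γ G A → Derives (Ctx.cons B Δ) H C →
      Derives ((Γ.union Δ).add f (.lolli A B)) (H.plug (.app (.var f) G)) C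
  | bang {Γ : Ctx ι} {G : Graph} {B : Formula ι} :
      Derives Γ G B → Derives Γ.bang G B.bang

/-- `Γ ⊢_EAL M : A`: some derivation of `Γ ⊢ M : A` has a sharing graph in which the fans share
only variables. -/
def Typing {ι : Type*} (Γ : Ctx ι) (M : Term) (A : Formula ι) : Prop :=
  ∃ G : Graph, Derives Γ G A ∧ G.readback = M ∧ G.SharesOnlyVariables

/-! ### Simple type derivations -/

/-- The simple type environment under a binder. -/
def envCons {ι : Type*} (σ : STy ι) (E : ℕ → STy ι) : ℕ → STy ι
  | 0 => σ
  | x + 1 => E x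

/-- Natural deduction derivations of `E ⊢ M : σ`, i.e. syntax trees of `M` decorated with simple
types. -/
inductive SDer {ι : Type*} : (ℕ → STy ι) → Term → STy ι → Type _
  | var (E : ℕ → STy ι) (x : ℕ) : SDer E (.var x) (E x)
  | lam {E : ℕ → STy ι} {M : Term} {σ τ : STy ι} :
      SDer (envCons σ E) M τ → SDer E (.lam M) (.arr σ τ)
  | app {E : ℕ → STy ι} {M N : Term} {σ τ : STy ι} :
      SDer E M (.arr σ τ) → SDer E N σ → SDer E (.app M N) τ

/-- `M` is simply typeable (over the base types `ι`). -/
def SimplyTypeable (ι : Type*) (M : Term) : Prop :=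
  ∃ (E : ℕ → STy ι) (σ : STy ι), Nonempty (SDer E M σ)

/-! ### General EAL-types and linear constraints

Integer variables are natural numbers; a list of variables stands for their sum. -/

/-- General EAL-types with erasure `σ`: `!^{n₁+⋯+n_k} a` or `!^{n₁+⋯+n_k} (Θ ⊸ Γ)`. -/
inductive GTy {ι : Type*} : STy ι → Type _
  | atom (ns : List ℕ) (a : ι) : GTy (.atom a)
  | lolli {σ τ : STy ι} (ns : List ℕ) (Θ : GTy σ) (Γ : GTy τ) : GTy (.arr σ τ)

namespace GTy

variable {ι : Type*} {σ τ : STy ι}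

/-- The outermost exponent. -/
def outer : {σ : STy ι} → GTy σ → List ℕ
  | _, .atom ns _ => ns
  | _, .lolli ns _ _ => ns

/-- Replace the outermost exponent. -/
def setOuter (ms : List ℕ) : {σ : STy ι} → GTy σ → GTy σ
  | _, .atom _ a => .atom ms a
  | _, .lolli _ Θ Γ => .lolli ms Θ Γ

/-- `!^c Θ`, identified with the general EAL-type that has `c` added to the outer exponent. -/
def bang (c : ℕ) (Θ : GTy σ) : GTy σ := Θ.setOuter (c :: Θ.outer)

def dom : GTy (.arr σ τ) → GTy σ
  | .lolli _ Θ _ => Θ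

def cod : GTy (.arr σ τ) → GTy τ
  | .lolli _ _ Γ => Γ

/-- The instantiation `X(Θ)`. -/
def inst (X : ℕ → ℕ) : {σ : STy ι} → GTy σ → Formula ι
  | _, .atom ns a => Formula.bang^[(ns.map X).sum] (.atom a)
  | _, .lolli ns Θ Γ => Formula.bang^[(ns.map X).sum] (.lolli (Θ.inst X) (Γ.inst X))

end GTy

/-- Linear constraints: `∑ pos - ∑ neg = 0` and `∑ ns ≥ 1`. -/
inductive Constraint : Type
  | eq (pos neg : List ℕ) : Constraint
  | ge (ns : List ℕ) : Constraint

def Constraint.Holds (X : ℕ → ℕ) : Constraint → Prop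
  | .eq pos neg => ((pos.map X).sum : ℤ) - ((neg.map X).sum : ℤ) = 0
  | .ge ns => 1 ≤ (ns.map X).sum

/-- The constraint `A - c`, for an equation `A`. -/
def Constraint.sub (c : ℕ) : Constraint → Constraint
  | .eq pos neg => .eq pos (neg ++ [c])
  | .ge ns => .ge ns

/-- A row of the constraint matrix. The number `id` is the identity of the row: it does not change
when the boxing function modifies the constraint in this row. -/
structure Row : Type where
  id : ℕ
  lin : Constraint

/-- Number new rows consecutively, from `n` on. -/
def newRows (n : ℕ) (cs : List Constraint) : List Row :=
  cs.mapIdx fun i c => ⟨n + i, c⟩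

/-- A slice: a list of critical points. A critical point is a pair of (the identity of) a row and
a list of free variable occurrences. -/
abbrev Slice : Type := List (ℕ × List ℕ)

/-- The row with identity `i` belongs to the slice. -/
def Slice.hasRow (sl : Slice) (i : ℕ) : Bool := sl.any fun p => p.1 == i

/-- The variable occurrence `o` belongs to the slice. -/
def Slice.hasOcc (sl : Slice) (o : ℕ) : Bool := sl.any fun p => p.2.contains o

/-- An entry of a base: a variable, the identity of one of its occurrences, and the general
EAL-type of this occurrence. -/
structure Entry {ι : Type*} (E : ℕ → STy ι) : Type _ where
  var : ℕ
  occ : ℕ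
  ty : GTy (E var)

def Entry.bang {ι : Type*} {E : ℕ → STy ι} (c : ℕ) (e : Entry E) : Entry E :=
  ⟨e.var, e.occ, e.ty.bang c⟩

/-! ### The functions of the algorithm

Every function that needs fresh integer variables, row identities or occurrence identities takes
the first unused number `n`, and returns the next unused one. -/

/-- Type processing `𝒫`. -/
def process {ι : Type*} : (σ : STy ι) → ℕ → GTy σ × ℕ
  | .atom a, n => (.atom [n] a, n + 1)
  | .arr σ τ, n =>
      let Θ := process σ (n + 1)
      let Γ := process τ Θ.2
      (.lolli [n] Θ.1 Γ.1, Γ.2)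

/-- Equations between consecutive exponents. -/
def chain : List (List ℕ) → List Constraint
  | a :: b :: l => .eq a b :: chain (b :: l)
  | _ => []

/-- Unification `𝒰` of general EAL-types with the same erasure. -/
def unify {ι : Type*} : (σ : STy ι) → List (GTy σ) → List Constraint
  | .atom _, l => chain (l.map GTy.outer)
  | .arr σ τ, l =>
      chain (l.map GTy.outer) ++ unify σ (l.map GTy.dom) ++ unify τ (l.map GTy.cod)

/-- Contraction `𝒞`. -/
def contraction {ι : Type*} {σ : STy ι} : List (GTy σ) → List Constraint
  | Θ₁ :: Θ₂ :: l => .ge Θ₁.outer :: unify σ (Θ₁ :: Θ₂ :: l)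
  | _ => []

/-- The result `⟨base, type, constraints⟩` of boxing, and the next unused number. -/
structure Boxed {ι : Type*} (E : ℕ → STy ι) (σ : STy ι) : Type _ where
  base : List (Entry E)
  ty : GTy σ
  rows : List Row
  next : ℕ

/-- Boxing through the critical points. -/
def boxSlices {ι : Type*} {E : ℕ → STy ι} {σ : STy ι} :
    List (Entry E) → GTy σ → List Slice → List Row → ℕ → Boxed E σ
  | B, Γ, [], A, n => ⟨B, Γ, A, n⟩
  | B, Γ, sl :: cpts, A, n =>
      boxSlices
        (B.map fun e => if sl.hasOcc e.occ then e else e.bang n)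
        (Γ.bang n) cpts
        (A.map fun r => if sl.hasRow r.id then ⟨r.id, r.lin.sub n⟩ else r)
        (n + 1)

/-- Boxing `𝔹`: nothing for a variable; otherwise box through the critical points and then add
`b` boxes around the term. -/
def box {ι : Type*} {E : ℕ → STy ι} {σ : STy ι} (M : Term) (B : List (Entry E)) (Γ : GTy σ)
    (cpts : List Slice) (A : List Row) (n : ℕ) : Boxed E σ :=
  if M.isVar then ⟨B, Γ, A, n⟩
  else
    let r := boxSlices B Γ cpts A n
    ⟨r.base.map (Entry.bang r.next), r.ty.bang r.next, r.rows, r.next + 1⟩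

/-- Product union of sets of slices. -/
def productUnion : List Slice → List Slice → List Slice
  | [], cpts => cpts
  | sl :: cpts₁, cpts₂ => (sl :: cpts₂.map fun sl₂ => sl ++ sl₂) ++ productUnion cpts₁ cpts₂

/-- The result `⟨type, base, constraints, critical points⟩` of type synthesis, and the next unused
number. -/
structure Synth {ι : Type*} (E : ℕ → STy ι) (σ : STy ι) : Type _ where
  ty : GTy σ
  base : List (Entry E)
  rows : List Row
  cpts : List Slice
  next : ℕ

/-- The list of free variable occurrences of the term for which the base was synthesized. -/
def occurrences {ι : Type*} {E : ℕ → STy ι} (B : List (Entry E)) : List ℕ := B.map Entry.occ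

/-- The types of the occurrences of the variable that is being abstracted. -/
def boundTypes {ι : Type*} {E : ℕ → STy ι} {σ : STy ι} (B : List (Entry (envCons σ E))) :
    List (GTy σ) :=
  B.filterMap fun
    | ⟨0, _, Θ⟩ => some Θ
    | ⟨_ + 1, _, _⟩ => none

/-- The occurrences of the variable that is being abstracted. -/
def boundOccs {ι : Type*} {E : ℕ → STy ι} {σ : STy ι} (B : List (Entry (envCons σ E))) :
    List ℕ :=
  B.filterMap fun
    | ⟨0, o, _⟩ => some o
    | ⟨_ + 1, _, _⟩ => none

/-- The rest of the base, with variables renumbered for the context outside the abstraction. -/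
def unbound {ι : Type*} {E : ℕ → STy ι} {σ : STy ι} (B : List (Entry (envCons σ E))) :
    List (Entry E) :=
  B.filterMap fun
    | ⟨0, _, _⟩ => none
    | ⟨x + 1, o, Θ⟩ => some ⟨x, o, Θ⟩

/-- Variable case of type synthesis. -/
def synthVar {ι : Type*} (E : ℕ → STy ι) (x n : ℕ) : Synth E (E x) :=
  let Θ := process (E x) n
  ⟨Θ.1, [⟨x, Θ.2, Θ.1⟩], [], [], Θ.2 + 1⟩

/-- Abstraction cases of type synthesis: `M` is the body and `r` the result for the body. -/
def synthLam {ι : Type*} {E : ℕ → STy ι} {σ τ : STy ι} (M : Term)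
    (r : Synth (envCons σ E) τ) : Synth E (.arr σ τ) :=
  let bx := box M r.base r.ty r.cpts r.rows r.next
  match boundTypes bx.base with
  | Θ₁ :: Θs =>
      -- the abstracted variable occurs in the body
      let A₃ := contraction (Θ₁ :: Θs)
      ⟨.lolli [] Θ₁ bx.ty, unbound bx.base, bx.rows ++ newRows bx.next A₃,
        r.cpts.filter (fun sl => !(boundOccs bx.base).any sl.hasOcc),
        bx.next + A₃.length⟩
  | [] =>
      let Θ := process σ bx.next
      if M.isApp then
        -- `Θ.2` is the fresh integer variable, `Θ.2 + 1` the identity of the new row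
        ⟨.lolli [] Θ.1 (bx.ty.setOuter [Θ.2]), unbound bx.base,
          bx.rows ++ [⟨Θ.2 + 1, .eq bx.ty.outer [Θ.2]⟩],
          r.cpts ++ [[(Θ.2 + 1, occurrences bx.base)]],
          Θ.2 + 2⟩
      else
        ⟨.lolli [] Θ.1 bx.ty, unbound bx.base, bx.rows, r.cpts, Θ.2⟩

/-- Application cases of type synthesis, for `M N`: `r₁` is the result for `M` and `r₂` the result
for `N`, which uses numbers not used by `r₁`. -/
def synthApp {ι : Type*} {E : ℕ → STy ι} {σ τ : STy ι} (M N : Term)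
    (r₁ : Synth E (.arr σ τ)) (r₂ : Synth E σ) : Synth E τ :=
  let bx := box N r₂.base r₂.ty r₂.cpts r₂.rows r₂.next
  let A₄ := if N.isApp then unify σ [bx.ty, r₁.ty.dom] else unify σ [r₁.ty.dom, bx.ty]
  -- the first row of `A₄`, between the outermost exponents, has the identity `bx.next`
  let k := bx.next + A₄.length
  let cpts₁ := if M.isApp then r₁.cpts ++ [[(k, occurrences r₁.base)]] else r₁.cpts
  let cpts₂ := if N.isApp then r₂.cpts ++ [[(bx.next, occurrences r₂.base)]] else r₂.cpts
  ⟨r₁.ty.cod, r₁.base ++ bx.base,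
    r₁.rows ++ bx.rows ++ newRows bx.next A₄ ++ [⟨k, .eq r₁.ty.outer []⟩],
    productUnion cpts₁ cpts₂, k + 1⟩

/-- Type synthesis on a simple type derivation. -/
def synth {ι : Type*} : {E : ℕ → STy ι} → {M : Term} → {σ : STy ι} → SDer E M σ → ℕ → Synth E σ
  | _, _, _, .var E x, n => synthVar E x n
  | _, .lam M, _, .lam d, n => synthLam M (synth d n)
  | _, .app M N, _, .app d₁ d₂, n =>
      let r₁ := synth d₁ n
      synthApp M N r₁ (synth d₂ r₁.next)

/-- The types of the occurrences of the free variable `x` in a base. -/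
def typesOf {ι : Type*} {E : ℕ → STy ι} (B : List (Entry E)) (x : ℕ) : List (GTy (E x)) :=
  B.filterMap fun e => if h : e.var = x then some (h ▸ e.ty) else none

/-- The result `⟨Θ, B, A⟩` of the type synthesis algorithm. -/
structure Result {ι : Type*} (E : ℕ → STy ι) (σ : STy ι) : Type _ where
  ty : GTy σ
  base : List ((x : ℕ) × GTy (E x))
  constraints : List Constraint

/-- The type synthesis algorithm: synthesize, box, forget the critical points, and contract the
occurrences of every free variable, keeping the type of the first one. -/
def algorithm {ι : Type*} {E : ℕ → STy ι} {M : Term} {σ : STy ι} (d : SDer E M σ) : Result E σ :=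
  let r := synth d 0
  let bx := box M r.base r.ty r.cpts r.rows r.next
  let vars := (bx.base.map Entry.var).dedup
  { ty := bx.ty
    base := vars.flatMap fun x => ((typesOf bx.base x).take 1).map fun Θ => ⟨x, Θ⟩
    constraints := bx.rows.map Row.lin ++ vars.flatMap fun x => contraction (typesOf bx.base x) }

/-- `X` solves all constraints; its values are natural numbers. -/
def Solves (X : ℕ → ℕ) (A : List Constraint) : Prop := ∀ c ∈ A, c.Holds X

/-- `X(B) ⊆ Γ`. -/
def InstSubset {ι : Type*} {E : ℕ → STy ι} (X : ℕ → ℕ) (B : List ((x : ℕ) × GTy (E x)))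
    (Γ : Ctx ι) : Prop :=
  ∀ p ∈ B, Γ p.1 = some (p.2.inst X)

end EAL

/-! Both sides of the equivalence are compared with an intermediate notion, the leveled typing
(`Leveled`, `LeveledTyping`). Boxes, i.e. uses of the rule (!), are regions of the syntax tree. All
that matters about them is how many surround each abstraction and each application; this number is
the level of the node. Types on different sides of a box border become comparable when they are
written as seen from outside all boxes: an abstraction of level d then has a type !^d(A ⊸ B). One
condition relates the levels: a node of level d contains free only variables bound at level at most
d, so that every box around a binder contains all occurrences of its variable. In addition,
variables that occur repeatedly need a type !A.

From a derivation to levels (`LeveledTyping.of_derives`): (!) raises every level by one, while (cut)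
and (⊸L) substitute without changing levels. Substituting for a variable with several occurrences
would multiply the free variables of the substituted term, whose types need not start with !. Since
fans share only variables, this happens only when that term is a variable (`readback_eq_var`).

From levels to a derivation (`PlainTyping.of_leveled`): a repeated variable is split by (contr). In
a linear term with root level 0 the last rules can be read off. With positive root level there are
two cases (`unbox_or_cutAt`). Either all levels are positive and the types of the free variables
start with !, so that one box is removed by (!); or some subterm has level 0 and is split off by
(cut).

For the algorithm, a slice is read as a box around the current term that stops at the critical
points of the slice; the empty slice is a box around everything. Put a list `W` of such boxes around
a term: an equation loses 1 for each box that stops at it, and an occurrence gains one ! for each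
box that contains it (`RowsHold`, `BaseFits`, `Synth.Fits`). Boxing 𝔹 then merely extends `W`, by
X(c) copies of each slice and X(b) copies of the empty one (`Synth.fits_boxed`). Under this reading
the clauses of synthesis turn into the rules of `Leveled`, with the length of `W` as level
(`fits_synthApp` and the three `fits_synthLam` lemmas), and solutions yield leveled typings by
induction (`leveled_of_fits`).

Conversely (`Leveled.exists_realizedBy`), list the boxes around each node from the outermost
inwards. A child of higher level than its parent has surplus inner boxes, which boxing adds. A child
of lower level is left out by the innermost boxes of the parent, which therefore stop at a critical
point there. Only applications can be such children: a variable node has no level of its own, and an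
abstraction whose type starts with p signs ! has level at least p. Nor is a critical point needed at
a body that uses the abstracted variable, because its level is at least that of the binder. -/

namespace EAL

/-! ### Terms: renaming, substitution and occurrences of free variables -/

/-- The index of a variable outside a binder, if it is not the bound one. -/
def lower : ℕ → Option ℕ
  | 0 => none
  | x + 1 => some x

theorem count_filterMap_lower (l : List ℕ) (x : ℕ) :
    (l.filterMap lower).count x = l.count (x + 1) := by
  induction l with
  | nil => rfl
  | cons a l ih =>
    cases a with
    | zero => rw [List.filterMap_cons_none (show lower 0 = none from rfl), ih]; simp
    | succ a =>
      rw [List.filterMap_cons_some (show lower (a + 1) = some a from rfl)]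
      simp [ih, List.count_cons]

theorem mem_filterMap_lower {l : List ℕ} {x : ℕ} : x ∈ l.filterMap lower ↔ x + 1 ∈ l := by
  rw [← List.count_pos_iff, count_filterMap_lower, List.count_pos_iff]

/-- The binder step in computing the occurrences of renamed and substituted terms and graphs: the
image of the bound variable contributes nothing outside. -/
theorem filterMap_lower_flatMap (l : List ℕ) (f g : ℕ → List ℕ)
    (h0 : (f 0).filterMap lower = []) (hs : ∀ x, (f (x + 1)).filterMap lower = g x) :
    (l.flatMap f).filterMap lower = (l.filterMap lower).flatMap g := by
  induction l with
  | nil => rfl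
  | cons a l ih =>
    cases a with
    | zero =>
      rw [List.filterMap_cons_none (show lower 0 = none from rfl), List.flatMap_cons,
        List.filterMap_append, h0, ih, List.nil_append]
    | succ a =>
      rw [List.filterMap_cons_some (show lower (a + 1) = some a from rfl), List.flatMap_cons,
        List.filterMap_append, hs, ih, List.flatMap_cons]

theorem filterMap_lower_map_succ (l : List ℕ) : (l.map Nat.succ).filterMap lower = l := by
  induction l with
  | nil => rfl
  | cons a l ih => simp only [List.map_cons, List.filterMap_cons, Nat.succ_eq_add_one, lower, ih]

theorem flatMap_singleton_comp (l : List ℕ) (f : ℕ → ℕ) : l.flatMap (fun x => [f x]) = l.map f := by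
  induction l with
  | nil => rfl
  | cons a l ih => simp [ih]

namespace Term

/-- The list of free variable occurrences. -/
def fvs : Term → List ℕ
  | .var x => [x]
  | .lam M => M.fvs.filterMap lower
  | .app M N => M.fvs ++ N.fvs

/-- The number of nodes of the syntax tree. -/
def size : Term → ℕ
  | .var _ => 1
  | .lam M => M.size + 1
  | .app M N => M.size + N.size + 1

theorem size_pos (M : Term) : 1 ≤ M.size := by cases M <;> simp [size]

theorem liftSub_var_comp (ρ : ℕ → ℕ) :
    liftSub (fun x => .var (ρ x)) = fun x => .var (liftRen ρ x) := by
  funext x; cases x <;> rfl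

theorem rename_eq_subst (M : Term) (ρ : ℕ → ℕ) : M.rename ρ = M.subst fun x => .var (ρ x) := by
  induction M generalizing ρ with
  | var x => rfl
  | lam M ih => simp only [rename, subst, ih, liftSub_var_comp]
  | app M N ih₁ ih₂ => simp only [rename, subst, ih₁, ih₂]

theorem subst_rename (M : Term) (ρ : ℕ → ℕ) (s : ℕ → Term) :
    (M.rename ρ).subst s = M.subst fun x => s (ρ x) := by
  induction M generalizing ρ s with
  | var x => rfl
  | lam M ih =>
    simp only [rename, subst, ih]
    congr 2; funext x; cases x <;> rfl
  | app M N ih₁ ih₂ => simp only [rename, subst, ih₁, ih₂]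

theorem rename_rename (M : Term) (ρ ρ' : ℕ → ℕ) :
    (M.rename ρ).rename ρ' = M.rename fun x => ρ' (ρ x) := by
  rw [rename_eq_subst, subst_rename, rename_eq_subst]

theorem rename_subst (M : Term) (s : ℕ → Term) (ρ : ℕ → ℕ) :
    (M.subst s).rename ρ = M.subst fun x => (s x).rename ρ := by
  induction M generalizing ρ s with
  | var x => rfl
  | lam M ih =>
    simp only [rename, subst, ih]
    congr 2; funext x
    cases x with
    | zero => rfl
    | succ x => simp only [liftSub, rename_rename]; rfl
  | app M N ih₁ ih₂ => simp only [rename, subst, ih₁, ih₂]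

theorem subst_subst (M : Term) (s t : ℕ → Term) :
    (M.subst s).subst t = M.subst fun x => (s x).subst t := by
  induction M generalizing s t with
  | var x => rfl
  | lam M ih =>
    simp only [subst, ih]
    congr 2; funext x
    cases x with
    | zero => rfl
    | succ x => simp only [liftSub, subst_rename, rename_subst]
  | app M N ih₁ ih₂ => simp only [subst, ih₁, ih₂]

theorem subst_congr (M : Term) {s t : ℕ → Term} (h : ∀ x ∈ M.fvs, s x = t x) :
    M.subst s = M.subst t := by
  induction M generalizing s t with
  | var x => exact h x (by simp [fvs])
  | lam M ih =>
    simp only [subst]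
    rw [ih]
    intro x hx
    cases x with
    | zero => rfl
    | succ x => simp only [liftSub]; rw [h x (mem_filterMap_lower.2 hx)]
  | app M N ih₁ ih₂ =>
    simp only [subst]
    rw [ih₁ fun x hx => h x (by simp [fvs, hx]), ih₂ fun x hx => h x (by simp [fvs, hx])]

theorem subst_var (M : Term) : M.subst .var = M := by
  induction M with
  | var x => rfl
  | lam M ih =>
    have : liftSub .var = .var := by funext x; cases x <;> rfl
    simp only [subst, this, ih]
  | app M N ih₁ ih₂ => simp only [subst, ih₁, ih₂]

theorem subst_eq_self (M : Term) {s : ℕ → Term} (h : ∀ x ∈ M.fvs, s x = .var x) :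
    M.subst s = M := by
  rw [M.subst_congr h, subst_var]

theorem fvs_rename (M : Term) (ρ : ℕ → ℕ) : (M.rename ρ).fvs = M.fvs.map ρ := by
  induction M generalizing ρ with
  | var x => rfl
  | lam M ih =>
    simp only [rename, fvs, ih]
    rw [← flatMap_singleton_comp, ← flatMap_singleton_comp]
    exact filterMap_lower_flatMap _ _ _ rfl fun x => rfl
  | app M N ih₁ ih₂ => simp only [rename, fvs, ih₁, ih₂, List.map_append]

theorem fvs_subst (M : Term) (s : ℕ → Term) :
    (M.subst s).fvs = M.fvs.flatMap fun x => (s x).fvs := by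
  induction M generalizing s with
  | var x => simp [subst, fvs]
  | lam M ih =>
    simp only [subst, fvs, ih]
    refine filterMap_lower_flatMap _ _ _ rfl fun x => ?_
    simp only [liftSub, fvs_rename, filterMap_lower_map_succ]
  | app M N ih₁ ih₂ => simp only [subst, fvs, ih₁, ih₂, List.flatMap_append]

theorem size_rename (M : Term) (ρ : ℕ → ℕ) : (M.rename ρ).size = M.size := by
  induction M generalizing ρ with
  | var x => rfl
  | lam M ih => simp only [rename, size, ih]
  | app M N ih₁ ih₂ => simp only [rename, size, ih₁, ih₂]

theorem count_zero_fvs_rename_liftRen (M : Term) (ρ : ℕ → ℕ) :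
    (M.rename (liftRen ρ)).fvs.count 0 = M.fvs.count 0 := by
  rw [fvs_rename]
  induction M.fvs with
  | nil => rfl
  | cons a l ih => cases a <;> simp [liftRen, ih]

theorem count_zero_fvs_subst_liftSub (M : Term) (s : ℕ → Term) :
    (M.subst (liftSub s)).fvs.count 0 = M.fvs.count 0 := by
  rw [fvs_subst]
  induction M.fvs with
  | nil => rfl
  | cons a l ih =>
    rw [List.flatMap_cons, List.count_append, ih]
    cases a with
    | zero => simp [liftSub, fvs, Nat.add_comm]
    | succ a => simp [liftSub, fvs_rename, List.count_eq_zero]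

theorem eq_var_of_subst_eq_var {M : Term} {s : ℕ → Term} {z : ℕ} (h : M.subst s = .var z) :
    ∃ x, M = .var x ∧ s x = .var z := by
  cases M with
  | var x => exact ⟨x, rfl, h⟩
  | lam M => simp [subst] at h
  | app M N => simp [subst] at h

/-- The substitution of one term for the variable `0`, and the renumbering of the others. -/
def instZero (N : Term) : ℕ → Term
  | 0 => N
  | x + 1 => .var x

/-- The renaming that identifies the variables `0` and `1` with `z`. -/
def merge (z : ℕ) : ℕ → ℕ
  | 0 => z
  | 1 => z
  | x + 2 => x

end Term

/-! ### Sharing graphs -/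

namespace Graph

/-- The list of free variable occurrences of a graph. -/
def fvs : Graph → List ℕ
  | .var x => [x]
  | .lam G => G.fvs.filterMap lower
  | .app G H => G.fvs ++ H.fvs
  | .share P N => P.fvs ++ (N.fvs.filterMap lower).filterMap lower

theorem readback_share (P N : Graph) : (share P N).readback = N.readback.subst fun
      | 0 => P.readback
      | 1 => P.readback
      | x + 2 => .var x := rfl

theorem readback_share_var (z : ℕ) (N : Graph) :
    (share (.var z) N).readback = N.readback.rename (Term.merge z) := by
  rw [Term.rename_eq_subst, readback_share]
  congr 1; funext x; rcases x with _ | _ | x <;> rfl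

theorem readback_rename (G : Graph) (ρ : ℕ → ℕ) :
    (G.rename ρ).readback = G.readback.rename ρ := by
  induction G generalizing ρ with
  | var x => rfl
  | lam G ih => simp only [rename, readback, Term.rename, ih]
  | app G H ih₁ ih₂ => simp only [rename, readback, Term.rename, ih₁, ih₂]
  | share P N ih₁ ih₂ =>
    simp only [rename, readback, ih₁, ih₂, Term.subst_rename, Term.rename_subst]
    congr 1; funext x; rcases x with _ | _ | x <;> rfl

theorem readback_subst (G : Graph) (s : ℕ → Graph) :
    (G.subst s).readback = G.readback.subst fun x => (s x).readback := by
  induction G generalizing s with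
  | var x => rfl
  | lam G ih =>
    simp only [subst, readback, Term.subst, ih]
    congr 2; funext x; cases x with
    | zero => rfl
    | succ x => simp only [liftSub, Term.liftSub, readback_rename]
  | app G H ih₁ ih₂ => simp only [subst, readback, Term.subst, ih₁, ih₂]
  | share P N ih₁ ih₂ =>
    simp only [subst, readback, ih₁, ih₂, Term.subst_subst]
    congr 1; funext x
    rcases x with _ | _ | x
    · rfl
    · rfl
    · simp only [liftSub, readback_rename, Term.subst_rename, Term.subst]
      exact Term.subst_var _

theorem readback_plug (H G : Graph) :
    (H.plug G).readback = H.readback.subst (Term.instZero G.readback) := by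
  rw [plug, readback_subst]
  congr 1; funext x; cases x <;> rfl

theorem fvs_rename (G : Graph) (ρ : ℕ → ℕ) : (G.rename ρ).fvs = G.fvs.map ρ := by
  induction G generalizing ρ with
  | var x => rfl
  | lam M ih =>
    simp only [rename, fvs, ih]
    rw [← flatMap_singleton_comp, ← flatMap_singleton_comp]
    exact filterMap_lower_flatMap _ _ _ rfl fun x => rfl
  | app M N ih₁ ih₂ => simp only [rename, fvs, ih₁, ih₂, List.map_append]
  | share P N ih₁ ih₂ =>
    simp only [rename, fvs, ih₁, ih₂, List.map_append]
    congr 1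
    rw [← flatMap_singleton_comp, ← flatMap_singleton_comp,
      filterMap_lower_flatMap _ _ (fun x => [liftRen ρ x]) rfl fun x => rfl]
    exact filterMap_lower_flatMap _ _ _ rfl fun x => rfl

theorem fvs_subst (G : Graph) (s : ℕ → Graph) :
    (G.subst s).fvs = G.fvs.flatMap fun x => (s x).fvs := by
  induction G generalizing s with
  | var x => simp [subst, fvs]
  | lam M ih =>
    simp only [subst, fvs, ih]
    refine filterMap_lower_flatMap _ _ _ rfl fun x => ?_
    simp only [liftSub, fvs_rename, filterMap_lower_map_succ]
  | app M N ih₁ ih₂ => simp only [subst, fvs, ih₁, ih₂, List.flatMap_append]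
  | share P N ih₁ ih₂ =>
    simp only [subst, fvs, ih₁, ih₂, List.flatMap_append]
    congr 1
    rw [filterMap_lower_flatMap _ _ (fun x => (liftSub s x).fvs) rfl]
    · refine filterMap_lower_flatMap _ _ _ rfl fun x => ?_
      simp only [liftSub, fvs_rename, filterMap_lower_map_succ]
    · intro x
      simp only [liftSub, fvs_rename, filterMap_lower_map_succ]

/-- The converse fails: if neither port of a fan is used, unfolding it erases the graph that it
faces. -/
theorem mem_fvs_of_mem_readback {G : Graph} {x : ℕ} (h : x ∈ G.readback.fvs) : x ∈ G.fvs := by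
  induction G generalizing x with
  | var y => exact h
  | lam G ih =>
    simp only [readback, Term.fvs, fvs, mem_filterMap_lower] at h ⊢
    exact ih h
  | app G H ih₁ ih₂ =>
    simp only [readback, Term.fvs, fvs, List.mem_append] at h ⊢
    exact h.imp ih₁ ih₂
  | share P N ih₁ ih₂ =>
    simp only [readback, Term.fvs_subst, List.mem_flatMap] at h
    simp only [fvs, List.mem_append, mem_filterMap_lower]
    obtain ⟨y, hy, hx⟩ := h
    rcases y with _ | _ | y
    · exact .inl (ih₁ hx)
    · exact .inl (ih₁ hx)
    · simp only [Term.fvs, List.mem_singleton] at hx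
      subst hx
      exact .inr (ih₂ hy)

end Graph

/-! ### Formulas -/

namespace Formula

variable {ι : Type*}

/-- The formula does not start with `!`. -/
def IsCore : Formula ι → Prop
  | .bang _ => False
  | _ => True

/-- The number of leading ! and the remaining core are determined by the formula. Comparing types
thus splits into an equation between exponents and one between cores, as unification does. -/
theorem iterate_bang_inj {A B : Formula ι} (hA : A.IsCore) (hB : B.IsCore) {m n : ℕ}
    (h : bang^[m] A = bang^[n] B) : m = n ∧ A = B := by
  induction m generalizing n with
  | zero =>
    cases n with
    | zero => exact ⟨rfl, h⟩
    | succ n =>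
      rw [Function.iterate_succ_apply', Function.iterate_zero_apply] at h
      subst h; exact hA.elim
  | succ m ih =>
    cases n with
    | zero =>
      rw [Function.iterate_succ_apply', Function.iterate_zero_apply] at h
      subst h; exact hB.elim
    | succ n =>
      rw [Function.iterate_succ_apply', Function.iterate_succ_apply'] at h
      obtain ⟨h₁, h₂⟩ := ih (bang.inj h)
      exact ⟨by rw [h₁], h₂⟩

theorem iterate_bang_left_cancel {A B : Formula ι} {n : ℕ} (h : bang^[n] A = bang^[n] B) :
    A = B :=
  Function.Injective.iterate (fun _ _ h => bang.inj h) n h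

theorem erase_iterate_bang (n : ℕ) (A : Formula ι) : (bang^[n] A).erase = A.erase := by
  induction n with
  | zero => rfl
  | succ n ih => rw [Function.iterate_succ_apply']; exact ih

theorem iterate_bang_add (m n : ℕ) (A : Formula ι) :
    bang^[m + n] A = bang^[m] (bang^[n] A) := Function.iterate_add_apply _ _ _ _

end Formula

end EAL

namespace EAL

/-! ### Leveled typings

A leveled typing assigns to every node of the syntax tree the number of boxes around it. -/

/-- Extend a sequence by a new first element. -/
def scons {α : Type*} (a : α) (f : ℕ → α) : ℕ → α
  | 0 => a
  | x + 1 => f x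

theorem scons_comp_liftRen {α : Type*} (a : α) (f : ℕ → α) (ρ : ℕ → ℕ) :
    (fun x => scons a f (liftRen ρ x)) = scons a fun x => f (ρ x) := by
  funext x; cases x <;> rfl

/-- `Leveled ℓ T d M A`: the root of `M` has level `d`, and `A` is the type of `M` outside all
boxes. For every free variable `x`, `ℓ x` is the level of its binder and `T x` is its type outside
all boxes. No box around the binder of a variable has an occurrence of this variable outside. -/
inductive Leveled {ι : Type*} : (ℕ → ℕ) → (ℕ → Formula ι) → ℕ → Term → Formula ι → Prop
  | var (ℓ : ℕ → ℕ) (T : ℕ → Formula ι) (d x : ℕ) : Leveled ℓ T d (.var x) (T x)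
  | lam {ℓ : ℕ → ℕ} {T : ℕ → Formula ι} {d d' : ℕ} {M : Term} {A B : Formula ι} :
      (∀ x ∈ (Term.lam M).fvs, ℓ x ≤ d) → (2 ≤ M.fvs.count 0 → ∃ A', A = .bang A') →
      Leveled (scons d ℓ) (scons (Formula.bang^[d] A) T) d' M (Formula.bang^[d] B) →
      Leveled ℓ T d (.lam M) (Formula.bang^[d] (.lolli A B))
  | app {ℓ : ℕ → ℕ} {T : ℕ → Formula ι} {d d₁ d₂ : ℕ} {M N : Term} {A B : Formula ι} :
      (∀ x ∈ (Term.app M N).fvs, ℓ x ≤ d) →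
      Leveled ℓ T d₁ M (Formula.bang^[d] (.lolli A B)) →
      Leveled ℓ T d₂ N (Formula.bang^[d] A) →
      Leveled ℓ T d (.app M N) (Formula.bang^[d] B)

namespace Leveled

variable {ι : Type*} {ℓ ℓ' : ℕ → ℕ} {T T' : ℕ → Formula ι} {d : ℕ} {M N : Term} {C : Formula ι}

theorem var_inv {x : ℕ} (h : Leveled ℓ T d (.var x) C) : C = T x := by cases h; rfl

theorem var_of_eq {x : ℕ} (h : C = T x) : Leveled ℓ T d (.var x) C := by subst h; exact .var _ _ _ _

theorem lam_inv (h : Leveled ℓ T d (.lam M) C) :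
    ∃ A B d', C = Formula.bang^[d] (.lolli A B) ∧ (∀ x ∈ (Term.lam M).fvs, ℓ x ≤ d) ∧
      (2 ≤ M.fvs.count 0 → ∃ A', A = .bang A') ∧
      Leveled (scons d ℓ) (scons (Formula.bang^[d] A) T) d' M (Formula.bang^[d] B) := by
  cases h with
  | lam h₁ h₂ h₃ => exact ⟨_, _, _, rfl, h₁, h₂, h₃⟩

theorem app_inv (h : Leveled ℓ T d (.app M N) C) :
    ∃ A B d₁ d₂, C = Formula.bang^[d] B ∧ (∀ x ∈ (Term.app M N).fvs, ℓ x ≤ d) ∧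
      Leveled ℓ T d₁ M (Formula.bang^[d] (.lolli A B)) ∧
      Leveled ℓ T d₂ N (Formula.bang^[d] A) := by
  cases h with
  | app h₁ h₂ h₃ => exact ⟨_, _, _, _, rfl, h₁, h₂, h₃⟩

/-- Only the free variables matter, and levels of binders may decrease. -/
theorem congr (h : Leveled ℓ T d M C) (hℓ : ∀ x ∈ M.fvs, ℓ' x ≤ ℓ x)
    (hT : ∀ x ∈ M.fvs, T' x = T x) : Leveled ℓ' T' d M C := by
  induction h generalizing ℓ' T' with
  | var ℓ T d x => exact var_of_eq (hT x (by simp [Term.fvs])).symm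
  | lam h₁ h₂ _ ih =>
    refine .lam (fun x hx => (hℓ x hx).trans (h₁ x hx)) h₂ (ih ?_ ?_)
    · intro x hx
      cases x with
      | zero => exact le_rfl
      | succ x => exact hℓ x (mem_filterMap_lower.2 hx)
    · intro x hx
      cases x with
      | zero => rfl
      | succ x => exact hT x (mem_filterMap_lower.2 hx)
  | app h₁ _ _ ih₁ ih₂ =>
    refine .app (fun x hx => (hℓ x hx).trans (h₁ x hx)) (ih₁ ?_ ?_) (ih₂ ?_ ?_)
    · exact fun x hx => hℓ x (List.mem_append_left _ hx)
    · exact fun x hx => hT x (List.mem_append_left _ hx)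
    · exact fun x hx => hℓ x (List.mem_append_right _ hx)
    · exact fun x hx => hT x (List.mem_append_right _ hx)

theorem rename_iff {ρ : ℕ → ℕ} :
    Leveled ℓ T d (M.rename ρ) C ↔ Leveled (fun x => ℓ (ρ x)) (fun x => T (ρ x)) d M C := by
  induction M generalizing ℓ T d C ρ with
  | var x =>
    exact ⟨fun h => var_of_eq h.var_inv, fun h => var_of_eq (x := ρ x) h.var_inv⟩
  | lam M ih =>
    constructor
    · intro h
      obtain ⟨A, B, d', rfl, h₁, h₂, h₃⟩ := lam_inv (M := M.rename (liftRen ρ)) h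
      rw [ih, scons_comp_liftRen, scons_comp_liftRen] at h₃
      rw [Term.count_zero_fvs_rename_liftRen] at h₂
      refine .lam (fun x hx => h₁ (ρ x) ?_) h₂ h₃
      have : (Term.lam (M.rename (liftRen ρ))).fvs = _ := Term.fvs_rename (.lam M) ρ
      rw [this]; exact List.mem_map_of_mem hx
    · intro h
      obtain ⟨A, B, d', rfl, h₁, h₂, h₃⟩ := h.lam_inv
      rw [← scons_comp_liftRen d ℓ ρ, ← scons_comp_liftRen _ T ρ] at h₃
      replace h₃ := ih.2 h₃
      rw [← Term.count_zero_fvs_rename_liftRen _ ρ] at h₂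
      refine .lam (fun x hx => ?_) h₂ h₃
      have : (Term.lam (M.rename (liftRen ρ))).fvs = _ := Term.fvs_rename (.lam M) ρ
      rw [this] at hx
      obtain ⟨y, hy, rfl⟩ := List.mem_map.1 hx
      exact h₁ y hy
  | app M N ih₁ ih₂ =>
    constructor
    · intro h
      obtain ⟨A, B, d₁, d₂, rfl, h₁, h₂, h₃⟩ :=
        app_inv (M := M.rename ρ) (N := N.rename ρ) h
      rw [ih₁] at h₂
      rw [ih₂] at h₃
      refine .app (fun x hx => h₁ (ρ x) ?_) h₂ h₃
      have : (Term.app (M.rename ρ) (N.rename ρ)).fvs = _ := Term.fvs_rename (.app M N) ρ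
      rw [this]; exact List.mem_map_of_mem hx
    · intro h
      obtain ⟨A, B, d₁, d₂, rfl, h₁, h₂, h₃⟩ := h.app_inv
      rw [← ih₁] at h₂
      rw [← ih₂] at h₃
      refine .app (fun x hx => ?_) h₂ h₃
      have : (Term.app (M.rename ρ) (N.rename ρ)).fvs = _ := Term.fvs_rename (.app M N) ρ
      rw [this] at hx
      obtain ⟨y, hy, rfl⟩ := List.mem_map.1 hx
      exact h₁ y hy

/-- Substitution; the levels of the nodes do not change. -/
theorem subst {s : ℕ → Term} (h : Leveled ℓ T d M C)
    (hs : ∀ x ∈ M.fvs, ∃ e, Leveled ℓ' T' e (s x) (T x))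
    (hℓ : ∀ x ∈ M.fvs, ∀ y ∈ (s x).fvs, ℓ' y ≤ ℓ x) : ∃ e, Leveled ℓ' T' e (M.subst s) C := by
  induction h generalizing ℓ' T' s with
  | var ℓ T d x => exact hs x (by simp [Term.fvs])
  | @lam ℓ T d d' M A B h₁ h₂ _ ih =>
    have key := @ih (scons d ℓ') (scons (Formula.bang^[d] A) T') (Term.liftSub s) ?_ ?_
    · obtain ⟨e, he⟩ := key
      rw [← Term.count_zero_fvs_subst_liftSub _ s] at h₂
      refine ⟨d, .lam (fun y hy => ?_) h₂ he⟩
      have : (Term.lam (M.subst (Term.liftSub s))).fvs = _ := Term.fvs_subst (.lam M) s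
      rw [this] at hy
      obtain ⟨x, hx, hy⟩ := List.mem_flatMap.1 hy
      exact (hℓ x hx y hy).trans (h₁ x hx)
    · intro x hx
      cases x with
      | zero => exact ⟨0, .var _ _ _ 0⟩
      | succ x =>
        obtain ⟨e, he⟩ := hs x (mem_filterMap_lower.2 hx)
        exact ⟨e, rename_iff.2 he⟩
    · intro x hx y hy
      cases x with
      | zero =>
        simp only [Term.liftSub, Term.fvs, List.mem_singleton] at hy
        subst hy; exact le_rfl
      | succ x =>
        simp only [Term.liftSub, Term.fvs_rename, List.mem_map] at hy
        obtain ⟨y, hy, rfl⟩ := hy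
        exact hℓ x (mem_filterMap_lower.2 hx) y hy
  | @app ℓ T d d₁ d₂ M N A B h₁ _ _ ih₁ ih₂ =>
    obtain ⟨e₁, he₁⟩ := ih₁ (fun x hx => hs x (List.mem_append_left _ hx))
      (fun x hx => hℓ x (List.mem_append_left _ hx))
    obtain ⟨e₂, he₂⟩ := ih₂ (fun x hx => hs x (List.mem_append_right _ hx))
      (fun x hx => hℓ x (List.mem_append_right _ hx))
    refine ⟨d, .app (fun y hy => ?_) he₁ he₂⟩
    have : (Term.app (M.subst s) (N.subst s)).fvs = _ := Term.fvs_subst (.app M N) s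
    rw [this] at hy
    obtain ⟨x, hx, hy⟩ := List.mem_flatMap.1 hy
    exact (hℓ x hx y hy).trans (h₁ x hx)

/-- One more box around the whole term. -/
theorem bang (h : Leveled ℓ T d M C) (hℓ : ∀ x, ℓ' x ≤ ℓ x + 1) :
    Leveled ℓ' (fun x => (T x).bang) (d + 1) M C.bang := by
  induction h generalizing ℓ' with
  | var ℓ T d x => exact .var _ _ _ x
  | @lam ℓ T d d' M A B h₁ h₂ _ ih =>
    rw [← Function.iterate_succ_apply' Formula.bang]
    refine .lam (d' := d' + 1) (fun x hx => (hℓ x).trans (Nat.succ_le_succ (h₁ x hx))) h₂ ?_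
    have := @ih (scons (d + 1) ℓ') (fun x => by
      cases x with
      | zero => exact le_rfl
      | succ x => exact hℓ x)
    rw [← Function.iterate_succ_apply' Formula.bang] at this
    refine this.congr (fun _ _ => le_rfl) fun x _ => ?_
    cases x with
    | zero => exact Function.iterate_succ_apply' _ _ _
    | succ x => rfl
  | @app ℓ T d d₁ d₂ M N A B h₁ _ _ ih₁ ih₂ =>
    rw [← Function.iterate_succ_apply' Formula.bang]
    refine .app (d₁ := d₁ + 1) (d₂ := d₂ + 1) (A := A)
      (fun x hx => (hℓ x).trans (Nat.succ_le_succ (h₁ x hx))) ?_ ?_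
    · rw [Function.iterate_succ_apply']; exact ih₁ hℓ
    · rw [Function.iterate_succ_apply']; exact ih₂ hℓ

end Leveled

/-- A term has a leveled typing in the context `Γ`, whose variables are outside all boxes and
occur more than once only with types `!A`. -/
def LeveledTyping {ι : Type*} (Γ : Ctx ι) (M : Term) (C : Formula ι) : Prop :=
  ∃ (T : ℕ → Formula ι) (d : ℕ), (∀ x ∈ M.fvs, Γ x = some (T x)) ∧
    (∀ x, 2 ≤ M.fvs.count x → ∃ A, T x = .bang A) ∧ Leveled (fun _ => 0) T d M C

end EAL

namespace EAL

/-! ### From sequent derivations to leveled typings -/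

theorem count_flatMap_instZero (l l₀ : List ℕ) (f : ℕ → List ℕ) (h₀ : f 0 = l₀)
    (hs : ∀ x, f (x + 1) = [x]) (y : ℕ) :
    (l.flatMap f).count y = l.count (y + 1) + l.count 0 * l₀.count y := by
  induction l with
  | nil => simp
  | cons a l ih =>
    rw [List.flatMap_cons, List.count_append, ih]
    cases a with
    | zero => simp [h₀, Nat.add_mul]; omega
    | succ a => simp [hs, List.count_cons]; split_ifs <;> omega

theorem Term.count_fvs_subst_instZero (M N : Term) (y : ℕ) :
    (M.subst (instZero N)).fvs.count y =
      M.fvs.count (y + 1) + M.fvs.count 0 * N.fvs.count y := by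
  rw [fvs_subst]
  exact count_flatMap_instZero _ _ _ rfl (fun _ => rfl) y

theorem count_map_merge (l : List ℕ) (z y : ℕ) :
    (l.map (Term.merge z)).count y =
      l.count (y + 2) + if z = y then l.count 0 + l.count 1 else 0 := by
  induction l with
  | nil => simp
  | cons a l ih =>
    rw [List.map_cons, List.count_cons, ih]
    rcases a with _ | _ | a
    · by_cases h : z = y <;> simp [Term.merge, h]; omega
    · by_cases h : z = y <;> simp [Term.merge, h]; omega
    · by_cases h : z = y <;> simp [Term.merge, h, List.count_cons]; omega

namespace Graph

theorem count_fvs_plug (H G : Graph) (y : ℕ) :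
    (H.plug G).fvs.count y = H.fvs.count (y + 1) + H.fvs.count 0 * G.fvs.count y := by
  rw [plug, fvs_subst]
  exact count_flatMap_instZero _ _ _ rfl (fun _ => rfl) y

theorem exists_readback_rename_eq_var {G : Graph} {ρ : ℕ → ℕ} :
    (∃ x, (G.rename ρ).readback = .var x) ↔ ∃ x, G.readback = .var x := by
  rw [readback_rename]
  cases G.readback <;> simp [Term.rename]

theorem sharesOnlyVariables_rename {G : Graph} {ρ : ℕ → ℕ} :
    (G.rename ρ).SharesOnlyVariables ↔ G.SharesOnlyVariables := by
  induction G generalizing ρ with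
  | var x => exact Iff.rfl
  | lam G ih => exact ih
  | app G H ih₁ ih₂ => exact and_congr ih₁ ih₂
  | share P N ih₁ ih₂ =>
    exact and_congr exists_readback_rename_eq_var (and_congr ih₁ ih₂)

/-- Substitution never turns an application or abstraction into a variable, so a fan that faces a
variable afterwards did so before. -/
theorem SharesOnlyVariables.of_subst {H : Graph} {s : ℕ → Graph}
    (h : (H.subst s).SharesOnlyVariables) : H.SharesOnlyVariables := by
  induction H generalizing s with
  | var x => trivial
  | lam G ih => exact ih (s := liftSub s) h
  | app G H ih₁ ih₂ => exact ⟨ih₁ h.1, ih₂ h.2⟩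
  | share P N ih₁ ih₂ =>
    obtain ⟨⟨x, hx⟩, h₁, h₂⟩ := h
    rw [readback_subst] at hx
    obtain ⟨y, hy, -⟩ := Term.eq_var_of_subst_eq_var hx
    exact ⟨⟨y, hy⟩, ih₁ h₁, ih₂ h₂⟩

theorem SharesOnlyVariables.of_subst_of_mem {H : Graph} {s : ℕ → Graph} {x : ℕ}
    (h : (H.subst s).SharesOnlyVariables) (hx : x ∈ H.fvs) : (s x).SharesOnlyVariables := by
  induction H generalizing s x with
  | var y =>
    simp only [fvs, List.mem_singleton] at hx
    subst hx; exact h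
  | lam G ih =>
    exact sharesOnlyVariables_rename.1 (ih (s := liftSub s) h (mem_filterMap_lower.1 hx))
  | app G H ih₁ ih₂ =>
    rcases List.mem_append.1 hx with hx | hx
    · exact ih₁ h.1 hx
    · exact ih₂ h.2 hx
  | share P N ih₁ ih₂ =>
    rcases List.mem_append.1 hx with hx | hx
    · exact ih₁ h.2.1 hx
    · exact sharesOnlyVariables_rename.1 (sharesOnlyVariables_rename.1
        (ih₂ (s := liftSub (liftSub s)) h.2.2 (mem_filterMap_lower.1 (mem_filterMap_lower.1 hx))))

/-- In a graph that uses `x` at most once, several occurrences of `x` in the readback come from a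
fan that faces `x`. -/
theorem SharesOnlyVariables.readback_eq_var {H : Graph} {s : ℕ → Graph} {x : ℕ}
    (h : (H.subst s).SharesOnlyVariables) (h₁ : H.fvs.count x ≤ 1)
    (h₂ : 2 ≤ H.readback.fvs.count x) : ∃ y, (s x).readback = .var y := by
  induction H generalizing s x with
  | var y =>
    simp only [readback, Term.fvs] at h₂
    simp only [fvs] at h₁
    omega
  | lam G ih =>
    simp only [readback, Term.fvs, fvs, count_filterMap_lower] at h₁ h₂
    exact exists_readback_rename_eq_var.1 (ih (s := liftSub s) h h₁ h₂)
  | app G H ih₁ ih₂ =>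
    simp only [readback, Term.fvs, fvs, List.count_append] at h₁ h₂
    by_cases hG : x ∈ G.fvs
    · have := List.count_pos_iff.2 hG
      have hH : x ∉ H.readback.fvs := fun hx => by
        have := List.count_pos_iff.2 (mem_fvs_of_mem_readback hx); omega
      rw [List.count_eq_zero.2 hH] at h₂
      exact ih₁ h.1 (by omega) h₂
    · have hG' : x ∉ G.readback.fvs := fun hx => hG (mem_fvs_of_mem_readback hx)
      rw [List.count_eq_zero.2 hG'] at h₂
      exact ih₂ h.2 (by omega) (by omega)
  | share P N ih₁ ih₂ =>
    obtain ⟨⟨z, hz⟩, -, hN⟩ := h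
    simp only [fvs, List.count_append, count_filterMap_lower] at h₁
    by_cases hP : x ∈ P.readback.fvs
    -- Here the fan itself faces `x`, and what it faces after the substitution is a variable.
    · rw [readback_subst] at hz
      obtain ⟨y, hy, hyz⟩ := Term.eq_var_of_subst_eq_var hz
      rw [hy] at hP
      simp only [Term.fvs, List.mem_singleton] at hP
      subst hP
      exact ⟨z, hyz⟩
    · have : (share P N).readback.fvs.count x = N.readback.fvs.count (x + 2) := by
        rw [readback_share, Term.fvs_subst]
        induction N.readback.fvs with
        | nil => rfl
        | cons a l ih =>
          rw [List.flatMap_cons, List.count_append, ih]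
          rcases a with _ | _ | a
          · simp [List.count_eq_zero.2 hP]
          · simp [List.count_eq_zero.2 hP]
          · simp only [Term.fvs, List.count_cons, List.count_nil, beq_iff_eq, Nat.zero_add,
              show a + 1 + 1 = x + 2 ↔ a = x by omega]
            rw [Nat.add_comm]
      rw [this] at h₂
      exact exists_readback_rename_eq_var.1 (exists_readback_rename_eq_var.1
        (ih₂ (s := liftSub (liftSub s)) hN (le_trans (Nat.le_add_left _ _) h₁) h₂))

end Graph

section

variable {ι : Type*}

theorem Ctx.mem_dom {Γ : Ctx ι} {x : ℕ} : x ∈ Γ.dom ↔ Γ x ≠ none := Iff.rfl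

theorem Ctx.union_eq_none {Γ Δ : Ctx ι} {x : ℕ} :
    Γ.union Δ x = none ↔ Γ x = none ∧ Δ x = none := by
  simp [Ctx.union]

/-- The graph of a derivation uses every variable at most once. -/
theorem Derives.count_fvs {Γ : Ctx ι} {G : Graph} {A : Formula ι} (h : Derives Γ G A) (x : ℕ) :
    G.fvs.count x ≤ 1 ∧ (Γ x = none → G.fvs.count x = 0) := by
  -- The computation common to (cut) and (⊸L): the variable plugged into occurs at most once in the
  -- graph, so nothing is duplicated.
  have plug : ∀ {Γ Δ : Ctx ι} {G H : Graph} {A : Formula ι}, Disjoint Γ.dom Δ.dom →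
      (∀ x, G.fvs.count x ≤ 1 ∧ (Γ x = none → G.fvs.count x = 0)) →
      (∀ x, H.fvs.count x ≤ 1 ∧ (Ctx.cons A Δ x = none → H.fvs.count x = 0)) →
      ∀ x, (H.plug G).fvs.count x ≤ 1 ∧ (Γ.union Δ x = none → (H.plug G).fvs.count x = 0) := by
    intro Γ Δ G H A hd hG hH x
    rw [Graph.count_fvs_plug, Ctx.union_eq_none]
    have h₁ := hG x
    have h₂ := hH (x + 1)
    have h₃ := (hH 0).1
    have h₄ : H.fvs.count 0 * G.fvs.count x ≤ 1 * G.fvs.count x := Nat.mul_le_mul_right _ h₃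
    have h₅ : Γ x = none ∨ Δ x = none := by
      by_contra hc
      push Not at hc
      exact Set.disjoint_left.1 hd hc.1 hc.2
    simp only [Ctx.cons] at h₂
    rcases h₅ with h₅ | h₅
    · have := h₁.2 h₅
      exact ⟨by omega, fun h => by have := h₂.2 h.2; omega⟩
    · have := h₂.2 h₅
      exact ⟨by omega, fun h => by have := h₁.2 h.1; omega⟩
  induction h generalizing x with
  | ax y A =>
    simp only [Graph.fvs, Ctx.single]
    by_cases h : x = y
    · subst h; simp
    · simp [h, Ne.symm h]
  | cut hd _ _ ih₁ ih₂ => exact plug hd ih₁ ih₂ x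
  | weak y A hy _ ih =>
    refine ⟨(ih x).1, fun h => (ih x).2 ?_⟩
    by_cases hxy : x = y
    · subst hxy; simp [Ctx.add] at h
    · simpa [Ctx.add, hxy] using h
  | @contr Γ G A B z hz _ ih =>
    have h₁ := ih (x + 2)
    simp only [Ctx.cons] at h₁
    simp only [Graph.fvs, List.count_append, count_filterMap_lower]
    by_cases h : x = z
    · subst h
      have := h₁.2 (by simpa [Ctx.mem_dom] using hz)
      simp [Ctx.add, this]
    · simpa [h, Ne.symm h, Ctx.add] using h₁
  | lolliR _ ih =>
    simp only [Graph.fvs, count_filterMap_lower]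
    exact ih (x + 1)
  | @lolliL Γ Δ G H A B C f hd hf₁ hf₂ _ _ ih₁ ih₂ =>
    have hd' : Disjoint (Γ.add f (.lolli A B)).dom Δ.dom := by
      rw [Set.disjoint_left] at hd ⊢
      intro y hy
      by_cases hyf : y = f
      · subst hyf; exact hf₂
      · exact hd (by simpa [Ctx.mem_dom, Ctx.add, hyf] using hy)
    have := plug (G := .app (.var f) G) hd' (fun y => ?_) ih₂ x
    · refine ⟨this.1, fun h => this.2 ?_⟩
      by_cases hxf : x = f
      · subst hxf; simp [Ctx.add] at h
      · simpa [Ctx.union, Ctx.add, hxf] using h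
    · have h₁ := ih₁ y
      simp only [Graph.fvs, List.count_append]
      by_cases hyf : y = f
      · subst hyf
        have := h₁.2 (by simpa [Ctx.mem_dom] using hf₁)
        simp [Ctx.add, this]
      · simpa [hyf, Ne.symm hyf, Ctx.add] using h₁
  | bang _ ih =>
    refine ⟨(ih x).1, fun h => (ih x).2 ?_⟩
    simpa [Ctx.bang] using h

namespace LeveledTyping

/-- All context variables have level 0, so the level condition survives with unchanged levels. The
delicate point is the condition on repeated variables, since copies of `N` multiply its free
variables. By `hlin` an `N` copied several times is a variable; it has the type of the variable it
replaces, which starts with !. -/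
theorem subst {Γ Δ : Ctx ι} {M N : Term} {A B : Formula ι} (hd : Disjoint Γ.dom Δ.dom)
    (hM : LeveledTyping (Ctx.cons A Δ) M B) (hN : 0 ∈ M.fvs → LeveledTyping Γ N A)
    (hlin : 2 ≤ M.fvs.count 0 → ∃ y, N = .var y) :
    LeveledTyping (Γ.union Δ) (M.subst (Term.instZero N)) B := by
  obtain ⟨T, d, hT, hc, hL⟩ := hM
  have hΔ : ∀ y, y + 1 ∈ M.fvs → Γ y = none ∧ Γ.union Δ y = some (T (y + 1)) := by
    intro y hy
    have h₁ : Δ y = some (T (y + 1)) := hT _ hy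
    have h₂ : Γ y = none := by
      by_contra h
      exact Set.disjoint_left.1 hd h (by simp [Ctx.mem_dom, h₁])
    exact ⟨h₂, by simp [Ctx.union, h₁, h₂]⟩
  by_cases h0 : 0 ∈ M.fvs
  · obtain ⟨U, e, hU, hUc, hUL⟩ := hN h0
    have hA : A = T 0 := Option.some.inj (hT 0 h0)
    have hΓ : ∀ y ∈ N.fvs, Γ.union Δ y = some (U y) := fun y hy => by
      simp [Ctx.union, hU y hy]
    -- Only the values at free variables matter; `B` is an arbitrary default.
    let T' : ℕ → Formula ι := fun y => (Γ.union Δ y).getD B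
    have hlev : ∃ d', Leveled (fun _ => 0) T' d' (M.subst (Term.instZero N)) B := by
      refine hL.subst ?_ fun _ _ _ _ => le_rfl
      intro x hx
      cases x with
      | zero =>
        refine ⟨e, ?_⟩
        rw [← hA]
        exact hUL.congr (fun _ _ => le_rfl) fun y hy => by simp [T', hΓ y hy]
      | succ x => exact ⟨0, Leveled.var_of_eq (by simp [T', hΔ x hx])⟩
    obtain ⟨d', hlev⟩ := hlev
    refine ⟨T', d', ?_, ?_, hlev⟩
    · intro y hy
      rw [Term.fvs_subst] at hy
      obtain ⟨x, hx, hy⟩ := List.mem_flatMap.1 hy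
      cases x with
      | zero => simp [T', hΓ y hy]
      | succ x =>
        simp only [Term.instZero, Term.fvs, List.mem_singleton] at hy
        subst hy
        simp [T', hΔ _ hx]
    · intro y hy
      rw [Term.count_fvs_subst_instZero] at hy
      by_cases hyN : y ∈ N.fvs
      · have h₁ : M.fvs.count (y + 1) = 0 := List.count_eq_zero.2 fun h => by
          have := (hΔ y h).1
          rw [hU y hyN] at this
          cases this
        have h₂ : T' y = U y := by simp [T', hΓ y hyN]
        rw [h₂]
        rw [h₁, Nat.zero_add] at hy
        by_cases h₃ : 2 ≤ M.fvs.count 0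
        · obtain ⟨z, rfl⟩ := hlin h₃
          simp only [Term.fvs, List.mem_singleton] at hyN
          subst hyN
          rw [← hUL.var_inv, hA]
          exact hc 0 h₃
        · have := List.count_pos_iff.2 h0
          rw [show M.fvs.count 0 = 1 by omega, Nat.one_mul] at hy
          exact hUc y hy
      · rw [List.count_eq_zero.2 hyN, Nat.mul_zero, Nat.add_zero] at hy
        have h₁ : y + 1 ∈ M.fvs := List.count_pos_iff.1 (by omega)
        have h₂ : T' y = T (y + 1) := by simp [T', hΔ y h₁]
        rw [h₂]
        exact hc _ hy
  -- The variable does not occur: `N` disappears, and no typing of it is available or needed.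
  · have hfv : ∀ y, (M.subst (Term.instZero N)).fvs.count y = M.fvs.count (y + 1) := by
      intro y
      rw [Term.count_fvs_subst_instZero, List.count_eq_zero.2 h0, Nat.zero_mul, Nat.add_zero]
    have hlev : ∃ d', Leveled (fun _ => 0) (fun x => T (x + 1)) d'
        (M.subst (Term.instZero N)) B := by
      refine hL.subst ?_ fun _ _ _ _ => le_rfl
      intro x hx
      cases x with
      | zero => exact absurd hx h0
      | succ x => exact ⟨0, .var _ _ _ x⟩
    obtain ⟨d', hlev⟩ := hlev
    refine ⟨_, d', ?_, ?_, hlev⟩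
    · intro y hy
      rw [← List.count_pos_iff, hfv, List.count_pos_iff] at hy
      exact (hΔ y hy).2
    · intro y hy
      rw [hfv] at hy
      exact hc _ hy

/-- At a cut, the variable occurs at most once in the sharing graph. Several occurrences in the
readback are thus due to a fan, and after plugging this fan must still face a variable. -/
theorem of_derives {Γ : Ctx ι} {G : Graph} {A : Formula ι} (h : Derives Γ G A)
    (hG : G.SharesOnlyVariables) : LeveledTyping Γ G.readback A := by
  have plug : ∀ {Γ Δ : Ctx ι} {G H : Graph} {A B : Formula ι}, Disjoint Γ.dom Δ.dom →
      (H.plug G).SharesOnlyVariables → Derives (Ctx.cons A Δ) H B →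
      LeveledTyping (Ctx.cons A Δ) H.readback B →
      (G.SharesOnlyVariables → LeveledTyping Γ G.readback A) →
      LeveledTyping (Γ.union Δ) (H.plug G).readback B := by
    intro Γ Δ G H A B hd hs hH hM hN
    rw [Graph.readback_plug]
    refine hM.subst hd (fun h0 => hN ?_) fun h2 => ?_
    · exact hs.of_subst_of_mem (x := 0) (Graph.mem_fvs_of_mem_readback h0)
    · exact hs.readback_eq_var (x := 0) (hH.count_fvs 0).1 h2
  induction h with
  | ax x A =>
    refine ⟨fun _ => A, 0, ?_, ?_, .var _ _ _ x⟩
    · intro y hy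
      simp only [Graph.readback, Term.fvs, List.mem_singleton] at hy
      subst hy; simp [Ctx.single]
    · intro y hy
      have : [x].count y ≤ [x].length := List.count_le_length
      simp only [Graph.readback, Term.fvs] at hy
      simp only [List.length_singleton] at this
      omega
  | cut hd _ h₂ ih₁ ih₂ => exact plug hd hG h₂ (ih₂ hG.of_subst) ih₁
  | weak x A hx _ ih =>
    obtain ⟨T, d, hT, hc, hL⟩ := ih hG
    refine ⟨T, d, fun y hy => ?_, hc, hL⟩
    have hyx : y ≠ x := by
      rintro rfl
      exact hx (by simp [Ctx.mem_dom, hT y hy])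
    simpa [Ctx.add, hyx] using hT y hy
  | @contr Γ G A B z hz _ ih =>
    obtain ⟨T, d, hT, hc, hL⟩ := ih hG.2.2
    rw [Graph.readback_share_var]
    have key : ∀ x ∈ G.readback.fvs, Γ.add z A.bang (Term.merge z x) = some (T x) := by
      intro x hx
      rw [← hT x hx]
      rcases x with _ | _ | x
      · simp [Term.merge, Ctx.add, Ctx.cons]
      · simp [Term.merge, Ctx.add, Ctx.cons]
      · have hxz : x ≠ z := by
          rintro rfl
          have := hT _ hx
          exact hz (by simp [Ctx.mem_dom, show Γ x = some _ from this])
        simp [Term.merge, Ctx.add, Ctx.cons, hxz]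
    let T' : ℕ → Formula ι := fun y => (Γ.add z A.bang y).getD B
    refine ⟨T', d, ?_, ?_, ?_⟩
    · intro y hy
      rw [Term.fvs_rename] at hy
      obtain ⟨x, hx, rfl⟩ := List.mem_map.1 hy
      simp [T', key x hx]
    · intro y hy
      rw [Term.fvs_rename, count_map_merge] at hy
      by_cases hyz : z = y
      · subst hyz; exact ⟨A, by simp [T', Ctx.add]⟩
      · rw [if_neg hyz, Nat.add_zero] at hy
        have := key (y + 2) (List.count_pos_iff.1 (by omega))
        simp only [Term.merge] at this
        obtain ⟨C, hC⟩ := hc _ hy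
        exact ⟨C, by simp [T', this, hC]⟩
    · rw [Leveled.rename_iff]
      exact hL.congr (fun _ _ => le_rfl) fun x hx => by simp [T', key x hx]
  | @lolliR Γ G A B _ ih =>
    obtain ⟨T, d, hT, hc, hL⟩ := ih hG
    refine ⟨fun x => T (x + 1), 0, fun x hx => hT (x + 1) (mem_filterMap_lower.1 hx),
      fun x hx => hc (x + 1) ?_, ?_⟩
    · simpa only [Graph.readback, Term.fvs, count_filterMap_lower] using hx
    · refine Leveled.lam (d := 0) (d' := d) (fun _ _ => le_rfl) (fun h => ?_) (hL.congr ?_ ?_)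
      · obtain ⟨A', hA'⟩ := hc 0 h
        have := hT 0 (List.count_pos_iff.1 (by omega))
        exact ⟨A', (Option.some.inj this).trans hA'⟩
      · intro x _; cases x <;> exact le_rfl
      · intro x hx
        cases x with
        | zero => exact Option.some.inj (hT 0 hx)
        | succ x => rfl
  | @lolliL Γ Δ G H A B C f hd hf₁ hf₂ h₁ h₂ ih₁ ih₂ =>
    have hd' : Disjoint (Γ.add f (.lolli A B)).dom Δ.dom := by
      rw [Set.disjoint_left] at hd ⊢
      intro y hy
      by_cases hyf : y = f
      · subst hyf; exact hf₂
      · exact hd (by simpa [Ctx.mem_dom, Ctx.add, hyf] using hy)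
    have hΓ : (Γ.union Δ).add f (.lolli A B) = (Γ.add f (.lolli A B)).union Δ := by
      funext y
      by_cases hyf : y = f
      · subst hyf; simp [Ctx.add, Ctx.union]
      · simp [Ctx.add, Ctx.union, hyf]
    rw [hΓ]
    refine plug hd' hG h₂ (ih₂ hG.of_subst) fun hs => ?_
    obtain ⟨T, d, hT, hc, hL⟩ := ih₁ hs.2
    have hf : f ∉ G.readback.fvs := fun h => hf₁ (by simp [Ctx.mem_dom, hT f h])
    have hfn : ∀ x ∈ G.readback.fvs, x ≠ f := fun x hx h => hf (h ▸ hx)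
    -- The new application node gets level 0, and the levels inside the argument stay.
    refine ⟨Function.update T f (.lolli A B), 0, ?_, ?_, ?_⟩
    · intro x hx
      simp only [Graph.readback, Term.fvs, List.mem_append, List.mem_singleton] at hx
      by_cases hxf : x = f
      · subst hxf; simp [Ctx.add]
      · simpa [Ctx.add, hxf] using hT x (hx.resolve_left hxf)
    · intro x hx
      simp only [Graph.readback, Term.fvs, List.count_append] at hx
      by_cases hxf : x = f
      · subst hxf
        rw [List.count_eq_zero.2 hf] at hx
        simp at hx
      · simp only [List.count_cons_of_ne (Ne.symm hxf), List.count_nil, Nat.zero_add] at hx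
        simpa [hxf] using hc x hx
    · refine Leveled.app (d := 0) (d₁ := 0) (d₂ := d) (A := A) (fun _ _ => le_rfl)
        (Leveled.var_of_eq ?_) (hL.congr (fun _ _ => le_rfl) fun x hx => ?_)
      · simp
      · simp [hfn x hx]
  | bang _ ih =>
    obtain ⟨T, d, hT, hc, hL⟩ := ih hG
    exact ⟨fun x => (T x).bang, d + 1, fun x hx => by simp [Ctx.bang, hT x hx],
      fun x _ => ⟨T x, rfl⟩, hL.bang fun _ => Nat.zero_le _⟩

end LeveledTyping

theorem Typing.leveledTyping {Γ : Ctx ι} {M : Term} {A : Formula ι} (h : Typing Γ M A) :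
    LeveledTyping Γ M A := by
  obtain ⟨G, hG, rfl, hs⟩ := h
  exact .of_derives hG hs

end

end EAL

namespace EAL

/-! ### From leveled typings to sequent derivations -/

namespace Graph

/-- Every fan faces a variable. -/
def Plain : Graph → Prop
  | .var _ => True
  | .lam G => G.Plain
  | .app G H => G.Plain ∧ H.Plain
  | .share P N => (∃ z, P = .var z) ∧ N.Plain

/-- Some fan faces the free variable `x`. -/
def Faces : Graph → ℕ → Prop
  | .var _, _ => False
  | .lam G, x => G.Faces (x + 1)
  | .app G H, x => G.Faces x ∨ H.Faces x
  | .share P N, x => P = .var x ∨ N.Faces (x + 2)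

theorem Plain.sharesOnlyVariables {G : Graph} (h : G.Plain) : G.SharesOnlyVariables := by
  induction G with
  | var x => trivial
  | lam G ih => exact ih h
  | app G H ih₁ ih₂ => exact ⟨ih₁ h.1, ih₂ h.2⟩
  | share P N _ ih₂ =>
    obtain ⟨⟨z, rfl⟩, h⟩ := h
    exact ⟨⟨z, rfl⟩, trivial, ih₂ h⟩

theorem Plain.rename {G : Graph} (h : G.Plain) (ρ : ℕ → ℕ) : (G.rename ρ).Plain := by
  induction G generalizing ρ with
  | var x => trivial
  | lam G ih => exact ih h _
  | app G H ih₁ ih₂ => exact ⟨ih₁ h.1 _, ih₂ h.2 _⟩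
  | share P N _ ih₂ =>
    obtain ⟨⟨z, rfl⟩, h⟩ := h
    exact ⟨⟨ρ z, rfl⟩, ih₂ h _⟩

theorem Faces.of_rename {G : Graph} (hG : G.Plain) {ρ : ℕ → ℕ} {y : ℕ}
    (h : (G.rename ρ).Faces y) : ∃ x, G.Faces x ∧ ρ x = y := by
  induction G generalizing ρ y with
  | var x => exact h.elim
  | lam G ih =>
    obtain ⟨x, hx, hy⟩ := ih hG (ρ := liftRen ρ) h
    cases x with
    | zero => cases hy
    | succ x => exact ⟨x, hx, Nat.succ.inj hy⟩
  | app G H ih₁ ih₂ =>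
    rcases h with h | h
    · obtain ⟨x, hx, hy⟩ := ih₁ hG.1 h
      exact ⟨x, .inl hx, hy⟩
    · obtain ⟨x, hx, hy⟩ := ih₂ hG.2 h
      exact ⟨x, .inr hx, hy⟩
  | share P N _ ih₂ =>
    obtain ⟨⟨z, rfl⟩, hN⟩ := hG
    rcases h with h | h
    · exact ⟨z, .inl rfl, var.inj h⟩
    · obtain ⟨x, hx, hy⟩ := ih₂ hN (ρ := liftRen (liftRen ρ)) h
      rcases x with _ | _ | x
      · cases hy
      · cases hy
      · exact ⟨x, .inr hx, Nat.succ.inj (Nat.succ.inj hy)⟩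

theorem Plain.liftSub {s : ℕ → Graph} (hs : ∀ x, (s x).Plain) (x : ℕ) :
    (Graph.liftSub s x).Plain := by
  cases x with
  | zero => trivial
  | succ x => exact (hs x).rename _

theorem Faces.of_liftSub {s : ℕ → Graph} (hs : ∀ x, (s x).Plain) {x y : ℕ}
    (h : (liftSub s x).Faces (y + 1)) : ∃ x, (s x).Faces y := by
  cases x with
  | zero => exact h.elim
  | succ x =>
    obtain ⟨z, hz, hy⟩ := Faces.of_rename (hs x) h
    obtain rfl := Nat.succ.inj hy
    exact ⟨x, hz⟩

theorem eq_var_of_liftSub {s : ℕ → Graph} {x y : ℕ} (h : liftSub s x = .var (y + 1)) :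
    ∃ x', x = x' + 1 ∧ s x' = .var y := by
  cases x with
  | zero => cases h
  | succ x =>
    refine ⟨x, rfl, ?_⟩
    simp only [liftSub] at h
    cases hx : s x with
    | var z =>
      rw [hx] at h
      rw [Nat.succ.inj (var.inj h)]
    | lam G => rw [hx] at h; cases h
    | app G H => rw [hx] at h; cases h
    | share P N => rw [hx] at h; cases h

/-- Only a variable may be substituted where a fan faces it, whereas the other variables may receive
any plain graph. For this reason the faced variables are tracked by `Faces`. -/
theorem Plain.subst {H : Graph} (hH : H.Plain) {s : ℕ → Graph} (hs : ∀ x, (s x).Plain)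
    (hf : ∀ x, H.Faces x → ∃ y, s x = .var y) : (H.subst s).Plain := by
  have lift : ∀ {s : ℕ → Graph} {x : ℕ}, (∃ y, s x = .var y) →
      ∃ y, Graph.liftSub s (x + 1) = .var y := by
    rintro s x ⟨y, hy⟩
    exact ⟨y + 1, by simp only [Graph.liftSub, hy]; rfl⟩
  induction H generalizing s with
  | var x => exact hs x
  | lam G ih =>
    refine ih hH (Plain.liftSub hs) fun x hx => ?_
    cases x with
    | zero => exact ⟨0, rfl⟩
    | succ x => exact lift (hf x hx)
  | app G H ih₁ ih₂ =>
    exact ⟨ih₁ hH.1 hs fun x hx => hf x (.inl hx), ih₂ hH.2 hs fun x hx => hf x (.inr hx)⟩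
  | share P N _ ih₂ =>
    obtain ⟨⟨z, rfl⟩, hN⟩ := hH
    refine ⟨hf z (.inl rfl), ih₂ hN (Plain.liftSub (Plain.liftSub hs)) fun x hx => ?_⟩
    rcases x with _ | _ | x
    · exact ⟨0, rfl⟩
    · exact ⟨1, rfl⟩
    · exact lift (lift (hf x (.inr hx)))

theorem Faces.of_subst {H : Graph} (hH : H.Plain) {s : ℕ → Graph} (hs : ∀ x, (s x).Plain)
    {y : ℕ} (h : (H.subst s).Faces y) :
    (∃ x, (s x).Faces y) ∨ ∃ x, H.Faces x ∧ s x = .var y := by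
  induction H generalizing s y with
  | var x => exact .inl ⟨x, h⟩
  | lam G ih =>
    rcases ih hH (Plain.liftSub hs) h with ⟨x, hx⟩ | ⟨x, hx, hy⟩
    · exact .inl (Faces.of_liftSub hs hx)
    · obtain ⟨x, rfl, hy'⟩ := eq_var_of_liftSub hy
      exact .inr ⟨x, hx, hy'⟩
  | app G H ih₁ ih₂ =>
    rcases h with h | h
    · exact (ih₁ hH.1 hs h).imp_right fun ⟨x, hx, hy⟩ => ⟨x, .inl hx, hy⟩
    · exact (ih₂ hH.2 hs h).imp_right fun ⟨x, hx, hy⟩ => ⟨x, .inr hx, hy⟩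
  | share P N _ ih₂ =>
    obtain ⟨⟨z, rfl⟩, hN⟩ := hH
    rcases h with h | h
    · exact .inr ⟨z, .inl rfl, h⟩
    · rcases ih₂ hN (Plain.liftSub (Plain.liftSub hs)) h with ⟨x, hx⟩ | ⟨x, hx, hy⟩
      · obtain ⟨x, hx⟩ := Faces.of_liftSub (Plain.liftSub hs) hx
        exact .inl (Faces.of_liftSub hs hx)
      · obtain ⟨x, rfl, hy'⟩ := eq_var_of_liftSub hy
        obtain ⟨x, rfl, hy''⟩ := eq_var_of_liftSub hy'
        exact .inr ⟨x, .inr hx, hy''⟩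

end Graph

/-! ### Giving one of several occurrences a name of its own -/

namespace Term

/-- Every choice of names for the free variable occurrences is realized by a term. -/
theorem exists_fvs_eq (M : Term) (ρ : ℕ → ℕ) (l : List ℕ) (h : l.map ρ = M.fvs) :
    ∃ M' : Term, M'.fvs = l ∧ M'.rename ρ = M := by
  induction M generalizing ρ l with
  | var x =>
    simp only [fvs, List.map_eq_singleton_iff] at h
    obtain ⟨y, rfl, rfl⟩ := h
    exact ⟨.var y, rfl, rfl⟩
  | lam M ih =>
    -- The names under the binder: bound positions of `m` stay 0, and the other positions take the
    -- names in `l`, raised by one.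
    have key : ∀ (m l : List ℕ), l.map ρ = m.filterMap lower →
        ∃ l' : List ℕ, l'.map (liftRen ρ) = m ∧ l'.filterMap lower = l := by
      intro m
      induction m with
      | nil =>
        intro l hl
        refine ⟨[], rfl, ?_⟩
        simpa using hl.symm
      | cons a m ihm =>
        intro l hl
        cases a with
        | zero =>
          rw [List.filterMap_cons_none (show lower 0 = none from rfl)] at hl
          obtain ⟨l', h₁, h₂⟩ := ihm l hl
          refine ⟨0 :: l', by simp [h₁, liftRen], ?_⟩
          rw [List.filterMap_cons_none (show lower 0 = none from rfl), h₂]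
        | succ a =>
          rw [List.filterMap_cons_some (show lower (a + 1) = some a from rfl)] at hl
          obtain ⟨b, l, rfl, rfl, hl'⟩ := List.map_eq_cons_iff.1 hl
          obtain ⟨l', h₁, h₂⟩ := ihm l hl'
          refine ⟨(b + 1) :: l', by simp [h₁, liftRen], ?_⟩
          rw [List.filterMap_cons_some (show lower (b + 1) = some b from rfl), h₂]
    obtain ⟨l', h₁, h₂⟩ := key _ l h
    obtain ⟨M', h₃, h₄⟩ := ih (liftRen ρ) l' h₁
    exact ⟨.lam M', by simp only [fvs, h₃, h₂], by simp only [rename, h₄]⟩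
  | app M N ih₁ ih₂ =>
    obtain ⟨l₁, l₂, rfl, h₁, h₂⟩ := List.map_eq_append_iff.1 h
    obtain ⟨M', h₃, h₄⟩ := ih₁ ρ l₁ h₁
    obtain ⟨N', h₅, h₆⟩ := ih₂ ρ l₂ h₂
    exact ⟨.app M' N', by simp only [fvs, h₃, h₅], by simp only [rename, h₄, h₆]⟩

/-- The number of variable occurrences beyond the first one of each variable. -/
def excess (M : Term) : ℕ := M.fvs.length - M.fvs.toFinset.card

/-- One occurrence of a variable that occurs several times can be given a name of its own. -/
theorem exists_rename_merge (M : Term) (x : ℕ) (h : 2 ≤ M.fvs.count x) :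
    ∃ M' : Term, M'.rename (merge x) = M ∧ M'.fvs.count 0 = 1 ∧ 1 ∈ M'.fvs ∧
      x + 2 ∉ M'.fvs ∧ (∀ y, y ≠ x → M'.fvs.count (y + 2) = M.fvs.count y) ∧
      M'.excess < M.excess := by
  obtain ⟨l₁, l₂, hl⟩ := List.append_of_mem (List.count_pos_iff.1 (show 0 < M.fvs.count x by omega))
  -- The occurrence between `l₁` and `l₂` will be named 0. The other occurrences of `x` are named 1,
  -- and all other variables move up by two, which `merge x` undoes.
  let g : ℕ → ℕ := fun y => if y = x then 1 else y + 2
  have hg : ∀ y, merge x (g y) = y := by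
    intro y
    by_cases hy : y = x
    · simp [g, hy, merge]
    · simp [g, hy, merge]
  have hginj : Function.Injective g := fun a b hab => by rw [← hg a, hab, hg]
  have hx : x ∈ l₁ ++ l₂ := by
    rw [hl] at h
    simp only [List.count_append, List.count_cons_self] at h
    exact List.count_pos_iff.1 (by rw [List.count_append]; omega)
  have h0 : ∀ l : List ℕ, (l.map g).count 0 = 0 := by
    intro l
    rw [List.count_eq_zero]
    simp only [List.mem_map, not_exists, not_and]
    intro y _
    by_cases hy : y = x <;> simp [g, hy]
  have hx2 : ∀ l : List ℕ, x + 2 ∉ l.map g := by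
    intro l
    simp only [List.mem_map, not_exists, not_and]
    intro y _
    by_cases hy : y = x <;> simp [g, hy]
  obtain ⟨M', h₁, h₂⟩ := M.exists_fvs_eq (merge x) (l₁.map g ++ 0 :: l₂.map g) (by
    have h0x : merge x 0 = x := rfl
    simp [hl, Function.comp_def, hg, h0x])
  have hmem : ∀ y, y ∈ M'.fvs ↔ y = 0 ∨ y ∈ (l₁ ++ l₂).map g := by
    intro y
    simp only [h₁, List.mem_append, List.mem_cons, List.map_append]
    tauto
  refine ⟨M', h₂, ?_, ?_, ?_, ?_, ?_⟩
  · rw [h₁]; simp [h0]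
  · rw [hmem]
    exact .inr (List.mem_map.2 ⟨x, hx, by simp [g]⟩)
  · rw [hmem]
    rintro (h | h)
    · cases h
    · exact hx2 _ h
  · intro y hy
    have hgy : g y = y + 2 := by simp [g, hy]
    rw [h₁, hl, ← hgy]
    simp only [List.count_append, List.count_map_of_injective _ g hginj, List.count_cons]
    simp [hgy, Ne.symm hy]
  · have hlen : M'.fvs.length = M.fvs.length := by simp [h₁, hl]
    -- With as many occurrences as before, one more name is in use, so the excess drops.
    have hcard : M'.fvs.toFinset.card = M.fvs.toFinset.card + 1 := by
      have e₁ : M'.fvs.toFinset = insert 0 (M.fvs.toFinset.image g) := by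
        ext y
        simp only [List.mem_toFinset, hmem, Finset.mem_insert, Finset.mem_image, List.mem_map, hl,
          List.mem_append, List.mem_cons]
        constructor
        · rintro (h | ⟨a, ha, rfl⟩)
          · exact .inl h
          · exact .inr ⟨a, by tauto, rfl⟩
        · rintro (h | ⟨a, ha, rfl⟩)
          · exact .inl h
          · refine .inr ⟨a, ?_, rfl⟩
            rcases ha with ha | rfl | ha
            · exact .inl ha
            · exact List.mem_append.1 hx
            · exact .inr ha
      rw [e₁, Finset.card_insert_of_notMem, Finset.card_image_of_injective _ hginj]
      simp only [Finset.mem_image, not_exists, not_and]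
      intro y _
      by_cases hy : y = x <;> simp [g, hy]
    have hle := M'.fvs.toFinset_card_le
    unfold excess
    omega

end Term

/-! ### Sequent rules for plain typings -/

section

variable {ι : Type*}

/-- A typing whose fans face only variables that occur at least twice. -/
def PlainTyping (Γ : Ctx ι) (M : Term) (A : Formula ι) : Prop :=
  ∃ G : Graph, Derives Γ G A ∧ G.readback = M ∧ G.Plain ∧ ∀ x, G.Faces x → 2 ≤ M.fvs.count x

namespace PlainTyping

variable {Γ Δ : Ctx ι} {M N : Term} {A B C : Formula ι}

theorem typing (h : PlainTyping Γ M A) : Typing Γ M A := by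
  obtain ⟨G, h₁, h₂, h₃, -⟩ := h
  exact ⟨G, h₁, h₂, h₃.sharesOnlyVariables⟩

/-- A variable that occurs just once is faced by no fan, so `N` is not put in front of a fan. The
cut does not lower the number of occurrences of the remaining variables, so the faced ones still
occur at least twice. -/
theorem cut (hd : Disjoint Γ.dom Δ.dom) (hN : PlainTyping Γ N A)
    (hM : PlainTyping (Ctx.cons A Δ) M B) (h0 : M.fvs.count 0 = 1) :
    PlainTyping (Γ.union Δ) (M.subst (Term.instZero N)) B := by
  obtain ⟨G, hG, rfl, hGp, hGf⟩ := hN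
  obtain ⟨H, hH, rfl, hHp, hHf⟩ := hM
  have hs : ∀ x : ℕ, Graph.Plain ((fun | 0 => G | x + 1 => .var x : ℕ → Graph) x) := by
    intro x
    cases x with
    | zero => exact hGp
    | succ x => trivial
  have hf0 : ¬ H.Faces 0 := fun h => by have := hHf 0 h; omega
  refine ⟨H.plug G, .cut hd hG hH, Graph.readback_plug _ _, hHp.subst hs fun x hx => ?_,
    fun x hx => ?_⟩
  · cases x with
    | zero => exact absurd hx hf0
    | succ x => exact ⟨x, rfl⟩
  · rw [Term.count_fvs_subst_instZero, h0, Nat.one_mul]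
    rcases Graph.Faces.of_subst hHp hs hx with ⟨y, hy⟩ | ⟨y, hy, hyx⟩
    · cases y with
      | zero => exact (hGf x hy).trans (Nat.le_add_left _ _)
      | succ y => exact hy.elim
    · cases y with
      | zero => exact absurd hy hf0
      | succ y =>
        obtain rfl := Graph.var.inj hyx
        exact (hHf _ hy).trans (Nat.le_add_right _ _)

theorem weak (x : ℕ) (A : Formula ι) (hx : x ∉ Γ.dom) (h : PlainTyping Γ M B) :
    PlainTyping (Γ.add x A) M B := by
  obtain ⟨G, h₁, h₂⟩ := h
  exact ⟨G, .weak x A hx h₁, h₂⟩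

theorem lam (h : PlainTyping (Ctx.cons A Γ) M B) : PlainTyping Γ (.lam M) (.lolli A B) := by
  obtain ⟨G, h₁, rfl, h₂, h₃⟩ := h
  refine ⟨.lam G, .lolliR h₁, rfl, h₂, fun x hx => ?_⟩
  simp only [Term.fvs, count_filterMap_lower]
  exact h₃ _ hx

theorem bang (h : PlainTyping Γ M B) : PlainTyping Γ.bang M B.bang := by
  obtain ⟨G, h₁, h₂⟩ := h
  exact ⟨G, .bang h₁, h₂⟩

/-- Both ports of the new fan are in use, so the variable it faces occurs at least twice afterwards.
-/
theorem contr (z : ℕ) (hz : z ∉ Γ.dom)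
    (h : PlainTyping (Ctx.cons A.bang (Ctx.cons A.bang Γ)) M B)
    (h0 : 0 ∈ M.fvs) (h1 : 1 ∈ M.fvs) :
    PlainTyping (Γ.add z A.bang) (M.rename (Term.merge z)) B := by
  obtain ⟨G, h₁, rfl, h₂, h₃⟩ := h
  refine ⟨.share (.var z) G, .contr z hz h₁, Graph.readback_share_var _ _, ⟨⟨z, rfl⟩, h₂⟩,
    fun x hx => ?_⟩
  rw [Term.fvs_rename, count_map_merge]
  rcases hx with hx | hx
  · obtain rfl := Graph.var.inj hx
    have := List.count_pos_iff.2 h0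
    have := List.count_pos_iff.2 h1
    simp only [if_true]
    omega
  · exact (h₃ _ hx).trans (Nat.le_add_right _ _)

/-- This is (⊸L) with an axiom as its right premise. -/
theorem appVar (h : PlainTyping Γ M A) (hΓ : Γ 0 = none) :
    PlainTyping (Γ.add 0 (.lolli A B)) (.app (.var 0) M) B := by
  obtain ⟨G, h₁, rfl, h₂, h₃⟩ := h
  have hB : Derives (Ctx.cons B fun _ => none) (.var 0) B := by
    have : Ctx.cons B (fun _ => none) = Ctx.single 0 B := by
      funext x; cases x <;> simp [Ctx.cons, Ctx.single]
    rw [this]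
    exact .ax 0 B
  have hd : Disjoint Γ.dom (Ctx.dom (ι := ι) fun _ => none) := by
    rw [Set.disjoint_left]
    exact fun x _ h => h rfl
  have key := Derives.lolliL 0 hd (by simpa [Ctx.mem_dom] using hΓ) (by simp [Ctx.mem_dom]) h₁ hB
  have hu : Γ.union (fun _ => none) = Γ := by funext x; simp [Ctx.union]
  rw [hu] at key
  refine ⟨_, key, rfl, ⟨trivial, h₂⟩, fun x hx => ?_⟩
  have hx : G.Faces x := hx.resolve_left id
  simp only [Term.fvs, List.count_append]
  exact (h₃ x hx).trans (Nat.le_add_left _ _)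

/-- Weakening to a larger basis. -/
theorem mono (h : PlainTyping Γ M B) (hΔ : Δ.dom.Finite)
    (hsub : ∀ x A, Γ x = some A → Δ x = some A) : PlainTyping Δ M B := by
  classical
  -- Weakening adds a single declaration, so the basis is enlarged along a finite set `s`: on `s` it
  -- is already Δ, elsewhere still Γ.
  have key : ∀ s : Finset ℕ, PlainTyping (fun x => if x ∈ s then Δ x else Γ x) M B := by
    intro s
    induction s using Finset.induction_on with
    | empty => simpa using h
    | insert a s ha ih =>
      by_cases h₁ : Γ a = none
      · cases h₂ : Δ a with
        | none =>
          convert ih using 2 with x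
          by_cases hx : x = a
          · subst hx; simp [ha, h₁, h₂]
          · simp [hx]
        | some A =>
          have := ih.weak a A (by simp [Ctx.mem_dom, ha, h₁])
          convert this using 1
          funext x
          by_cases hx : x = a
          · subst hx; simp [Ctx.add, h₂]
          · simp [Ctx.add, hx]
      · obtain ⟨A, hA⟩ := Option.ne_none_iff_exists'.1 h₁
        convert ih using 2 with x
        by_cases hx : x = a
        · subst hx; simp [ha, hA, hsub x A hA]
        · simp [hx]
  have := key hΔ.toFinset
  convert this using 1
  funext x
  by_cases hx : x ∈ hΔ.toFinset
  · simp [hx]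
  · simp only [hx, if_false]
    have h₁ : Δ x = none := by simpa [Ctx.mem_dom] using hx
    rw [h₁]
    cases h₂ : Γ x with
    | none => rfl
    | some A => rw [hsub x A h₂] at h₁; cases h₁

end PlainTyping

end

end EAL

/-! ### Removing a box, or cutting out a subterm of level zero -/

namespace EAL

namespace Formula

/-- Remove one outermost `!`. -/
def unbang {ι : Type*} : Formula ι → Formula ι
  | .bang A => A
  | A => A

end Formula

namespace Term

/-- The substitution of `N` for the variable `k`. -/
def instAt (k : ℕ) (N : Term) : ℕ → Term := fun x => if x = k then N else .var x

theorem liftSub_instAt (k : ℕ) (N : Term) :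
    liftSub (instAt k N) = instAt (k + 1) (N.rename Nat.succ) := by
  funext x
  cases x with
  | zero => simp [liftSub, instAt]
  | succ x =>
    by_cases h : x = k
    · simp [liftSub, instAt, h]
    · simp [liftSub, instAt, h, rename]

theorem subst_instAt_of_notMem {M : Term} {k : ℕ} (N : Term) (h : k ∉ M.fvs) :
    M.subst (instAt k N) = M :=
  M.subst_eq_self fun x hx => if_neg (fun hxk : x = k => h (hxk ▸ hx))

theorem exists_rename_succ {N : Term} (h : 0 ∉ N.fvs) : ∃ N' : Term, N'.rename Nat.succ = N := by
  refine ⟨N.rename Nat.pred, ?_⟩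
  rw [rename_rename, rename_eq_subst]
  refine N.subst_eq_self fun x hx => ?_
  rw [Nat.succ_pred_eq_of_ne_zero fun h0 => h (h0 ▸ hx)]

end Term

section

variable {ι : Type*}

theorem update_scons {α : Type*} (a : α) (f : ℕ → α) (k : ℕ) (b : α) :
    Function.update (scons a f) (k + 1) b = scons a (Function.update f k b) := by
  funext x
  cases x with
  | zero => simp [scons]
  | succ x =>
    by_cases h : x = k
    · subst h; simp [scons]
    · simp [scons, h]

namespace Leveled

/-- `M` is decomposed as `M₁{N/k}` where `N` is not a variable and its root has level `0`. -/
structure CutAt (ℓ : ℕ → ℕ) (T : ℕ → Formula ι) (d : ℕ) (M : Term) (A : Formula ι) (k : ℕ)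
    (M₁ N : Term) (C : Formula ι) : Prop where
  eq_subst : M = M₁.subst (Term.instAt k N)
  outer : Leveled (Function.update ℓ k 0) (Function.update T k C) d M₁ A
  inner : Leveled ℓ T 0 N C
  level : ∀ x ∈ N.fvs, ℓ x = 0
  two_le_size : 2 ≤ N.size
  size_eq : M₁.size + N.size = M.size + 1
  level_eq : M₁.size = 1 → d = 0
  count_self : M₁.fvs.count k = 1
  count_eq : ∀ x, M.fvs.count x + (if x = k then 1 else 0) = M₁.fvs.count x + N.fvs.count x

theorem CutAt.mem_of_mem {ℓ : ℕ → ℕ} {T : ℕ → Formula ι} {d : ℕ} {M : Term} {A : Formula ι}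
    {k : ℕ} {M₁ N : Term} {C : Formula ι} (h : CutAt ℓ T d M A k M₁ N C) {x : ℕ}
    (hx : x ∈ M₁.fvs) (hxk : x ≠ k) : x ∈ M.fvs := by
  have h₁ := h.count_eq x
  have h₂ := List.count_pos_iff.2 hx
  rw [if_neg hxk] at h₁
  exact List.count_pos_iff.1 (by omega)

/-- At level `0`, the whole term is cut out. -/
theorem cutAt_self {ℓ : ℕ → ℕ} {T : ℕ → Formula ι} {M : Term} {A : Formula ι} {k : ℕ}
    (h : Leveled ℓ T 0 M A) (hℓ : ∀ x ∈ M.fvs, ℓ x ≤ 0) (hM : 2 ≤ M.size) :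
    CutAt ℓ T 0 M A k (.var k) M A where
  eq_subst := by simp [Term.subst, Term.instAt]
  outer := var_of_eq (by simp)
  inner := h
  level := fun x hx => Nat.le_zero.1 (hℓ x hx)
  two_le_size := hM
  size_eq := by simp [Term.size, Nat.add_comm]
  level_eq := fun _ => rfl
  count_self := by simp [Term.fvs]
  count_eq := fun x => by
    simp only [Term.fvs, List.count_cons, List.count_nil, beq_iff_eq, Nat.zero_add,
      eq_comm (a := k)]
    rw [Nat.add_comm]

/-- A term in a box either is a box as a whole, or has a subterm of level `0`. -/
theorem unbox_or_cutAt {ℓ : ℕ → ℕ} {T : ℕ → Formula ι} {d p : ℕ} {M : Term} {B : Formula ι}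
    (h : Leveled ℓ T d M (Formula.bang^[p + 1] B)) (hℓ : ∀ x ∈ M.fvs, ℓ x ≤ p + 1)
    (k : ℕ) (hk : k ∉ M.fvs) :
    (Leveled (fun x => ℓ x - 1) (fun x => (T x).unbang) (d - 1) M (Formula.bang^[p] B) ∧
      ∀ x ∈ M.fvs, T x = (T x).unbang.bang) ∨
    ∃ M₁ N C, CutAt ℓ T d M (Formula.bang^[p + 1] B) k M₁ N C := by
  induction M generalizing ℓ T d p B k with
  | var x =>
    -- A variable never blocks the removal of a box: its type is the type of the whole term here and
    -- starts with !.
    have hx := h.var_inv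
    rw [Function.iterate_succ_apply'] at hx
    refine .inl ⟨var_of_eq (by simp only [← hx]; rfl), fun y hy => ?_⟩
    simp only [Term.fvs, List.mem_singleton] at hy
    subst hy; rw [← hx]; rfl
  | lam M ih =>
    obtain ⟨A, A', d', hB, h₁, h₂, h₃⟩ := h.lam_inv
    -- At level 0 the node is not in the box to be removed and is cut out itself; at a positive
    -- level the search continues below it.
    cases d with
    | zero =>
      exact .inr ⟨_, _, _, h.cutAt_self h₁ (Nat.succ_le_succ M.size_pos)⟩
    | succ d =>
      have hk' : k + 1 ∉ M.fvs := fun hm => hk (mem_filterMap_lower.2 hm)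
      have hℓ' : ∀ x ∈ M.fvs, scons (d + 1) ℓ x ≤ d + 1 := by
        intro x hx
        cases x with
        | zero => exact le_rfl
        | succ x => exact h₁ x (mem_filterMap_lower.2 hx)
      rcases ih h₃ hℓ' (k + 1) hk' with ⟨h₄, h₅⟩ | ⟨M₁, N, C, hc⟩
      · left
        have hB' : Formula.bang^[p] B = Formula.bang^[d] (.lolli A A') := by
          rw [Function.iterate_succ_apply', Function.iterate_succ_apply'] at hB
          exact Formula.bang.inj hB
        refine ⟨?_, fun x hx => h₅ (x + 1) (mem_filterMap_lower.1 hx)⟩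
        rw [hB']
        refine .lam (fun x hx => ?_) h₂ (h₄.congr ?_ ?_)
        · have := h₁ x hx
          simp only [Nat.add_sub_cancel]
          omega
        · intro x _
          cases x <;> exact le_rfl
        · intro x _
          cases x with
          | zero =>
            simp only [scons, Nat.add_sub_cancel]
            rw [Function.iterate_succ_apply']
            rfl
          | succ x => rfl
      · right
        -- The free variables of the cut subterm are bound at level 0, but this binder has level `d
        -- + 1`. Hence the subterm can be moved out of the abstraction.
        have h0 : 0 ∉ N.fvs := fun h0 => by
          have := hc.level 0 h0
          simp [scons] at this
        obtain ⟨N, rfl⟩ := Term.exists_rename_succ h0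
        have hcount : ∀ x, (N.rename Nat.succ).fvs.count (x + 1) = N.fvs.count x := fun x => by
          rw [Term.fvs_rename]
          exact List.count_map_of_injective _ _ Nat.succ_injective x
        have hin := hc.inner
        rw [rename_iff] at hin
        have hout := hc.outer
        rw [update_scons, update_scons] at hout
        refine ⟨.lam M₁, N, C, ?_, ?_, hin, ?_, ?_, ?_, ?_, ?_, ?_⟩
        · rw [Term.subst, Term.liftSub_instAt, ← hc.eq_subst]
        · rw [hB]
          refine .lam (fun x hx => ?_) (fun h => h₂ ?_) hout
          · by_cases hxk : x = k
            · subst hxk; simp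
            · simp only [ne_eq, hxk, not_false_eq_true, Function.update_of_ne]
              refine h₁ x (mem_filterMap_lower.2 (hc.mem_of_mem (mem_filterMap_lower.1 hx) ?_))
              omega
          · have := hc.count_eq 0
            simp only [Nat.zero_ne_add_one, if_false] at this
            omega
        · intro x hx
          exact hc.level (x + 1) (by rw [Term.fvs_rename]; exact List.mem_map_of_mem hx)
        · have := hc.two_le_size
          rwa [Term.size_rename] at this
        · have := hc.size_eq
          rw [Term.size_rename] at this
          simp only [Term.size]
          omega
        · have := M₁.size_pos
          simp only [Term.size]
          omega
        · simpa only [Term.fvs, count_filterMap_lower] using hc.count_self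
        · intro x
          have := hc.count_eq (x + 1)
          simp only [hcount, Nat.add_right_cancel_iff] at this
          simpa only [Term.fvs, count_filterMap_lower] using this
  | app M N ih₁ ih₂ =>
    obtain ⟨A, A', d₁, d₂, hB, h₁, h₂, h₃⟩ := h.app_inv
    cases d with
    | zero =>
      refine .inr ⟨_, _, _, h.cutAt_self h₁ ?_⟩
      have := M.size_pos
      simp only [Term.size]
      omega
    | succ d =>
      have hk₁ : k ∉ M.fvs := fun hm => hk (List.mem_append_left _ hm)
      have hk₂ : k ∉ N.fvs := fun hm => hk (List.mem_append_right _ hm)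
      have hℓ₁ : ∀ x ∈ M.fvs, ℓ x ≤ d + 1 := fun x hx => h₁ x (List.mem_append_left _ hx)
      have hℓ₂ : ∀ x ∈ N.fvs, ℓ x ≤ d + 1 := fun x hx => h₁ x (List.mem_append_right _ hx)
      have hne : ∀ {x : ℕ} {L : List ℕ}, x ∈ L → k ∉ L → x ≠ k := by
        rintro x L hx hL rfl
        exact hL hx
      have hfv : ∀ {M' N' : Term}, (∀ x ∈ M'.fvs, x ≠ k → x ∈ M.fvs) →
          (∀ x ∈ N'.fvs, x ≠ k → x ∈ N.fvs) →
          ∀ x ∈ (Term.app M' N').fvs, Function.update ℓ k 0 x ≤ d + 1 := by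
        intro M' N' hM' hN' x hx
        by_cases hxk : x = k
        · subst hxk; simp
        · simp only [ne_eq, hxk, not_false_eq_true, Function.update_of_ne]
          rcases List.mem_append.1 hx with hx | hx
          · exact hℓ₁ x (hM' x hx hxk)
          · exact hℓ₂ x (hN' x hx hxk)
      rcases ih₁ h₂ hℓ₁ k hk₁ with ⟨h₄, h₅⟩ | ⟨M₁, P, C, hc⟩
      · rcases ih₂ h₃ hℓ₂ k hk₂ with ⟨h₆, h₇⟩ | ⟨N₁, P, C, hc⟩
        · left
          refine ⟨?_, fun x hx => ?_⟩
          · have hB' : Formula.bang^[p] B = Formula.bang^[d] A' := by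
              rw [Function.iterate_succ_apply', Function.iterate_succ_apply'] at hB
              exact Formula.bang.inj hB
            rw [hB']
            refine .app (fun x hx => ?_) h₄ h₆
            have := h₁ x hx
            simp only [Nat.add_sub_cancel]
            omega
          · rcases List.mem_append.1 hx with hx | hx
            · exact h₅ x hx
            · exact h₇ x hx
        · right
          refine ⟨.app M N₁, P, C, ?_, ?_, hc.inner, hc.level, hc.two_le_size, ?_, ?_, ?_, ?_⟩
          · rw [Term.subst, ← hc.eq_subst, Term.subst_instAt_of_notMem P hk₁]
          · rw [hB]
            refine .app (hfv (fun x hx _ => hx) fun x hx => hc.mem_of_mem hx) (h₂.congr ?_ ?_)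
              hc.outer
            · intro x hx; simp [hne hx hk₁]
            · intro x hx; simp [hne hx hk₁]
          · have := hc.size_eq
            simp only [Term.size]
            omega
          · have := N₁.size_pos
            simp only [Term.size]
            omega
          · simp [Term.fvs, hc.count_self, List.count_eq_zero.2 hk₁]
          · intro x
            have := hc.count_eq x
            simp only [Term.fvs, List.count_append]
            omega
      · right
        refine ⟨.app M₁ N, P, C, ?_, ?_, hc.inner, hc.level, hc.two_le_size, ?_, ?_, ?_, ?_⟩
        · rw [Term.subst, ← hc.eq_subst, Term.subst_instAt_of_notMem P hk₂]
        · rw [hB]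
          refine .app (hfv (fun x hx => hc.mem_of_mem hx) fun x hx _ => hx) hc.outer (h₃.congr ?_ ?_)
          · intro x hx; simp [hne hx hk₂]
          · intro x hx; simp [hne hx hk₂]
        · have := hc.size_eq
          simp only [Term.size]
          omega
        · have := N.size_pos
          simp only [Term.size]
          omega
        · simp [Term.fvs, hc.count_self, List.count_eq_zero.2 hk₂]
        · intro x
          have := hc.count_eq x
          simp only [Term.fvs, List.count_append]
          omega

end Leveled

/-- The basis that assigns types to the free variables of a term. -/
def Ctx.restrict (T : ℕ → Formula ι) (M : Term) : Ctx ι :=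
  fun x => if x ∈ M.fvs then some (T x) else none

theorem Ctx.mem_dom_restrict {T : ℕ → Formula ι} {M : Term} {x : ℕ} :
    x ∈ (Ctx.restrict T M).dom ↔ x ∈ M.fvs := by
  simp [Ctx.mem_dom, Ctx.restrict]

/-! ### Building a derivation from levels -/

namespace PlainTyping

/-- Linearity makes the free variables of `N` disjoint from those of `M₁` other than `k`, as (cut)
requires. Both parts are smaller than `M`: `N` is not a variable, and `M₁` is not just `k` because
the root level is positive. -/
theorem of_cutAt {T : ℕ → Formula ι} {d k : ℕ} {M M₁ N : Term} {A C : Formula ι}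
    (hc : Leveled.CutAt (fun _ => 0) T d M A k M₁ N C) (hk : k ∉ M.fvs)
    (hlin : ∀ x, M.fvs.count x ≤ 1)
    (ih : ∀ (M' : Term) (d' : ℕ) (T' : ℕ → Formula ι) (A' : Formula ι), M'.size < M.size →
      Leveled (fun _ => 0) T' d' M' A' → (∀ x, M'.fvs.count x ≤ 1) →
      PlainTyping (Ctx.restrict T' M') M' A') (hd : d ≠ 0) :
    PlainTyping (Ctx.restrict T M) M A := by
  -- (cut) acts on the index 0, so `k` is moved there and every other variable goes up by one.
  let ρ : ℕ → ℕ := fun x => if x = k then 0 else x + 1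
  have hρ : Function.Injective ρ := by
    intro a b hab
    by_cases ha : a = k <;> by_cases hb : b = k <;> simp_all [ρ]
  have hρk : ρ k = 0 := by simp [ρ]
  have hρs : ∀ x, x ≠ k → ρ x = x + 1 := fun x hx => by simp [ρ, hx]
  have hsz := hc.size_eq
  have hsz₁ := M₁.size_pos
  have hsz₂ : M₁.size ≠ 1 := fun h => hd (hc.level_eq h)
  have hN2 := hc.two_le_size
  have hkM : M.fvs.count k = 0 := List.count_eq_zero.2 hk
  have hkN : k ∉ N.fvs := by
    have := hc.count_eq k
    rw [hc.count_self, hkM, if_pos rfl] at this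
    exact List.count_eq_zero.1 (by omega)
  have hcount : ∀ x, (M₁.rename ρ).fvs.count (ρ x) = M₁.fvs.count x := fun x => by
    rw [Term.fvs_rename, List.count_map_of_injective _ _ hρ]
  have hcount0 : (M₁.rename ρ).fvs.count 0 = 1 := by
    rw [← hρk, hcount, hc.count_self]
  have hcountk : (M₁.rename ρ).fvs.count (k + 1) = 0 := by
    rw [Term.fvs_rename, List.count_eq_zero, List.mem_map]
    rintro ⟨y, -, hy⟩
    by_cases hyk : y = k
    · rw [hyk, hρk] at hy; omega
    · rw [hρs y hyk] at hy; omega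
  have hcounts : ∀ x, x ≠ k → (M₁.rename ρ).fvs.count (x + 1) = M₁.fvs.count x := fun x hx => by
    rw [← hρs x hx, hcount]
  have hN := ih N 0 T C (by omega) hc.inner fun x => by
    by_cases hxk : x = k
    · subst hxk; rw [List.count_eq_zero.2 hkN]; omega
    · have := hc.count_eq x
      have := hlin x
      simp only [hxk, if_false] at *
      omega
  have hM₁ := ih (M₁.rename ρ) d (scons C T) A (by rw [Term.size_rename]; omega)
    (Leveled.rename_iff.2 (hc.outer.congr (fun x _ => Nat.zero_le _) fun x _ => by
      by_cases hxk : x = k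
      · subst hxk; rw [hρk]; simp [scons]
      · rw [hρs x hxk]; simp [scons, hxk])) fun x => by
    cases x with
    | zero => omega
    | succ x =>
      by_cases hxk : x = k
      · subst hxk; omega
      · rw [hcounts x hxk]
        have := hc.count_eq x
        have := hlin x
        simp only [hxk, if_false] at *
        omega
  let Δ : Ctx ι := fun x => Ctx.restrict (scons C T) (M₁.rename ρ) (x + 1)
  have hΔ : Ctx.restrict (scons C T) (M₁.rename ρ) = Ctx.cons C Δ := by
    funext x
    cases x with
    | zero =>
      have : 0 ∈ (M₁.rename ρ).fvs := List.count_pos_iff.1 (by omega)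
      simp [Ctx.restrict, Ctx.cons, this, scons]
    | succ x => rfl
  have hΔs : ∀ x, Δ x = if x ≠ k ∧ x ∈ M₁.fvs then some (T x) else none := by
    intro x
    by_cases hxk : x = k
    · subst hxk
      simp [Δ, Ctx.restrict, List.count_eq_zero.1 hcountk]
    · have : x + 1 ∈ (M₁.rename ρ).fvs ↔ x ∈ M₁.fvs := by
        rw [← List.count_pos_iff, hcounts x hxk, List.count_pos_iff]
      simp [Δ, Ctx.restrict, this, hxk, scons]
  rw [hΔ] at hM₁
  have hdisj : Disjoint (Ctx.restrict T N).dom Δ.dom := by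
    rw [Set.disjoint_left]
    intro x hx hx'
    rw [Ctx.mem_dom_restrict] at hx
    have h₁ : x ≠ k ∧ x ∈ M₁.fvs := by
      by_contra h
      exact hx' (by rw [hΔs, if_neg h])
    have h₂ := hc.count_eq x
    have h₃ := hlin x
    have h₄ := List.count_pos_iff.2 hx
    have h₅ := List.count_pos_iff.2 h₁.2
    rw [if_neg h₁.1] at h₂
    omega
  have key := PlainTyping.cut hdisj hN hM₁ hcount0
  have e₁ : (M₁.rename ρ).subst (Term.instZero N) = M := by
    rw [hc.eq_subst, Term.subst_rename]
    congr 1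
    funext x
    by_cases hxk : x = k
    · subst hxk; rw [hρk]; simp [Term.instZero, Term.instAt]
    · rw [hρs x hxk]; simp [Term.instZero, Term.instAt, hxk]
  have e₂ : (Ctx.restrict T N).union Δ = Ctx.restrict T M := by
    funext x
    have h₂ := hc.count_eq x
    simp only [Ctx.union, hΔs]
    by_cases hxk : x = k
    · subst hxk
      simp [Ctx.restrict, hkN, hk]
    · rw [if_neg hxk] at h₂
      by_cases hxN : x ∈ N.fvs
      · have h₃ := List.count_pos_iff.2 hxN
        have h₄ : x ∈ M.fvs := List.count_pos_iff.1 (by omega)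
        simp [Ctx.restrict, hxN, h₄]
      · have h₃ := List.count_eq_zero.2 hxN
        have h₄ : x ∈ M.fvs ↔ x ∈ M₁.fvs := by
          rw [← List.count_pos_iff, ← List.count_pos_iff]; omega
        simp [Ctx.restrict, hxN, h₄, hxk]
  rwa [e₁, e₂] at key

/-- The term `M N` arises from `f N`, with a fresh variable f typed by (⊸L), by cutting in `M` for
f. -/
theorem app {T : ℕ → Formula ι} {M N : Term} {A B : Formula ι}
    (hM : PlainTyping (Ctx.restrict T M) M (.lolli A B))
    (hN : PlainTyping (Ctx.restrict (scons A T) (N.rename Nat.succ)) (N.rename Nat.succ) A)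
    (hlin : ∀ x, (Term.app M N).fvs.count x ≤ 1) :
    PlainTyping (Ctx.restrict T (.app M N)) (.app M N) B := by
  have hmem : ∀ x, x + 1 ∈ (N.rename Nat.succ).fvs ↔ x ∈ N.fvs := fun x => by
    rw [Term.fvs_rename]; simp
  have h0 : 0 ∉ (N.rename Nat.succ).fvs := by
    rw [Term.fvs_rename]; simp
  have h₁ := hN.appVar (B := B) (by simp [Ctx.restrict, h0])
  have hΔ : Ctx.add (Ctx.restrict (scons A T) (N.rename Nat.succ)) 0 (.lolli A B) =
      Ctx.cons (.lolli A B) (Ctx.restrict T N) := by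
    funext x
    cases x with
    | zero => simp [Ctx.add, Ctx.cons]
    | succ x => simp [Ctx.add, Ctx.cons, Ctx.restrict, hmem, scons]
  rw [hΔ] at h₁
  have hdisj : Disjoint (Ctx.restrict T M).dom (Ctx.restrict T N).dom := by
    rw [Set.disjoint_left]
    intro x hx hx'
    rw [Ctx.mem_dom_restrict] at hx hx'
    have := hlin x
    have := List.count_pos_iff.2 hx
    have := List.count_pos_iff.2 hx'
    simp only [Term.fvs, List.count_append] at *
    omega
  have key := PlainTyping.cut hdisj hM h₁ (by
    simp [Term.fvs, List.count_eq_zero.2 h0])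
  have e₁ : (Term.app (.var 0) (N.rename Nat.succ)).subst (Term.instZero M) = .app M N := by
    simp only [Term.subst, Term.subst_rename, Term.instZero]
    congr 1
    exact N.subst_var
  have e₂ : (Ctx.restrict T M).union (Ctx.restrict T N) = Ctx.restrict T (.app M N) := by
    funext x
    by_cases hx : x ∈ M.fvs <;> by_cases hx' : x ∈ N.fvs <;>
      simp [Ctx.union, Ctx.restrict, Term.fvs, hx, hx']
  rwa [e₁, e₂] at key

/-- Lexicographic induction on the size, the number of repeated occurrences and the root level.
Contraction lowers the second and keeps the first; removing a box from a linear term lowers only the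
third; a cut, or taking off a root of level 0, lowers the size. Size has to come first because the
body of a linear abstraction may again use its variable repeatedly. -/
theorem of_leveled (M : Term) (d : ℕ) (T : ℕ → Formula ι) (C : Formula ι)
    (h : Leveled (fun _ => 0) T d M C) (hc : ∀ x, 2 ≤ M.fvs.count x → ∃ A, T x = .bang A) :
    PlainTyping (Ctx.restrict T M) M C := by
  by_cases hlin : ∀ x, M.fvs.count x ≤ 1
  · have ih : ∀ (M' : Term) (d' : ℕ) (T' : ℕ → Formula ι) (A' : Formula ι), M'.size < M.size →
        Leveled (fun _ => 0) T' d' M' A' → (∀ x, M'.fvs.count x ≤ 1) →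
        PlainTyping (Ctx.restrict T' M') M' A' := fun M' d' T' A' _ hL hl =>
      of_leveled M' d' T' A' hL fun x hx => by have := hl x; omega
    -- Abstractions and applications of positive level are treated alike; `k` is a name that does
    -- not occur in `M`.
    have boxed : ∀ d₀ B, d = d₀ + 1 → C = Formula.bang^[d₀ + 1] B →
        PlainTyping (Ctx.restrict T M) M C := by
      rintro d₀ B rfl rfl
      obtain ⟨k, hk⟩ := Infinite.exists_notMem_finset M.fvs.toFinset
      rw [List.mem_toFinset] at hk
      rcases h.unbox_or_cutAt (fun _ _ => Nat.zero_le _) k hk with ⟨h₁, h₂⟩ | ⟨M₁, N, C, hcut⟩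
      · have := (of_leveled M d₀ _ _ h₁ fun x hx => by have := hlin x; omega).bang
        rw [← Function.iterate_succ_apply' Formula.bang] at this
        convert this using 1
        funext x
        by_cases hx : x ∈ M.fvs
        · simpa [Ctx.restrict, Ctx.bang, hx] using h₂ x hx
        · simp [Ctx.restrict, Ctx.bang, hx]
      · exact of_cutAt hcut hk hlin ih (by omega)
    match M, h with
    | .var x, h =>
      rw [h.var_inv]
      refine ⟨.var x, ?_, rfl, trivial, fun y hy => hy.elim⟩
      have : Ctx.restrict T (.var x) = Ctx.single x (T x) := by
        funext y
        by_cases hy : y = x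
        · subst hy; simp [Ctx.restrict, Ctx.single, Term.fvs]
        · simp [Ctx.restrict, Ctx.single, Term.fvs, hy]
      rw [this]
      exact .ax x (T x)
    | .lam M, h =>
      obtain ⟨A, B, d', hC, h₁, h₂, h₃⟩ := h.lam_inv
      cases d with
      | succ d => exact boxed _ _ rfl hC
      | zero =>
        subst hC
        have hb := of_leveled M d' (scons A T) B
          (h₃.congr (fun _ _ => Nat.zero_le _) fun _ _ => rfl) (fun x hx => by
            cases x with
            | zero => exact h₂ hx
            | succ x =>
              have := hlin x
              simp only [Term.fvs, count_filterMap_lower] at this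
              omega)
        refine PlainTyping.lam ?_
        by_cases h0 : 0 ∈ M.fvs
        · convert hb using 1
          funext x
          cases x with
          | zero => simp [Ctx.cons, Ctx.restrict, h0, scons]
          | succ x => simp only [Ctx.cons, Ctx.restrict, Term.fvs, mem_filterMap_lower, scons]
        -- The restricted basis lacks an abstracted variable that does not occur; weakening supplies
        -- it.
        · convert hb.weak 0 A (by rwa [Ctx.mem_dom_restrict]) using 1
          funext x
          cases x with
          | zero => simp [Ctx.cons, Ctx.add]
          | succ x =>
            simp only [Ctx.cons, Ctx.add, Ctx.restrict, Term.fvs, mem_filterMap_lower, scons, ne_eq,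
              Nat.add_eq_zero_iff, one_ne_zero, and_false, not_false_eq_true, Function.update_of_ne]
    | .app M N, h =>
      obtain ⟨A, B, d₁, d₂, hC, h₁, h₂, h₃⟩ := h.app_inv
      cases d with
      | succ d => exact boxed _ _ rfl hC
      | zero =>
        subst hC
        have hlin' := hlin
        simp only [Term.fvs, List.count_append] at hlin'
        refine PlainTyping.app (A := A) (ih M d₁ T _ ?_ h₂ fun x => ?_)
          (ih (N.rename Nat.succ) d₂ _ _ ?_ (Leveled.rename_iff.2 h₃) fun x => ?_) hlin
        · simp only [Term.size]; omega
        · have := hlin' x; omega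
        · rw [Term.size_rename]; simp only [Term.size]; omega
        · rw [Term.fvs_rename]
          cases x with
          | zero => rw [List.count_eq_zero.2 (by simp)]; omega
          | succ x =>
            have := List.count_map_of_injective N.fvs _ Nat.succ_injective x
            have := hlin' x
            simp only [Nat.succ_eq_add_one] at *
            omega
  · push Not at hlin
    obtain ⟨x, hx⟩ := hlin
    obtain ⟨A, hA⟩ := hc x hx
    obtain ⟨M', hM', h0, h1, hx2, hcount, hex⟩ := M.exists_rename_merge x hx
    have hsize : M'.size = M.size := by rw [← hM', Term.size_rename]
    have hL : Leveled (fun _ => 0) (scons (T x) (scons (T x) T)) d M' C := by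
      rw [← hM', Leveled.rename_iff] at h
      refine h.congr (fun _ _ => le_rfl) fun y _ => ?_
      rcases y with _ | _ | y <;> rfl
    have ih := of_leveled M' d _ C hL (fun y hy => by
      rcases y with _ | _ | y
      · omega
      · exact ⟨A, hA⟩
      · by_cases hyx : y = x
        · subst hyx; exact ⟨A, hA⟩
        · rw [hcount y hyx] at hy
          exact hc y hy)
    have h0' : 0 ∈ M'.fvs := List.count_pos_iff.1 (by omega)
    -- The variable `x` is left out: its occurrences are now named 0 and 1, and (contr) restores it.
    let Γ : Ctx ι := fun y => if y = x then none else Ctx.restrict T M y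
    have e₁ : Ctx.restrict (scons (T x) (scons (T x) T)) M' =
        Ctx.cons A.bang (Ctx.cons A.bang Γ) := by
      funext y
      rcases y with _ | _ | y
      · simp [Ctx.restrict, h0', Ctx.cons, scons, hA]
      · simp [Ctx.restrict, h1, Ctx.cons, scons, hA]
      · by_cases hyx : y = x
        · subst hyx
          simp [Ctx.restrict, hx2, Ctx.cons, Γ]
        · have : y + 2 ∈ M'.fvs ↔ y ∈ M.fvs := by
            rw [← List.count_pos_iff, hcount y hyx, List.count_pos_iff]
          simp [Ctx.restrict, this, Ctx.cons, Γ, scons, hyx]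
    rw [e₁] at ih
    have key := ih.contr x (by simp [Ctx.mem_dom, Γ]) h0' h1
    rw [hM'] at key
    convert key using 1
    funext y
    by_cases hyx : y = x
    · subst hyx
      have : y ∈ M.fvs := List.count_pos_iff.1 (by omega)
      simp [Ctx.add, Ctx.restrict, this, hA]
    · simp [Ctx.add, Γ, hyx]
termination_by (M.size, M.excess, d)
decreasing_by
  · exact Prod.Lex.left _ _ ‹_›
  · exact Prod.Lex.right _ (Prod.Lex.right _ (by omega))
  · exact Prod.Lex.left _ _ (Nat.lt_succ_self _)
  · rw [hsize]; exact Prod.Lex.right _ (Prod.Lex.left _ _ hex)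

end PlainTyping

theorem LeveledTyping.typing {Γ : Ctx ι} {M : Term} {C : Formula ι} (h : LeveledTyping Γ M C)
    (hΓ : Γ.dom.Finite) : Typing Γ M C := by
  obtain ⟨T, d, hT, hc, hL⟩ := h
  refine ((PlainTyping.of_leveled M d T C hL hc).mono hΓ fun x A hx => ?_).typing
  by_cases hxM : x ∈ M.fvs
  · rw [← hx, hT x hxM]; simp [Ctx.restrict, hxM]
  · simp [Ctx.restrict, hxM] at hx

end

end EAL

namespace EAL

/-! ### Instances of general types and the auxiliary functions of the algorithm -/

section

variable {ι : Type*} {E : ℕ → STy ι} {σ τ : STy ι} {X : ℕ → ℕ}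

namespace Formula

theorem exists_eq_iterate_bang (A : Formula ι) : ∃ m A₀, A = bang^[m] A₀ ∧ A₀.IsCore := by
  induction A with
  | atom a => exact ⟨0, .atom a, rfl, trivial⟩
  | lolli A B _ _ => exact ⟨0, .lolli A B, rfl, trivial⟩
  | bang A ih =>
    obtain ⟨m, A₀, rfl, h⟩ := ih
    exact ⟨m + 1, A₀, (Function.iterate_succ_apply' _ _ _).symm, h⟩

end Formula

namespace GTy

/-- The instance of a general type without its outermost exponent. -/
def core (X : ℕ → ℕ) : {σ : STy ι} → GTy σ → Formula ι
  | _, .atom _ a => .atom a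
  | _, .lolli _ Θ Γ => .lolli (Θ.inst X) (Γ.inst X)

theorem isCore_core (Θ : GTy σ) : (Θ.core X).IsCore := by cases Θ <;> trivial

theorem inst_eq (Θ : GTy σ) : Θ.inst X = Formula.bang^[(Θ.outer.map X).sum] (Θ.core X) := by
  cases Θ <;> rfl

theorem core_setOuter (ms : List ℕ) (Θ : GTy σ) : (Θ.setOuter ms).core X = Θ.core X := by
  cases Θ <;> rfl

theorem outer_setOuter (ms : List ℕ) (Θ : GTy σ) : (Θ.setOuter ms).outer = ms := by
  cases Θ <;> rfl

theorem inst_bang (c : ℕ) (Θ : GTy σ) : (Θ.bang c).inst X = Formula.bang^[X c] (Θ.inst X) := by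
  rw [inst_eq, inst_eq, bang, core_setOuter, outer_setOuter, List.map_cons, List.sum_cons,
    Formula.iterate_bang_add]

theorem core_eq_lolli (Θ : GTy (.arr σ τ)) :
    Θ.core X = .lolli (Θ.dom.inst X) (Θ.cod.inst X) := by
  cases Θ; rfl

theorem iterate_bang_inst_eq_iff {m n : ℕ} (Θ Θ' : GTy σ) :
    Formula.bang^[m] (Θ.inst X) = Formula.bang^[n] (Θ'.inst X) ↔
      m + (Θ.outer.map X).sum = n + (Θ'.outer.map X).sum ∧ Θ.core X = Θ'.core X := by
  rw [inst_eq, inst_eq, ← Formula.iterate_bang_add, ← Formula.iterate_bang_add]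
  refine ⟨fun h => Formula.iterate_bang_inj (isCore_core _) (isCore_core _) h, ?_⟩
  rintro ⟨h₁, h₂⟩
  rw [h₁, h₂]

theorem inst_eq_iff (Θ Θ' : GTy σ) : Θ.inst X = Θ'.inst X ↔
    (Θ.outer.map X).sum = (Θ'.outer.map X).sum ∧ Θ.core X = Θ'.core X := by
  simpa using iterate_bang_inst_eq_iff (m := 0) (n := 0) Θ Θ' (X := X)

theorem one_le_outer_iff (Θ : GTy σ) :
    1 ≤ (Θ.outer.map X).sum ↔ ∃ A, Θ.inst X = .bang A := by
  rw [inst_eq]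
  cases h : (Θ.outer.map X).sum with
  | zero =>
    refine ⟨fun h => absurd h (by omega), ?_⟩
    rintro ⟨A, hA⟩
    have := isCore_core Θ (X := X)
    rw [show Θ.core X = .bang A from hA] at this
    exact this.elim
  | succ n => exact ⟨fun _ => ⟨_, Function.iterate_succ_apply' _ _ _⟩, fun _ => by omega⟩

end GTy

/-- The constraint `A - k`, for an equation `A`, holds. -/
def Constraint.HoldsSub (X : ℕ → ℕ) (k : ℕ) : Constraint → Prop
  | .eq pos neg => (pos.map X).sum = (neg.map X).sum + k
  | .ge ns => 1 ≤ (ns.map X).sum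

theorem Constraint.holdsSub_zero {c : Constraint} : c.HoldsSub X 0 ↔ c.Holds X := by
  cases c with
  | eq pos neg =>
    simp only [HoldsSub, Holds, Nat.add_zero, sub_eq_zero, Nat.cast_inj]
  | ge ns => exact Iff.rfl

theorem Constraint.holdsSub_sub {c : Constraint} {n k : ℕ} :
    (c.sub n).HoldsSub X k ↔ c.HoldsSub X (X n + k) := by
  cases c with
  | eq pos neg => simp [HoldsSub, Constraint.sub, Nat.add_assoc]
  | ge ns => exact Iff.rfl

theorem solves_chain (a : List ℕ) (l : List (List ℕ)) :
    (∀ c ∈ chain (a :: l), c.Holds X) ↔ ∀ b ∈ l, (b.map X).sum = (a.map X).sum := by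
  induction l generalizing a with
  | nil => simp [chain]
  | cons b l ih =>
    simp only [chain, List.mem_cons, forall_eq_or_imp, ih]
    rw [← Constraint.holdsSub_zero]
    simp only [Constraint.HoldsSub, Nat.add_zero]
    constructor
    · rintro ⟨h₁, h₂⟩
      exact ⟨h₁.symm, fun c hc => (h₂ c hc).trans h₁.symm⟩
    · rintro ⟨h₁, h₂⟩
      exact ⟨h₁.symm, fun c hc => (h₂ c hc).trans h₁.symm⟩

theorem solves_unify (σ : STy ι) (Θ : GTy σ) (l : List (GTy σ)) :
    (∀ c ∈ unify σ (Θ :: l), c.Holds X) ↔ ∀ Θ' ∈ l, Θ'.inst X = Θ.inst X := by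
  induction σ with
  | atom a =>
    simp only [unify, List.map_cons, solves_chain, List.forall_mem_map, GTy.inst_eq_iff]
    refine forall₂_congr fun Θ' _ => ⟨fun h => ⟨h, ?_⟩, fun h => h.1⟩
    cases Θ; cases Θ'; rfl
  | arr σ τ ih₁ ih₂ =>
    simp only [unify, List.map_cons, List.mem_append, or_imp, forall_and, ih₁, ih₂, solves_chain,
      List.forall_mem_map, GTy.inst_eq_iff (σ := .arr σ τ), GTy.core_eq_lolli,
      Formula.lolli.injEq, and_assoc]

/-- The first equation of a unification compares the outermost exponents. -/
theorem exists_unify_pair_eq (Θ Θ' : GTy σ) :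
    ∃ cs, unify σ [Θ, Θ'] = .eq Θ.outer Θ'.outer :: cs ∧
      ∀ X, (∀ c ∈ cs, c.Holds X) ↔ Θ.core X = Θ'.core X := by
  cases σ with
  | atom a =>
    refine ⟨[], rfl, fun X => ?_⟩
    cases Θ; cases Θ'; simp [GTy.core]
  | arr σ τ =>
    refine ⟨unify σ [Θ.dom, Θ'.dom] ++ unify τ [Θ.cod, Θ'.cod], rfl, fun X => ?_⟩
    simp only [List.mem_append, or_imp, forall_and, solves_unify, List.mem_singleton, forall_eq,
      GTy.core_eq_lolli, Formula.lolli.injEq, eq_comm]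

theorem solves_contraction (Θ : GTy σ) (l : List (GTy σ)) :
    (∀ c ∈ contraction (Θ :: l), c.Holds X) ↔
      (l ≠ [] → ∃ A, Θ.inst X = .bang A) ∧ ∀ Θ' ∈ l, Θ'.inst X = Θ.inst X := by
  cases l with
  | nil => simp [contraction]
  | cons Θ' l =>
    rw [contraction, List.forall_mem_cons, solves_unify, ← GTy.one_le_outer_iff]
    simp [Constraint.Holds]

/-! ### Slices as boxes -/

/-- The slice is empty or belongs to the set of slices. -/
def Slice.Allowed (cpts : List Slice) (sl : Slice) : Prop := sl ∈ cpts ∨ sl = []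

theorem Slice.hasRow_append (s t : Slice) (i : ℕ) :
    Slice.hasRow (s ++ t) i = (s.hasRow i || t.hasRow i) := by
  simp [Slice.hasRow]

theorem Slice.hasOcc_append (s t : Slice) (o : ℕ) :
    Slice.hasOcc (s ++ t) o = (s.hasOcc o || t.hasOcc o) := by
  simp [Slice.hasOcc]

theorem mem_productUnion {cpts₁ cpts₂ : List Slice} {sl : Slice} :
    sl ∈ productUnion cpts₁ cpts₂ ↔
      sl ∈ cpts₁ ∨ sl ∈ cpts₂ ∨ ∃ s ∈ cpts₁, ∃ t ∈ cpts₂, sl = s ++ t := by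
  induction cpts₁ with
  | nil => simp [productUnion]
  | cons s cpts₁ ih =>
    simp only [productUnion, List.cons_append, List.mem_cons, List.mem_append, List.mem_map, ih]
    constructor
    · rintro (h | ⟨t, ht, rfl⟩ | h | h | ⟨s', hs', t, ht, rfl⟩)
      · exact .inl (.inl h)
      · exact .inr (.inr ⟨s, .inl rfl, t, ht, rfl⟩)
      · exact .inl (.inr h)
      · exact .inr (.inl h)
      · exact .inr (.inr ⟨s', .inr hs', t, ht, rfl⟩)
    · rintro ((h | h) | h | ⟨s', rfl | hs', t, ht, rfl⟩)
      · exact .inl h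
      · exact .inr (.inr (.inl h))
      · exact .inr (.inr (.inr (.inl h)))
      · exact .inr (.inl ⟨t, ht, rfl⟩)
      · exact .inr (.inr (.inr (.inr ⟨s', hs', t, ht, rfl⟩)))

/-- With the empty slice admitted on both sides, the product union is simply the set of all pairs:
slices of one side alone are paired with the empty one. -/
theorem Slice.allowed_productUnion {cpts₁ cpts₂ : List Slice} {sl : Slice} :
    Slice.Allowed (productUnion cpts₁ cpts₂) sl ↔
      ∃ s t, Slice.Allowed cpts₁ s ∧ Slice.Allowed cpts₂ t ∧ sl = s ++ t := by
  rw [Slice.Allowed, mem_productUnion]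
  constructor
  · rintro ((h | h | ⟨s, hs, t, ht, rfl⟩) | rfl)
    · exact ⟨sl, [], .inl h, .inr rfl, by simp⟩
    · exact ⟨[], sl, .inr rfl, .inl h, rfl⟩
    · exact ⟨s, t, .inl hs, .inl ht, rfl⟩
    · exact ⟨[], [], .inr rfl, .inr rfl, rfl⟩
  · rintro ⟨s, t, hs | rfl, ht | rfl, rfl⟩
    · exact .inl (.inr (.inr ⟨s, hs, t, ht, rfl⟩))
    · exact .inl (.inl (by simpa using hs))
    · exact .inl (.inr (.inl ht))
    · exact .inr rfl

/-- The rows hold when the boxes `W` are put around the term. -/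
def RowsHold (X : ℕ → ℕ) (W : List Slice) (A : List Row) : Prop :=
  ∀ r ∈ A, r.lin.HoldsSub X (W.countP fun sl => sl.hasRow r.id)

/-- When the boxes `W` are put around the term, the types of the variable occurrences are given
by `T`. -/
def BaseFits (X : ℕ → ℕ) (W : List Slice) (B : List (Entry E)) (T : ℕ → Formula ι) : Prop :=
  ∀ e ∈ B, Formula.bang^[W.countP fun sl => !sl.hasOcc e.occ] (e.ty.inst X) = T e.var

theorem RowsHold.perm {W W' : List Slice} {A : List Row} (h : RowsHold X W A) (hW : W.Perm W') :
    RowsHold X W' A := fun r hr => hW.countP_eq (fun sl => sl.hasRow r.id) ▸ h r hr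

theorem BaseFits.perm {W W' : List Slice} {B : List (Entry E)} {T : ℕ → Formula ι}
    (h : BaseFits X W B T) (hW : W.Perm W') :
    BaseFits X W' B T := fun e he => hW.countP_eq (fun sl => !sl.hasOcc e.occ) ▸ h e he

theorem rowsHold_append {W : List Slice} {A A' : List Row} :
    RowsHold X W (A ++ A') ↔ RowsHold X W A ∧ RowsHold X W A' := List.forall_mem_append

theorem baseFits_append {W : List Slice} {B B' : List (Entry E)} {T : ℕ → Formula ι} :
    BaseFits X W (B ++ B') T ↔ BaseFits X W B T ∧ BaseFits X W B' T := List.forall_mem_append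

/-- The boxes through critical points that boxing adds under the instantiation `X`. -/
def sliceBoxes (X : ℕ → ℕ) : List Slice → ℕ → List Slice
  | [], _ => []
  | sl :: cpts, n => List.replicate (X n) sl ++ sliceBoxes X cpts (n + 1)

/-- The boxes that boxing adds under the instantiation `X`. -/
def addedBoxes (X : ℕ → ℕ) (M : Term) (cpts : List Slice) (n : ℕ) : List Slice :=
  if M.isVar then []
  else sliceBoxes X cpts n ++ List.replicate (X (n + cpts.length)) []

theorem boxSlices_next (B : List (Entry E)) (Γ : GTy σ) (cpts : List Slice) (A : List Row)
    (n : ℕ) : (boxSlices B Γ cpts A n).next = n + cpts.length := by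
  induction cpts generalizing B Γ A n with
  | nil => rfl
  | cons sl cpts ih => simp only [boxSlices, ih, List.length_cons]; omega

/-- The fresh variable c of a slice stands for X(c) boxes with that slice: subtracting c from the
equations of the slice amounts to counting these boxes. -/
theorem rowsHold_boxSlices {W : List Slice} (B : List (Entry E)) (Γ : GTy σ) (cpts : List Slice)
    (A : List Row) (n : ℕ) :
    RowsHold X W (boxSlices B Γ cpts A n).rows ↔ RowsHold X (W ++ sliceBoxes X cpts n) A := by
  induction cpts generalizing B Γ A n with
  | nil => simp [boxSlices, sliceBoxes]
  | cons sl cpts ih =>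
    rw [boxSlices, ih]
    simp only [RowsHold, List.forall_mem_map]
    refine forall₂_congr fun r _ => ?_
    simp only [sliceBoxes, List.countP_append, List.countP_replicate]
    by_cases h : sl.hasRow r.id = true
    · simp only [h, if_true, Constraint.holdsSub_sub, Nat.add_left_comm (X n)]
    · simp only [h, Bool.false_eq_true, if_false, Nat.zero_add]

/-- An occurrence not listed in a slice lies inside the boxes of that slice, which is why its type
is the one that receives !^c. -/
theorem baseFits_boxSlices {W : List Slice} {T : ℕ → Formula ι} (B : List (Entry E)) (Γ : GTy σ)
    (cpts : List Slice) (A : List Row) (n : ℕ) :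
    BaseFits X W (boxSlices B Γ cpts A n).base T ↔ BaseFits X (W ++ sliceBoxes X cpts n) B T := by
  induction cpts generalizing B Γ A n with
  | nil => simp [boxSlices, sliceBoxes]
  | cons sl cpts ih =>
    rw [boxSlices, ih]
    simp only [BaseFits, List.forall_mem_map]
    refine forall₂_congr fun e _ => ?_
    by_cases h : sl.hasOcc e.occ = true
    · rw [show (if sl.hasOcc e.occ = true then e else e.bang n) = e from if_pos h]
      simp only [sliceBoxes, List.countP_append, List.countP_replicate, h, Bool.not_true,
        Bool.false_eq_true, if_false, Nat.zero_add]
    · rw [show (if sl.hasOcc e.occ = true then e else e.bang n) = e.bang n from if_neg h]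
      simp only [sliceBoxes, List.countP_append, List.countP_replicate, h, Entry.bang,
        GTy.inst_bang, ← Formula.iterate_bang_add, Bool.not_false, if_true]
      rw [show ∀ a b c : ℕ, a + (b + c) = a + c + b by omega]

theorem inst_boxSlices_ty (B : List (Entry E)) (Γ : GTy σ) (cpts : List Slice) (A : List Row)
    (n : ℕ) : (boxSlices B Γ cpts A n).ty.inst X =
      Formula.bang^[(sliceBoxes X cpts n).length] (Γ.inst X) := by
  induction cpts generalizing B Γ A n with
  | nil => rfl
  | cons sl cpts ih =>
    rw [boxSlices, ih, GTy.inst_bang, ← Formula.iterate_bang_add, sliceBoxes, List.length_append,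
      List.length_replicate, Nat.add_comm]

theorem boxSlices_base_map (B : List (Entry E)) (Γ : GTy σ) (cpts : List Slice) (A : List Row)
    (n : ℕ) : (boxSlices B Γ cpts A n).base.map (fun e => (e.var, e.occ)) =
      B.map fun e => (e.var, e.occ) := by
  induction cpts generalizing B Γ A n with
  | nil => rfl
  | cons sl cpts ih =>
    rw [boxSlices, ih, List.map_map]
    refine List.map_congr_left fun e _ => ?_
    simp only [Function.comp]
    split_ifs <;> rfl

theorem boxSlices_rows_map (B : List (Entry E)) (Γ : GTy σ) (cpts : List Slice) (A : List Row)
    (n : ℕ) : (boxSlices B Γ cpts A n).rows.map Row.id = A.map Row.id := by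
  induction cpts generalizing B Γ A n with
  | nil => rfl
  | cons sl cpts ih =>
    rw [boxSlices, ih, List.map_map]
    refine List.map_congr_left fun e _ => ?_
    simp only [Function.comp]
    split_ifs <;> rfl

section Box

variable (M : Term) (B : List (Entry E)) (Γ : GTy σ) (cpts : List Slice) (A : List Row) (n : ℕ)

theorem le_box_next : n ≤ (box M B Γ cpts A n).next := by
  rw [box]
  split_ifs
  · exact le_rfl
  · simp only [boxSlices_next]; omega

theorem rowsHold_box {W : List Slice} :
    RowsHold X W (box M B Γ cpts A n).rows ↔ RowsHold X (W ++ addedBoxes X M cpts n) A := by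
  rw [box, addedBoxes]
  split_ifs
  · simp
  · rw [rowsHold_boxSlices]
    simp [RowsHold, List.countP_append, List.countP_replicate, Slice.hasRow]

theorem baseFits_box {W : List Slice} {T : ℕ → Formula ι} :
    BaseFits X W (box M B Γ cpts A n).base T ↔
      BaseFits X (W ++ addedBoxes X M cpts n) B T := by
  rw [box, addedBoxes]
  split_ifs
  · simp
  · have h : ∀ (B : List (Entry E)) (c : ℕ), BaseFits X W (B.map (Entry.bang c)) T ↔
        BaseFits X (W ++ List.replicate (X c) []) B T := by
      intro B c
      simp only [BaseFits, List.forall_mem_map]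
      refine forall₂_congr fun e _ => ?_
      simp [Entry.bang, GTy.inst_bang, Formula.iterate_bang_add, List.countP_replicate,
        Slice.hasOcc]
    simp only [h, boxSlices_next, baseFits_boxSlices]
    have hp : ∀ V V' : List Slice, (W ++ V ++ V').Perm (W ++ (V' ++ V)) := fun V V' => by
      rw [List.append_assoc]
      exact List.Perm.append_left _ List.perm_append_comm
    exact ⟨fun h => h.perm (hp _ _), fun h => h.perm (hp _ _).symm⟩

theorem inst_box_ty : (box M B Γ cpts A n).ty.inst X =
    Formula.bang^[(addedBoxes X M cpts n).length] (Γ.inst X) := by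
  rw [box, addedBoxes]
  split_ifs
  · rfl
  · simp only [GTy.inst_bang, inst_boxSlices_ty, boxSlices_next, ← Formula.iterate_bang_add,
      List.length_append, List.length_replicate, Nat.add_comm]

theorem box_base_map : (box M B Γ cpts A n).base.map (fun e => (e.var, e.occ)) =
    B.map fun e => (e.var, e.occ) := by
  rw [box]
  split_ifs
  · rfl
  · simp only [List.map_map]
    exact boxSlices_base_map B Γ cpts A n

theorem box_base_map_var : (box M B Γ cpts A n).base.map Entry.var = B.map Entry.var := by
  have := congrArg (List.map Prod.fst) (box_base_map M B Γ cpts A n)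
  rw [List.map_map, List.map_map] at this
  exact this

theorem occurrences_box : occurrences (box M B Γ cpts A n).base = occurrences B := by
  have := congrArg (List.map Prod.snd) (box_base_map M B Γ cpts A n)
  rw [List.map_map, List.map_map] at this
  exact this

theorem box_rows_map : (box M B Γ cpts A n).rows.map Row.id = A.map Row.id := by
  rw [box]
  split_ifs
  · rfl
  · exact boxSlices_rows_map B Γ cpts A n

/-- A property of variables and occurrences holds for the boxed base iff it holds for the base. -/
theorem forall_mem_box_base {p : ℕ → ℕ → Prop} :
    (∀ e ∈ (box M B Γ cpts A n).base, p e.var e.occ) ↔ ∀ e ∈ B, p e.var e.occ := by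
  have h : ∀ L : List (Entry E), (∀ e ∈ L, p e.var e.occ) ↔
      ∀ q ∈ L.map (fun e => (e.var, e.occ)), p q.1 q.2 := fun L => by
    simp only [List.forall_mem_map]
  rw [h, box_base_map, ← h]

end Box

/-- Every collection of allowed boxes is added by boxing under some instantiation. -/
theorem exists_addedBoxes_perm (M : Term) (cpts : List Slice) (n : ℕ) (X₀ : ℕ → ℕ)
    (V : List Slice) (hV : ∀ sl ∈ V, Slice.Allowed cpts sl) (hM : M.isVar = true → V = [])
    {E : ℕ → STy ι} {σ : STy ι} (B : List (Entry E)) (Γ : GTy σ) (A : List Row) :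
    ∃ X : ℕ → ℕ, (∀ i < n, X i = X₀ i) ∧
      ∀ X' : ℕ → ℕ, (∀ i < (box M B Γ cpts A n).next, X' i = X i) →
        (addedBoxes X' M cpts n).Perm V := by
  by_cases hv : M.isVar = true
  · exact ⟨X₀, fun _ _ => rfl, fun X' _ => by simp [addedBoxes, hv, hM hv]⟩
  · have hnext : (box M B Γ cpts A n).next = n + cpts.length + 1 := by
      simp [box, hv, boxSlices_next]
    rw [hnext]
    simp only [addedBoxes, hv, Bool.false_eq_true, if_false]
    clear hM hnext
    induction cpts generalizing n X₀ V with
    | nil =>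
      -- No slices are left, so every box in `V` is empty and they are all assigned to the variable
      -- b, which is number `n`.
      refine ⟨Function.update X₀ n V.length, fun i hi => by simp [hi.ne], fun X' hX' => ?_⟩
      have hV' : V = List.replicate V.length [] :=
        List.eq_replicate_of_mem fun sl hsl => (hV sl hsl).resolve_left (by simp)
      have := hX' n (by simp)
      simp only [Function.update_self] at this
      simp only [sliceBoxes, List.length_nil, Nat.add_zero, List.nil_append, this, ← hV']
      exact List.Perm.refl _
    | cons sl cpts ih =>
      classical
      -- The variable of the first slice gets the multiplicity of this slice in `V`; the rest of `V`
      -- is left to the later variables.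
      obtain ⟨X, h₁, h₂⟩ := ih (n + 1) (Function.update X₀ n (V.count sl))
        (V.filter fun s => !(s == sl)) (by
          intro s hs
          simp only [List.mem_filter, Bool.not_eq_true', beq_eq_false_iff_ne] at hs
          exact (hV s hs.1).imp_left fun h => (List.mem_cons.1 h).resolve_left hs.2)
      refine ⟨X, fun i hi => ?_, fun X' hX' => ?_⟩
      · rw [h₁ i (by omega)]; simp [hi.ne]
      · have h₃ := h₂ X' fun i hi => hX' i (by simp only [List.length_cons]; omega)
        have h₄ : X' n = V.count sl := by
          rw [hX' n (by omega), h₁ n (by omega)]; simp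
        simp only [sliceBoxes, List.length_cons, h₄, List.append_assoc]
        rw [show n + (cpts.length + 1) = n + 1 + cpts.length by omega]
        refine (List.Perm.append_left _ h₃).trans ?_
        rw [← List.filter_beq]
        exact List.filter_append_perm (fun s => s == sl) V

/-! ### Type processing -/

theorem le_process_next (σ : STy ι) (n : ℕ) : n ≤ (process σ n).2 := by
  induction σ generalizing n with
  | atom a => exact Nat.le_succ n
  | arr σ τ ih₁ ih₂ =>
    have h₁ := ih₁ (n + 1)
    have h₂ := ih₂ (process σ (n + 1)).2
    simp only [process]
    omega

/-- Every formula with erasure `σ` is an instance of the processed type. -/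
theorem exists_inst_process (σ : STy ι) (A : Formula ι) (hA : A.erase = σ) (n : ℕ) (X₀ : ℕ → ℕ) :
    ∃ X : ℕ → ℕ, (∀ i < n, X i = X₀ i) ∧
      ∀ X' : ℕ → ℕ, (∀ i < (process σ n).2, X' i = X i) → (process σ n).1.inst X' = A := by
  obtain ⟨m, A₀, rfl, hcore⟩ := A.exists_eq_iterate_bang
  rw [Formula.erase_iterate_bang] at hA
  induction σ generalizing m A₀ n X₀ with
  | atom a =>
    refine ⟨Function.update X₀ n m, fun i hi => by simp [hi.ne], fun X' hX' => ?_⟩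
    have := hX' n (Nat.lt_succ_self n)
    cases A₀ with
    | atom b =>
      obtain rfl := STy.atom.inj hA
      simp [process, GTy.inst, this]
    | lolli A B => cases hA
    | bang A => exact hcore.elim
  | arr σ τ ih₁ ih₂ =>
    cases A₀ with
    | atom b => cases hA
    | bang A => exact hcore.elim
    | lolli A B =>
      obtain ⟨hA', hB⟩ := STy.arr.inj hA
      obtain ⟨a, A₀, rfl, hA₀⟩ := A.exists_eq_iterate_bang
      obtain ⟨b, B₀, rfl, hB₀⟩ := B.exists_eq_iterate_bang
      rw [Formula.erase_iterate_bang] at hA' hB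
      obtain ⟨X₁, h₁, h₁'⟩ := ih₁ (n + 1) (Function.update X₀ n m) a A₀ hA₀ hA'
      obtain ⟨X₂, h₂, h₂'⟩ := ih₂ (process σ (n + 1)).2 X₁ b B₀ hB₀ hB
      have hle₁ := le_process_next σ (n + 1)
      have hle₂ := le_process_next τ (process σ (n + 1)).2
      refine ⟨X₂, fun i hi => ?_, fun X' hX' => ?_⟩
      · rw [h₂ i (by omega), h₁ i (by omega)]; simp [hi.ne]
      · simp only [process] at hX' ⊢
        simp only [GTy.inst]
        rw [h₁' X' fun i hi => by rw [hX' i (by omega), h₂ i hi], h₂' X' hX']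
        have : X' n = m := by
          rw [hX' n (by omega), h₂ n (by omega), h₁ n (by omega)]; simp
        simp [this]

end

end EAL

namespace EAL

/-! ### The meaning of type synthesis, node by node -/

section

variable {ι : Type*} {E : ℕ → STy ι} {σ τ : STy ι} {X : ℕ → ℕ}

/-- All identities in the slice are numbers from `m` to `n - 1`. -/
def Slice.InRange (m n : ℕ) (sl : Slice) : Prop :=
  ∀ p ∈ sl, (m ≤ p.1 ∧ p.1 < n) ∧ ∀ o ∈ p.2, m ≤ o ∧ o < n

theorem Slice.InRange.hasRow_eq_false {m n : ℕ} {sl : Slice} (h : sl.InRange m n) {i : ℕ}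
    (hi : i < m ∨ n ≤ i) : sl.hasRow i = false := by
  simp only [Slice.hasRow, List.any_eq_false, beq_iff_eq]
  intro p hp hpi
  have := (h p hp).1
  omega

theorem Slice.InRange.hasOcc_eq_false {m n : ℕ} {sl : Slice} (h : sl.InRange m n) {o : ℕ}
    (ho : o < m ∨ n ≤ o) : sl.hasOcc o = false := by
  simp only [Slice.hasOcc, List.any_eq_false, List.contains_iff_mem]
  intro p hp hpo
  have := (h p hp).2 o hpo
  omega

theorem Slice.InRange.mono {m n m' n' : ℕ} {sl : Slice} (h : sl.InRange m n) (hm : m' ≤ m)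
    (hn : n ≤ n') : sl.InRange m' n' := fun p hp =>
  ⟨⟨hm.trans (h p hp).1.1, (h p hp).1.2.trans_le hn⟩, fun o ho =>
    ⟨hm.trans ((h p hp).2 o ho).1, ((h p hp).2 o ho).2.trans_le hn⟩⟩

theorem Slice.inRange_append {m n : ℕ} {s t : Slice} (hs : s.InRange m n) (ht : t.InRange m n) :
    Slice.InRange m n (s ++ t) := fun p hp => (List.mem_append.1 hp).elim (hs p) (ht p)

/-- The slice with a single critical point. -/
def Slice.point (i : ℕ) (os : List ℕ) : Slice := [(i, os)]

theorem Slice.hasRow_point (i : ℕ) (os : List ℕ) (j : ℕ) :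
    (Slice.point i os).hasRow j = (i == j) := by simp [Slice.hasRow, Slice.point]

theorem Slice.hasOcc_point (i : ℕ) (os : List ℕ) (o : ℕ) :
    (Slice.point i os).hasOcc o = os.contains o := by simp [Slice.hasOcc, Slice.point]

theorem Slice.inRange_point {m n i : ℕ} {os : List ℕ} (hi : m ≤ i ∧ i < n)
    (ho : ∀ o ∈ os, m ≤ o ∧ o < n) : (Slice.point i os).InRange m n := by
  intro p hp
  obtain rfl := List.mem_singleton.1 hp
  exact ⟨hi, ho⟩

namespace Synth

/-- The synthesized data uses only identities from `n` on. -/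
structure InRange (n : ℕ) (r : Synth E σ) : Prop where
  le : n ≤ r.next
  occ : ∀ e ∈ r.base, n ≤ e.occ ∧ e.occ < r.next
  row : ∀ a ∈ r.rows, n ≤ a.id ∧ a.id < r.next
  slice : ∀ sl ∈ r.cpts, sl.InRange n r.next

theorem InRange.allowed {n : ℕ} {r : Synth E σ} (h : r.InRange n) {sl : Slice}
    (hsl : Slice.Allowed r.cpts sl) : sl.InRange n r.next := by
  rcases hsl with hsl | rfl
  · exact h.slice sl hsl
  · exact fun p hp => absurd hp List.not_mem_nil

/-- The rows hold, and the types of the variable occurrences are given by `T`, when the boxes `W`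
are put around the term. -/
def Fits (X : ℕ → ℕ) (W : List Slice) (r : Synth E σ) (T : ℕ → Formula ι) : Prop :=
  RowsHold X W r.rows ∧ BaseFits X W r.base T

theorem Fits.perm {W W' : List Slice} {r : Synth E σ} {T : ℕ → Formula ι} (h : r.Fits X W T)
    (hW : W.Perm W') : r.Fits X W' T := ⟨h.1.perm hW, h.2.perm hW⟩

/-- Boxing of the synthesized data for `M`. -/
def boxed (M : Term) (r : Synth E σ) : Boxed E σ := box M r.base r.ty r.cpts r.rows r.next

/-- The boxes that boxing adds. -/
def added (X : ℕ → ℕ) (M : Term) (r : Synth E σ) : List Slice :=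
  addedBoxes X M r.cpts r.next

/-- Boxed data under the boxes `W` mean the same as unboxed data under more boxes. Boxing is thereby
absorbed into the list of boxes. -/
theorem fits_boxed {M : Term} {r : Synth E σ} {W : List Slice} {T : ℕ → Formula ι} :
    RowsHold X W (r.boxed M).rows ∧ BaseFits X W (r.boxed M).base T ↔
      r.Fits X (W ++ r.added X M) T :=
  and_congr (rowsHold_box ..) (baseFits_box ..)

theorem le_boxed_next (M : Term) (r : Synth E σ) : r.next ≤ (r.boxed M).next := le_box_next ..

theorem InRange.boxed_occ {n : ℕ} {r : Synth E σ} (h : r.InRange n) (M : Term) :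
    ∀ e ∈ (r.boxed M).base, n ≤ e.occ ∧ e.occ < r.next :=
  (forall_mem_box_base (p := fun _ o => n ≤ o ∧ o < r.next) ..).2 h.occ

theorem InRange.boxed_row {n : ℕ} {r : Synth E σ} (h : r.InRange n) (M : Term) :
    ∀ a ∈ (r.boxed M).rows, n ≤ a.id ∧ a.id < r.next := by
  have h₁ : ∀ i ∈ r.rows.map Row.id, n ≤ i ∧ i < r.next := by
    simpa only [List.forall_mem_map] using h.row
  rw [← box_rows_map M r.base r.ty r.cpts r.rows r.next] at h₁
  rw [List.forall_mem_map] at h₁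
  exact h₁

end Synth

theorem newRows_cons (m : ℕ) (c : Constraint) (cs : List Constraint) :
    newRows m (c :: cs) = ⟨m, c⟩ :: newRows (m + 1) cs := by
  simp [newRows, List.mapIdx_cons, Nat.add_comm, Nat.add_left_comm]

theorem mem_newRows {m : ℕ} {cs : List Constraint} {a : Row} (h : a ∈ newRows m cs) :
    m ≤ a.id ∧ a.id < m + cs.length := by
  simp only [newRows, List.mem_mapIdx] at h
  obtain ⟨i, hi, rfl⟩ := h
  simp only
  omega

/-- The boxes do not shift rows that belong to none of their slices. -/
theorem rowsHold_newRows {W : List Slice} {m : ℕ} {cs : List Constraint}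
    (h : ∀ sl ∈ W, ∀ i, m ≤ i → i < m + cs.length → Slice.hasRow sl i = false) :
    RowsHold X W (newRows m cs) ↔ ∀ c ∈ cs, c.Holds X := by
  induction cs generalizing m with
  | nil => simp [newRows, RowsHold]
  | cons c cs ih =>
    have h0 : W.countP (fun sl => sl.hasRow m) = 0 :=
      List.countP_eq_zero.2 fun sl hsl => by
        simp [h sl hsl m le_rfl (by simp)]
    have := ih (m := m + 1) fun sl hsl i hi hi' => h sl hsl i (by omega) (by
      simp only [List.length_cons]; omega)
    rw [newRows_cons, List.forall_mem_cons, ← this]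
    unfold RowsHold
    rw [List.forall_mem_cons, h0, Constraint.holdsSub_zero]

/-- In the application `p` says that a box stops at a given row of the head, or contains a given
occurrence in it, and `q` that the box enters the head at all. Counting over the combined boxes then
reduces to the boxes that enter the head. -/
theorem countP_map_append_left {Z : List (Slice × Slice)} {p q : Slice → Bool}
    (h : ∀ z ∈ Z, p (z.1 ++ z.2) = (p z.1 && q z.1)) :
    (Z.map fun z => z.1 ++ z.2).countP p = ((Z.map Prod.fst).filter q).countP p := by
  rw [List.countP_filter, List.countP_map, List.countP_map]
  exact List.countP_congr fun z hz => by simp [h z hz]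

theorem countP_map_append_right {Z : List (Slice × Slice)} {p q : Slice → Bool}
    (h : ∀ z ∈ Z, p (z.1 ++ z.2) = (p z.2 && q z.2)) :
    (Z.map fun z => z.1 ++ z.2).countP p = ((Z.map Prod.snd).filter q).countP p := by
  rw [List.countP_filter, List.countP_map, List.countP_map]
  exact List.countP_congr fun z hz => by simp [h z hz]

theorem length_filter_not_add_countP {α : Type*} (l : List α) (p : α → Bool) :
    (l.filter fun a => !p a).length + l.countP p = l.length := by
  induction l with
  | nil => rfl
  | cons a l ih => by_cases h : p a = true <;> simp [h] <;> omega

/-! #### Applications -/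

section App

variable (M N : Term) (r₁ : Synth E (.arr σ τ)) (r₂ : Synth E σ)

/-- The equations between the type of the argument and the domain of the function. -/
def appUnify : List Constraint :=
  if N.isApp then unify σ [(r₂.boxed N).ty, r₁.ty.dom] else unify σ [r₁.ty.dom, (r₂.boxed N).ty]

/-- The identity of the row for the outermost exponent of the type of the function. -/
def appKey : ℕ := (r₂.boxed N).next + (appUnify N r₁ r₂).length

def headSlices : List Slice :=
  if M.isApp then r₁.cpts ++ [Slice.point (appKey N r₁ r₂) (occurrences r₁.base)] else r₁.cpts

def argSlices : List Slice :=
  if N.isApp then r₂.cpts ++ [Slice.point (r₂.boxed N).next (occurrences r₂.base)] else r₂.cpts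

theorem synthApp_eq : synthApp M N r₁ r₂ =
    ⟨r₁.ty.cod, r₁.base ++ (r₂.boxed N).base,
      r₁.rows ++ (r₂.boxed N).rows ++ newRows (r₂.boxed N).next (appUnify N r₁ r₂) ++
        [⟨appKey N r₁ r₂, .eq r₁.ty.outer []⟩],
      productUnion (headSlices M N r₁ r₂) (argSlices N r₂), appKey N r₁ r₂ + 1⟩ := rfl

variable {M N r₁ r₂}

theorem allowed_headSlices {sl : Slice} (h : Slice.Allowed (headSlices M N r₁ r₂) sl) :
    Slice.Allowed r₁.cpts sl ∨
      M.isApp = true ∧ sl = Slice.point (appKey N r₁ r₂) (occurrences r₁.base) := by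
  rw [headSlices] at h
  split_ifs at h with hM
  · rcases h with h | h
    · rcases List.mem_append.1 h with h | h
      · exact .inl (.inl h)
      · exact .inr ⟨hM, List.mem_singleton.1 h⟩
    · exact .inl (.inr h)
  · exact .inl h

theorem allowed_argSlices {sl : Slice} (h : Slice.Allowed (argSlices N r₂) sl) :
    Slice.Allowed r₂.cpts sl ∨
      N.isApp = true ∧ sl = Slice.point (r₂.boxed N).next (occurrences r₂.base) := by
  rw [argSlices] at h
  split_ifs at h with hN
  · rcases h with h | h
    · rcases List.mem_append.1 h with h | h
      · exact .inl (.inl h)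
      · exact .inr ⟨hN, List.mem_singleton.1 h⟩
    · exact .inl (.inr h)
  · exact .inl h

/-- Boxes that stop at the argument are subtracted on the left side of the first equation, so the
exponent of the argument must stand there. If `N` is not an application, no box stops at it, `k` is
0, and the orientation is immaterial. -/
theorem appUnify_eq : ∃ c cs, appUnify N r₁ r₂ = c :: cs ∧
    (∀ X, (∀ c ∈ cs, c.Holds X) ↔ (r₂.boxed N).ty.core X = r₁.ty.dom.core X) ∧
    ∀ X k, (N.isApp = false → k = 0) → (c.HoldsSub X k ↔
      ((r₂.boxed N).ty.outer.map X).sum = (r₁.ty.dom.outer.map X).sum + k) := by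
  rw [appUnify]
  split_ifs with hN
  · obtain ⟨cs, h₁, h₂⟩ := exists_unify_pair_eq (r₂.boxed N).ty r₁.ty.dom
    exact ⟨_, cs, h₁, h₂, fun X k _ => Iff.rfl⟩
  · obtain ⟨cs, h₁, h₂⟩ := exists_unify_pair_eq r₁.ty.dom (r₂.boxed N).ty
    refine ⟨_, cs, h₁, fun X => (h₂ X).trans eq_comm, fun X k hk => ?_⟩
    obtain rfl := hk (by simpa using hN)
    simp only [Constraint.HoldsSub, Nat.add_zero, eq_comm]

theorem boxed_next_lt_appKey : (r₂.boxed N).next < appKey N r₁ r₂ := by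
  obtain ⟨c, cs, h, -⟩ := appUnify_eq (N := N) (r₁ := r₁) (r₂ := r₂)
  simp [appKey, h]

variable {n : ℕ}

/-- The boxes around the head. -/
def headBoxes (N : Term) (r₁ : Synth E (.arr σ τ)) (r₂ : Synth E σ) (Z : List (Slice × Slice)) :
    List Slice :=
  (Z.map Prod.fst).filter fun sl => !sl.hasRow (appKey N r₁ r₂)

/-- The boxes around the argument, without those that boxing adds. -/
def argBoxes (N : Term) (r₂ : Synth E σ) (Z : List (Slice × Slice)) : List Slice :=
  (Z.map Prod.snd).filter fun sl => !sl.hasRow (r₂.boxed N).next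

/-- Pairs of slices of the head and the argument. -/
def SlicePairs (M N : Term) (r₁ : Synth E (.arr σ τ)) (r₂ : Synth E σ)
    (Z : List (Slice × Slice)) : Prop :=
  ∀ z ∈ Z, Slice.Allowed (headSlices M N r₁ r₂) z.1 ∧ Slice.Allowed (argSlices N r₂) z.2

variable {Z : List (Slice × Slice)}

theorem SlicePairs.headBoxes_allowed (hZ : SlicePairs M N r₁ r₂ Z) :
    ∀ sl ∈ headBoxes N r₁ r₂ Z, Slice.Allowed r₁.cpts sl := by
  intro sl hsl
  simp only [headBoxes, List.mem_filter, List.mem_map] at hsl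
  obtain ⟨⟨z, hz, rfl⟩, h⟩ := hsl
  rcases allowed_headSlices (hZ z hz).1 with h' | ⟨-, h'⟩
  · exact h'
  · rw [h', Slice.hasRow_point] at h
    simp at h

theorem SlicePairs.argBoxes_allowed (hZ : SlicePairs M N r₁ r₂ Z) :
    ∀ sl ∈ argBoxes N r₂ Z, Slice.Allowed r₂.cpts sl := by
  intro sl hsl
  simp only [argBoxes, List.mem_filter, List.mem_map] at hsl
  obtain ⟨⟨z, hz, rfl⟩, h⟩ := hsl
  rcases allowed_argSlices (hZ z hz).2 with h' | ⟨-, h'⟩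
  · exact h'
  · rw [h', Slice.hasRow_point] at h
    simp at h

/-- Head slices mention no identities of the argument. -/
theorem headSlices_spec (h₁ : r₁.InRange n) (h₂ : r₂.InRange r₁.next) {sl : Slice}
    (hsl : Slice.Allowed (headSlices M N r₁ r₂) sl) :
    (∀ i, r₁.next ≤ i → i ≠ appKey N r₁ r₂ → sl.hasRow i = false) ∧
      (∀ o, r₁.next ≤ o → sl.hasOcc o = false) ∧
      (∀ i, i < r₁.next → sl.hasRow i = (sl.hasRow i && !sl.hasRow (appKey N r₁ r₂))) ∧
      ∀ o ∈ occurrences r₁.base,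
        (!sl.hasOcc o) = ((!sl.hasOcc o) && !sl.hasRow (appKey N r₁ r₂)) := by
  have hk : r₁.next < appKey N r₁ r₂ :=
    (h₂.le.trans (Synth.le_boxed_next N r₂)).trans_lt boxed_next_lt_appKey
  rcases allowed_headSlices hsl with h | ⟨-, rfl⟩
  · have hr := h₁.allowed h
    refine ⟨fun i hi _ => hr.hasRow_eq_false (.inr hi), fun o ho => hr.hasOcc_eq_false (.inr ho),
      fun i _ => ?_, fun o _ => ?_⟩
    · simp [hr.hasRow_eq_false (.inr hk.le)]
    · simp [hr.hasRow_eq_false (.inr hk.le)]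
  · refine ⟨fun i _ hi => ?_, fun o ho => ?_, fun i hi => ?_, fun o ho => ?_⟩
    · simpa [Slice.hasRow_point] using hi.symm
    · rw [Slice.hasOcc_point, List.contains_eq_mem, decide_eq_false_iff_not]
      intro h
      obtain ⟨e, he, rfl⟩ := List.mem_map.1 h
      have := (h₁.occ e he).2
      omega
    · have : (appKey N r₁ r₂ == i) = false := by simp; omega
      simp [Slice.hasRow_point, this]
    · simp [Slice.hasRow_point]
      simpa [Slice.hasOcc_point] using ho

/-- Argument slices mention no identities of the head. -/
theorem argSlices_spec (h₂ : r₂.InRange r₁.next) {sl : Slice}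
    (hsl : Slice.Allowed (argSlices N r₂) sl) :
    (∀ i, i < r₁.next ∨ r₂.next ≤ i → i ≠ (r₂.boxed N).next → sl.hasRow i = false) ∧
      (∀ o, o < r₁.next → sl.hasOcc o = false) ∧
      (∀ i, i < r₂.next → sl.hasRow i = (sl.hasRow i && !sl.hasRow (r₂.boxed N).next)) ∧
      (∀ o ∈ occurrences r₂.base,
        (!sl.hasOcc o) = ((!sl.hasOcc o) && !sl.hasRow (r₂.boxed N).next)) ∧
      (N.isApp = false → sl.hasRow (r₂.boxed N).next = false) := by
  have hk := Synth.le_boxed_next N r₂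
  rcases allowed_argSlices hsl with h | ⟨hN, rfl⟩
  · have hr := h₂.allowed h
    refine ⟨fun i hi _ => hr.hasRow_eq_false hi, fun o ho => hr.hasOcc_eq_false (.inl ho),
      fun i _ => ?_, fun o _ => ?_, fun _ => hr.hasRow_eq_false (.inr hk)⟩
    · simp [hr.hasRow_eq_false (.inr hk)]
    · simp [hr.hasRow_eq_false (.inr hk)]
  · refine ⟨fun i _ hi => ?_, fun o ho => ?_, fun i hi => ?_, fun o ho => ?_, fun h => ?_⟩
    · simpa [Slice.hasRow_point] using hi.symm
    · rw [Slice.hasOcc_point, List.contains_eq_mem, decide_eq_false_iff_not]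
      intro h
      obtain ⟨e, he, rfl⟩ := List.mem_map.1 h
      have := (h₂.occ e he).1
      omega
    · have : ((r₂.boxed N).next == i) = false := by simp; omega
      simp [Slice.hasRow_point, this]
    · simp [Slice.hasRow_point]
      simpa [Slice.hasOcc_point] using ho
    · rw [hN] at h; cases h

theorem countP_not_hasOcc_head (h₁ : r₁.InRange n) (h₂ : r₂.InRange r₁.next)
    (hZ : SlicePairs M N r₁ r₂ Z) {o : ℕ} (ho : o ∈ occurrences r₁.base) :
    (Z.map fun z => z.1 ++ z.2).countP (fun sl => !sl.hasOcc o) =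
      (headBoxes N r₁ r₂ Z).countP fun sl => !sl.hasOcc o := by
  refine countP_map_append_left fun z hz => ?_
  have hlt : o < r₁.next := by
    obtain ⟨e, he, rfl⟩ := List.mem_map.1 ho
    exact (h₁.occ e he).2
  rw [Slice.hasOcc_append, (argSlices_spec h₂ (hZ z hz).2).2.1 o hlt, Bool.or_false]
  exact (headSlices_spec h₁ h₂ (hZ z hz).1).2.2.2 o ho

theorem countP_not_hasOcc_arg (h₁ : r₁.InRange n) (h₂ : r₂.InRange r₁.next)
    (hZ : SlicePairs M N r₁ r₂ Z) {o : ℕ} (ho : o ∈ occurrences r₂.base) :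
    (Z.map fun z => z.1 ++ z.2).countP (fun sl => !sl.hasOcc o) =
      (argBoxes N r₂ Z).countP fun sl => !sl.hasOcc o := by
  refine countP_map_append_right fun z hz => ?_
  have hle : r₁.next ≤ o := by
    obtain ⟨e, he, rfl⟩ := List.mem_map.1 ho
    exact (h₂.occ e he).1
  rw [Slice.hasOcc_append, (headSlices_spec h₁ h₂ (hZ z hz).1).2.1 o hle, Bool.false_or]
  exact (argSlices_spec h₂ (hZ z hz).2).2.2.2.1 o ho

theorem rowsHold_head (h₁ : r₁.InRange n) (h₂ : r₂.InRange r₁.next)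
    (hZ : SlicePairs M N r₁ r₂ Z) :
    RowsHold X (Z.map fun z => z.1 ++ z.2) r₁.rows ↔
      RowsHold X (headBoxes N r₁ r₂ Z) r₁.rows := by
  refine forall₂_congr fun a ha => ?_
  have hlt := (h₁.row a ha).2
  have hle := h₂.le.trans (Synth.le_boxed_next N r₂)
  rw [countP_map_append_left (q := fun sl => !sl.hasRow (appKey N r₁ r₂)) fun z hz => ?_]
  · rfl
  · rw [Slice.hasRow_append, (argSlices_spec h₂ (hZ z hz).2).1 a.id (.inl hlt) (by omega),
      Bool.or_false]
    exact (headSlices_spec h₁ h₂ (hZ z hz).1).2.2.1 _ hlt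

theorem rowsHold_arg (h₁ : r₁.InRange n) (h₂ : r₂.InRange r₁.next)
    (hZ : SlicePairs M N r₁ r₂ Z) :
    RowsHold X (Z.map fun z => z.1 ++ z.2) (r₂.boxed N).rows ↔
      RowsHold X (argBoxes N r₂ Z) (r₂.boxed N).rows := by
  refine forall₂_congr fun a ha => ?_
  have hlt := h₂.boxed_row N a ha
  have hle := Synth.le_boxed_next N r₂
  have hk := boxed_next_lt_appKey (N := N) (r₁ := r₁) (r₂ := r₂)
  rw [countP_map_append_right (q := fun sl => !sl.hasRow (r₂.boxed N).next) fun z hz => ?_]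
  · rfl
  · rw [Slice.hasRow_append, (headSlices_spec h₁ h₂ (hZ z hz).1).1 a.id hlt.1 (by omega),
      Bool.false_or]
    exact (argSlices_spec h₂ (hZ z hz).2).2.2.1 _ hlt.2

/-- Each box around the application either enters the head or stops at its root; the row e = 0 is
shifted by the number of the latter. It thus says that the exponent of the head makes up for the
boxes that do not enter it: from outside, the head has as many leading ! as the application has
boxes. -/
theorem rowsHold_appKey (h₂ : r₂.InRange r₁.next)
    (hZ : SlicePairs M N r₁ r₂ Z) :
    RowsHold X (Z.map fun z => z.1 ++ z.2) [⟨appKey N r₁ r₂, .eq r₁.ty.outer []⟩] ↔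
      Formula.bang^[(headBoxes N r₁ r₂ Z).length] (r₁.ty.inst X) =
        Formula.bang^[Z.length] (.lolli (r₁.ty.dom.inst X) (r₁.ty.cod.inst X)) := by
  have hle := Synth.le_boxed_next N r₂
  have hk := boxed_next_lt_appKey (N := N) (r₁ := r₁) (r₂ := r₂)
  have hcount : (Z.map fun z => z.1 ++ z.2).countP (fun sl => sl.hasRow (appKey N r₁ r₂)) =
      (Z.map Prod.fst).countP fun sl => sl.hasRow (appKey N r₁ r₂) := by
    rw [List.countP_map, List.countP_map]
    refine List.countP_congr fun z hz => ?_
    simp only [Function.comp, Slice.hasRow_append]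
    rw [(argSlices_spec h₂ (hZ z hz).2).1 _ (.inr (by omega)) (by omega), Bool.or_false]
  have hlen := length_filter_not_add_countP (Z.map Prod.fst)
    fun sl => Slice.hasRow sl (appKey N r₁ r₂)
  rw [← headBoxes, List.length_map] at hlen
  rw [RowsHold, List.forall_mem_singleton, hcount, ← GTy.core_eq_lolli]
  simp only [Constraint.HoldsSub, List.map_nil, List.sum_nil, Nat.zero_add]
  rw [GTy.inst_eq, ← Formula.iterate_bang_add]
  constructor
  · intro h
    rw [h, hlen]
  · intro h
    have := (Formula.iterate_bang_inj (GTy.isCore_core _) (GTy.isCore_core _) h).1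
    omega

/-- The same balance for the argument: the first equation compensates for the boxes that stop at its
root, and the others, which no slice contains, identify the cores. -/
theorem rowsHold_appUnify (h₁ : r₁.InRange n) (h₂ : r₂.InRange r₁.next)
    (hZ : SlicePairs M N r₁ r₂ Z) :
    RowsHold X (Z.map fun z => z.1 ++ z.2) (newRows (r₂.boxed N).next (appUnify N r₁ r₂)) ↔
      Formula.bang^[(argBoxes N r₂ Z).length] ((r₂.boxed N).ty.inst X) =
        Formula.bang^[Z.length] (r₁.ty.dom.inst X) := by
  have hle := Synth.le_boxed_next N r₂
  have hk := boxed_next_lt_appKey (N := N) (r₁ := r₁) (r₂ := r₂)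
  have hr := h₂.le
  have hcount : (Z.map fun z => z.1 ++ z.2).countP (fun sl => sl.hasRow (r₂.boxed N).next) =
      (Z.map Prod.snd).countP fun sl => sl.hasRow (r₂.boxed N).next := by
    rw [List.countP_map, List.countP_map]
    refine List.countP_congr fun z hz => ?_
    simp only [Function.comp, Slice.hasRow_append]
    rw [(headSlices_spec h₁ h₂ (hZ z hz).1).1 _ (by omega) (by omega), Bool.false_or]
  have hlen := length_filter_not_add_countP (Z.map Prod.snd)
    fun sl => Slice.hasRow sl (r₂.boxed N).next
  rw [← argBoxes, List.length_map] at hlen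
  obtain ⟨c, cs, hu, hcs, hc⟩ := appUnify_eq (N := N) (r₁ := r₁) (r₂ := r₂)
  have hkey : appKey N r₁ r₂ = (r₂.boxed N).next + 1 + cs.length := by
    simp only [appKey, hu, List.length_cons]; omega
  have htail : RowsHold X (Z.map fun z => z.1 ++ z.2) (newRows ((r₂.boxed N).next + 1) cs) ↔
      ∀ c ∈ cs, c.Holds X := by
    refine rowsHold_newRows fun sl hsl i hi hi' => ?_
    obtain ⟨z, hz, rfl⟩ := List.mem_map.1 hsl
    rw [Slice.hasRow_append, (headSlices_spec h₁ h₂ (hZ z hz).1).1 i (by omega) (by omega),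
      (argSlices_spec h₂ (hZ z hz).2).1 i (.inr (by omega)) (by omega), Bool.false_or]
  have hzero : N.isApp = false →
      (Z.map Prod.snd).countP (fun sl => sl.hasRow (r₂.boxed N).next) = 0 := by
    intro hN
    refine List.countP_eq_zero.2 fun sl hsl => ?_
    obtain ⟨z, hz, rfl⟩ := List.mem_map.1 hsl
    simp [(argSlices_spec h₂ (hZ z hz).2).2.2.2.2 hN]
  rw [hu, newRows_cons, GTy.iterate_bang_inst_eq_iff, ← hcs, ← htail]
  unfold RowsHold
  rw [List.forall_mem_cons, hcount, hc _ _ hzero]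
  refine and_congr_left fun _ => ?_
  omega

/-- The right side has the shape of the rule `Leveled.app`. The level of the application is the
length of `Z`, and those of head and argument are the numbers of boxes around them, including for
the argument the boxes that boxing adds. -/
theorem fits_synthApp {T : ℕ → Formula ι} (h₁ : r₁.InRange n) (h₂ : r₂.InRange r₁.next)
    (hZ : SlicePairs M N r₁ r₂ Z) :
    (synthApp M N r₁ r₂).Fits X (Z.map fun z => z.1 ++ z.2) T ↔
      (r₁.Fits X (headBoxes N r₁ r₂ Z) T ∧ r₂.Fits X (argBoxes N r₂ Z ++ r₂.added X N) T) ∧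
      Formula.bang^[(headBoxes N r₁ r₂ Z).length] (r₁.ty.inst X) =
        Formula.bang^[Z.length] (.lolli (r₁.ty.dom.inst X) (r₁.ty.cod.inst X)) ∧
      Formula.bang^[(argBoxes N r₂ Z ++ r₂.added X N).length] (r₂.ty.inst X) =
        Formula.bang^[Z.length] (r₁.ty.dom.inst X) := by
  have hb₁ : BaseFits X (Z.map fun z => z.1 ++ z.2) r₁.base T ↔
      BaseFits X (headBoxes N r₁ r₂ Z) r₁.base T := by
    refine forall₂_congr fun e he => ?_
    rw [countP_not_hasOcc_head h₁ h₂ hZ (List.mem_map_of_mem he)]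
  have hb₂ : BaseFits X (Z.map fun z => z.1 ++ z.2) (r₂.boxed N).base T ↔
      BaseFits X (argBoxes N r₂ Z) (r₂.boxed N).base T := by
    refine forall₂_congr fun e he => ?_
    rw [countP_not_hasOcc_arg h₁ h₂ hZ]
    rw [← occurrences_box N r₂.base r₂.ty r₂.cpts r₂.rows r₂.next]
    exact List.mem_map_of_mem he
  have hty : Formula.bang^[(argBoxes N r₂ Z ++ r₂.added X N).length] (r₂.ty.inst X) =
      Formula.bang^[(argBoxes N r₂ Z).length] ((r₂.boxed N).ty.inst X) := by
    rw [List.length_append, Formula.iterate_bang_add, Synth.boxed, inst_box_ty, Synth.added]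
  rw [hty, ← Synth.fits_boxed, Synth.Fits, Synth.Fits, synthApp_eq]
  simp only [rowsHold_append, baseFits_append]
  rw [hb₁, hb₂, rowsHold_head h₁ h₂ hZ, rowsHold_arg h₁ h₂ hZ, rowsHold_appKey h₂ hZ,
    rowsHold_appUnify h₁ h₂ hZ]
  tauto

theorem inRange_synthApp (h₁ : r₁.InRange n) (h₂ : r₂.InRange r₁.next) :
    (synthApp M N r₁ r₂).InRange n := by
  have hle := Synth.le_boxed_next N r₂
  have hk := boxed_next_lt_appKey (N := N) (r₁ := r₁) (r₂ := r₂)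
  have hr₁ := h₁.le
  have hr₂ := h₂.le
  rw [synthApp_eq]
  refine ⟨?_, ?_, ?_, ?_⟩
  · simp only; omega
  · intro e he
    simp only at he ⊢
    rcases List.mem_append.1 he with he | he
    · have := h₁.occ e he; omega
    · have := h₂.boxed_occ N e he; omega
  · intro a ha
    simp only [List.mem_append, List.mem_singleton] at ha ⊢
    rcases ha with ((ha | ha) | ha) | rfl
    · have := h₁.row a ha; omega
    · have := h₂.boxed_row N a ha; omega
    · have := mem_newRows ha
      rw [← appKey] at this
      omega
    · simp only; omega
  · intro sl hsl
    simp only at hsl ⊢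
    obtain ⟨s, t, hs, ht, rfl⟩ := Slice.allowed_productUnion.1 (.inl hsl)
    refine Slice.inRange_append ?_ ?_
    · rcases allowed_headSlices hs with h | ⟨-, rfl⟩
      · exact (h₁.allowed h).mono le_rfl (by omega)
      · refine Slice.inRange_point (by omega) fun o ho => ?_
        obtain ⟨e, he, rfl⟩ := List.mem_map.1 ho
        have := h₁.occ e he; omega
    · rcases allowed_argSlices ht with h | ⟨-, rfl⟩
      · exact (h₂.allowed h).mono hr₁ (by omega)
      · refine Slice.inRange_point (by omega) fun o ho => ?_
        obtain ⟨e, he, rfl⟩ := List.mem_map.1 ho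
        have := h₂.occ e he; omega

end App

end

end EAL

namespace EAL

/-! #### Abstractions -/

section

variable {ι : Type*} {E : ℕ → STy ι} {σ τ : STy ι} {X : ℕ → ℕ}

theorem mem_boundTypes {B : List (Entry (envCons σ E))} {Θ : GTy σ} :
    Θ ∈ boundTypes B ↔ ∃ o, (⟨0, o, Θ⟩ : Entry (envCons σ E)) ∈ B := by
  simp only [boundTypes, List.mem_filterMap]
  constructor
  · rintro ⟨⟨x, o, Θ'⟩, he, h⟩
    cases x with
    | zero => exact ⟨o, by cases h; exact he⟩
    | succ x => cases h
  · rintro ⟨o, h⟩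
    exact ⟨_, h, rfl⟩

theorem mem_boundOccs {B : List (Entry (envCons σ E))} {o : ℕ} :
    o ∈ boundOccs B ↔ ∃ Θ : GTy σ, (⟨0, o, Θ⟩ : Entry (envCons σ E)) ∈ B := by
  simp only [boundOccs, List.mem_filterMap]
  constructor
  · rintro ⟨⟨x, o', Θ⟩, he, h⟩
    cases x with
    | zero => exact ⟨Θ, by cases h; exact he⟩
    | succ x => cases h
  · rintro ⟨Θ, h⟩
    exact ⟨_, h, rfl⟩

theorem mem_unbound {B : List (Entry (envCons σ E))} {x o : ℕ} {Θ : GTy (E x)} :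
    (⟨x, o, Θ⟩ : Entry E) ∈ unbound B ↔ (⟨x + 1, o, Θ⟩ : Entry (envCons σ E)) ∈ B := by
  simp only [unbound, List.mem_filterMap]
  constructor
  · rintro ⟨⟨y, o', Θ'⟩, he, h⟩
    cases y with
    | zero => cases h
    | succ y => cases h; exact he
  · intro h
    exact ⟨_, h, rfl⟩

theorem length_boundTypes (B : List (Entry (envCons σ E))) :
    (boundTypes B).length = (B.map Entry.var).count 0 := by
  induction B with
  | nil => rfl
  | cons e B ih =>
    obtain ⟨x, o, Θ⟩ := e
    cases x with
    | zero =>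
      have h : (boundTypes ((⟨0, o, Θ⟩ : Entry (envCons σ E)) :: B)).length =
        (boundTypes B).length + 1 := rfl
      rw [h, ih]
      simp
    | succ x =>
      have h : boundTypes ((⟨x + 1, o, Θ⟩ : Entry (envCons σ E)) :: B) = boundTypes B := rfl
      rw [h, ih]
      simp

theorem map_var_unbound (B : List (Entry (envCons σ E))) :
    (unbound B).map Entry.var = (B.map Entry.var).filterMap lower := by
  induction B with
  | nil => rfl
  | cons e B ih =>
    obtain ⟨x, o, Θ⟩ := e
    cases x with
    | zero =>
      have h : unbound ((⟨0, o, Θ⟩ : Entry (envCons σ E)) :: B) = unbound B := rfl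
      rw [h, ih, List.map_cons, List.filterMap_cons_none rfl]
    | succ x =>
      have h : unbound ((⟨x + 1, o, Θ⟩ : Entry (envCons σ E)) :: B) = ⟨x, o, Θ⟩ :: unbound B := rfl
      rw [h, List.map_cons, ih, List.map_cons]
      exact (List.filterMap_cons_some (show lower (x + 1) = some x from rfl)).symm

theorem baseFits_scons {W : List Slice} {B : List (Entry (envCons σ E))} {t : Formula ι}
    {T : ℕ → Formula ι} : BaseFits X W B (scons t T) ↔ BaseFits X W (unbound B) T ∧
      ∀ (o : ℕ) (Θ : GTy σ), (⟨0, o, Θ⟩ : Entry (envCons σ E)) ∈ B →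
        Formula.bang^[W.countP fun sl => !sl.hasOcc o] (Θ.inst X) = t := by
  constructor
  · intro h
    refine ⟨fun e he => ?_, fun o Θ he => h _ he⟩
    obtain ⟨x, o, Θ⟩ := e
    exact h _ (mem_unbound.1 he)
  · rintro ⟨h₁, h₂⟩ ⟨x, o, Θ⟩ he
    cases x with
    | zero => exact h₂ o Θ he
    | succ x => exact h₁ _ (mem_unbound.2 he)

theorem countP_filter_of_imp {α : Type*} {l : List α} {p q : α → Bool}
    (h : ∀ a ∈ l, p a = (p a && q a)) : l.countP p = (l.filter q).countP p := by
  rw [List.countP_filter]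
  exact List.countP_congr fun a ha => by rw [← h a ha]

theorem rowsHold_singleton {W : List Slice} {a : Row} :
    RowsHold X W [a] ↔ a.lin.HoldsSub X (W.countP fun sl => sl.hasRow a.id) :=
  List.forall_mem_singleton

section Lam

variable {M : Term} {r : Synth (envCons σ E) τ} {n : ℕ} {W : List Slice} {T : ℕ → Formula ι}

/-- The slices that remain when an occurring variable is abstracted. -/
def keptSlices (M : Term) (r : Synth (envCons σ E) τ) : List Slice :=
  r.cpts.filter fun sl => !(boundOccs (r.boxed M).base).any sl.hasOcc

/-- The processed type of a variable that does not occur. -/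
def dummyType (M : Term) (r : Synth (envCons σ E) τ) : GTy σ × ℕ := process σ (r.boxed M).next

/-- The critical point at the body of an abstraction. -/
def bodySlice (M : Term) (r : Synth (envCons σ E) τ) : Slice :=
  Slice.point ((dummyType M r).2 + 1) (occurrences (r.boxed M).base)

theorem synthLam_of_cons {Θ₁ : GTy σ} {Θs : List (GTy σ)}
    (hb : boundTypes (r.boxed M).base = Θ₁ :: Θs) : synthLam M r =
      ⟨.lolli [] Θ₁ (r.boxed M).ty, unbound (r.boxed M).base,
        (r.boxed M).rows ++ newRows (r.boxed M).next (contraction (Θ₁ :: Θs)),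
        keptSlices M r, (r.boxed M).next + (contraction (Θ₁ :: Θs)).length⟩ := by
  unfold Synth.boxed at hb
  simp only [synthLam, hb]
  rfl

theorem synthLam_of_isApp (hb : boundTypes (r.boxed M).base = []) (hM : M.isApp = true) :
    synthLam M r =
      ⟨.lolli [] (dummyType M r).1 ((r.boxed M).ty.setOuter [(dummyType M r).2]),
        unbound (r.boxed M).base,
        (r.boxed M).rows ++ [⟨(dummyType M r).2 + 1, .eq (r.boxed M).ty.outer [(dummyType M r).2]⟩],
        r.cpts ++ [bodySlice M r], (dummyType M r).2 + 2⟩ := by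
  unfold Synth.boxed at hb
  simp only [synthLam, hb, hM, if_true]
  rfl

theorem synthLam_of_not_isApp (hb : boundTypes (r.boxed M).base = []) (hM : M.isApp = false) :
    synthLam M r =
      ⟨.lolli [] (dummyType M r).1 (r.boxed M).ty, unbound (r.boxed M).base,
        (r.boxed M).rows, r.cpts, (dummyType M r).2⟩ := by
  unfold Synth.boxed at hb
  simp only [synthLam, hb, hM]
  rfl

theorem boxed_next_le_dummyType : (r.boxed M).next ≤ (dummyType M r).2 := le_process_next _ _

theorem allowed_keptSlices {sl : Slice} (h : Slice.Allowed (keptSlices M r) sl) :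
    Slice.Allowed r.cpts sl ∧ ∀ o ∈ boundOccs (r.boxed M).base, sl.hasOcc o = false := by
  rcases h with h | rfl
  · simp only [keptSlices, List.mem_filter, Bool.not_eq_true', List.any_eq_false,
      Bool.not_eq_true] at h
    exact ⟨.inl h.1, h.2⟩
  · exact ⟨.inr rfl, fun o _ => rfl⟩

theorem allowed_append_bodySlice {sl : Slice}
    (h : Slice.Allowed (r.cpts ++ [bodySlice M r]) sl) :
    Slice.Allowed r.cpts sl ∨ sl = bodySlice M r := by
  rcases h with h | h
  · rcases List.mem_append.1 h with h | h
    · exact .inl (.inl h)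
    · exact .inr (List.mem_singleton.1 h)
  · exact .inl (.inr h)

/-- No kept slice contains an occurrence of the abstracted variable, so all boxes in `W` contain all
these occurrences. Unifying their types inside the boxes is therefore the same as unifying them
outside. -/
theorem fits_synthLam_of_cons {Θ₁ : GTy σ} {Θs : List (GTy σ)} (h : r.InRange n)
    (hb : boundTypes (r.boxed M).base = Θ₁ :: Θs)
    (hW : ∀ sl ∈ W, Slice.Allowed (keptSlices M r) sl) :
    (synthLam M r).Fits X W T ↔
      r.Fits X (W ++ r.added X M) (scons (Formula.bang^[W.length] (Θ₁.inst X)) T) ∧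
      (Θs ≠ [] → ∃ A, Θ₁.inst X = .bang A) := by
  have hle := Synth.le_boxed_next M r
  have hnew : RowsHold X W (newRows (r.boxed M).next (contraction (Θ₁ :: Θs))) ↔
      ∀ c ∈ contraction (Θ₁ :: Θs), c.Holds X :=
    rowsHold_newRows fun sl hsl i hi _ =>
      (h.allowed (allowed_keptSlices (hW sl hsl)).1).hasRow_eq_false (.inr (hle.trans hi))
  have hcount : ∀ o ∈ boundOccs (r.boxed M).base,
      W.countP (fun sl => !sl.hasOcc o) = W.length := fun o ho =>
    List.countP_eq_length.2 fun sl hsl => by simp [(allowed_keptSlices (hW sl hsl)).2 o ho]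
  have hbound : (∀ (o : ℕ) (Θ : GTy σ), (⟨0, o, Θ⟩ : Entry (envCons σ E)) ∈ (r.boxed M).base →
      Formula.bang^[W.countP fun sl => !sl.hasOcc o] (Θ.inst X) =
        Formula.bang^[W.length] (Θ₁.inst X)) ↔ ∀ Θ ∈ Θs, Θ.inst X = Θ₁.inst X := by
    constructor
    · intro h Θ hΘ
      obtain ⟨o, ho⟩ := mem_boundTypes.1 (hb ▸ List.mem_cons_of_mem _ hΘ)
      have := h o Θ ho
      rw [hcount o (mem_boundOccs.2 ⟨Θ, ho⟩)] at this
      exact Formula.iterate_bang_left_cancel this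
    · intro h o Θ ho
      rw [hcount o (mem_boundOccs.2 ⟨Θ, ho⟩)]
      have : Θ ∈ boundTypes (r.boxed M).base := mem_boundTypes.2 ⟨o, ho⟩
      rw [hb, List.mem_cons] at this
      rcases this with rfl | this
      · rfl
      · rw [h Θ this]
  rw [← Synth.fits_boxed, baseFits_scons, hbound, Synth.Fits, synthLam_of_cons hb]
  simp only [rowsHold_append]
  rw [hnew, solves_contraction]
  tauto

/-- The formula `t` is arbitrary since no entry of the base belongs to the abstracted variable. -/
theorem fits_synthLam_of_not_isApp (hb : boundTypes (r.boxed M).base = [])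
    (hM : M.isApp = false) (t : Formula ι) :
    (synthLam M r).Fits X W T ↔ r.Fits X (W ++ r.added X M) (scons t T) := by
  have hbound : ∀ (o : ℕ) (Θ : GTy σ), (⟨0, o, Θ⟩ : Entry (envCons σ E)) ∈ (r.boxed M).base →
      Formula.bang^[W.countP fun sl => !sl.hasOcc o] (Θ.inst X) = t := fun o Θ ho => by
    have := mem_boundTypes.2 ⟨o, ho⟩
    rw [hb] at this
    exact absurd this List.not_mem_nil
  rw [← Synth.fits_boxed, baseFits_scons, Synth.Fits, synthLam_of_not_isApp hb hM]
  simp only [and_iff_left hbound]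

/-- The boxes around the body of an abstraction, without those that boxing adds. -/
def bodyBoxes (M : Term) (r : Synth (envCons σ E) τ) (W : List Slice) : List Slice :=
  W.filter fun sl => !sl.hasRow ((dummyType M r).2 + 1)

theorem bodySlices_spec (h : r.InRange n) {sl : Slice}
    (hsl : Slice.Allowed (r.cpts ++ [bodySlice M r]) sl) :
    (∀ i < r.next, sl.hasRow i = (sl.hasRow i && !sl.hasRow ((dummyType M r).2 + 1))) ∧
      ∀ o ∈ occurrences (r.boxed M).base,
        (!sl.hasOcc o) = ((!sl.hasOcc o) && !sl.hasRow ((dummyType M r).2 + 1)) := by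
  have hle := (Synth.le_boxed_next M r).trans boxed_next_le_dummyType
  rcases allowed_append_bodySlice hsl with h' | rfl
  · have := (h.allowed h').hasRow_eq_false (i := (dummyType M r).2 + 1) (.inr (by omega))
    simp [this]
  · refine ⟨fun i hi => ?_, fun o ho => ?_⟩
    · have : ((dummyType M r).2 + 1 == i) = false := by simp; omega
      simp [bodySlice, Slice.hasRow_point, this]
    · rw [bodySlice, Slice.hasOcc_point, List.contains_iff_mem.2 ho]
      simp

theorem bodyBoxes_allowed (hW : ∀ sl ∈ W, Slice.Allowed (r.cpts ++ [bodySlice M r]) sl) :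
    ∀ sl ∈ bodyBoxes M r W, Slice.Allowed r.cpts sl := by
  intro sl hsl
  simp only [bodyBoxes, List.mem_filter] at hsl
  rcases allowed_append_bodySlice (hW sl hsl.1) with h | rfl
  · exact h
  · have := hsl.2
    rw [bodySlice, Slice.hasRow_point] at this
    simp at this

theorem countP_not_hasOcc_body (h : r.InRange n)
    (hW : ∀ sl ∈ W, Slice.Allowed (r.cpts ++ [bodySlice M r]) sl) {o : ℕ}
    (ho : o ∈ occurrences (r.boxed M).base) :
    W.countP (fun sl => !sl.hasOcc o) = (bodyBoxes M r W).countP fun sl => !sl.hasOcc o :=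
  countP_filter_of_imp fun sl hsl => (bodySlices_spec h (hW sl hsl)).2 o ho

/-- As at an application: a box in `W` enters the body or stops at its root, and the equation e - n
= 0 balances the boxes of the second kind against the fresh exponent n. -/
theorem fits_synthLam_of_isApp (h : r.InRange n) (hb : boundTypes (r.boxed M).base = [])
    (hM : M.isApp = true) (hW : ∀ sl ∈ W, Slice.Allowed (r.cpts ++ [bodySlice M r]) sl)
    (t : Formula ι) :
    (synthLam M r).Fits X W T ↔ r.Fits X (bodyBoxes M r W ++ r.added X M) (scons t T) ∧
      Formula.bang^[(bodyBoxes M r W ++ r.added X M).length] (r.ty.inst X) =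
        Formula.bang^[W.length] (((r.boxed M).ty.setOuter [(dummyType M r).2]).inst X) := by
  have hbound : ∀ (o : ℕ) (Θ : GTy σ), (⟨0, o, Θ⟩ : Entry (envCons σ E)) ∈ (r.boxed M).base →
      Formula.bang^[(bodyBoxes M r W).countP fun sl => !sl.hasOcc o] (Θ.inst X) = t :=
    fun o Θ ho => by
      have := mem_boundTypes.2 ⟨o, ho⟩
      rw [hb] at this
      exact absurd this List.not_mem_nil
  have hrows : RowsHold X W (r.boxed M).rows ↔
      RowsHold X (bodyBoxes M r W) (r.boxed M).rows := by
    refine forall₂_congr fun a ha => ?_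
    rw [bodyBoxes, ← countP_filter_of_imp fun sl hsl =>
      (bodySlices_spec h (hW sl hsl)).1 a.id (h.boxed_row M a ha).2]
  have hbase : BaseFits X W (unbound (r.boxed M).base) T ↔
      BaseFits X (bodyBoxes M r W) (unbound (r.boxed M).base) T := by
    refine forall₂_congr fun e he => ?_
    obtain ⟨x, o, Θ⟩ := e
    rw [countP_not_hasOcc_body h hW (List.mem_map.2 ⟨_, mem_unbound.1 he, rfl⟩)]
  have hlen := length_filter_not_add_countP W
    fun sl => Slice.hasRow sl ((dummyType M r).2 + 1)
  rw [← bodyBoxes] at hlen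
  have hty : Formula.bang^[(bodyBoxes M r W ++ r.added X M).length] (r.ty.inst X) =
      Formula.bang^[(bodyBoxes M r W).length] ((r.boxed M).ty.inst X) := by
    rw [List.length_append, Formula.iterate_bang_add, Synth.boxed, inst_box_ty, Synth.added]
  rw [hty, ← Synth.fits_boxed, baseFits_scons, Synth.Fits, synthLam_of_isApp hb hM,
    GTy.iterate_bang_inst_eq_iff]
  simp only [rowsHold_append, and_iff_left hbound, GTy.core_setOuter, GTy.outer_setOuter, and_true]
  rw [hrows, hbase, rowsHold_singleton, Constraint.HoldsSub]
  simp only [List.map_cons, List.map_nil, List.sum_cons, List.sum_nil, Nat.add_zero]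
  rw [and_right_comm]
  refine and_congr_right fun _ => ?_
  omega

theorem inRange_synthLam (h : r.InRange n) : (synthLam M r).InRange n := by
  have hle := Synth.le_boxed_next M r
  have hle' := boxed_next_le_dummyType (M := M) (r := r)
  have hn := h.le
  have hocc : ∀ e ∈ unbound (r.boxed M).base, n ≤ e.occ ∧ e.occ < r.next := by
    rintro ⟨x, o, Θ⟩ he
    exact h.boxed_occ M _ (mem_unbound.1 he)
  have hrow := h.boxed_row M
  cases hb : boundTypes (r.boxed M).base with
  | cons Θ₁ Θs =>
    rw [synthLam_of_cons hb]
    refine ⟨?_, ?_, ?_, ?_⟩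
    · simp only; omega
    · intro e he
      have := hocc e he
      simp only; omega
    · intro a ha
      simp only [List.mem_append] at ha ⊢
      rcases ha with ha | ha
      · have := hrow a ha; omega
      · have := mem_newRows ha; omega
    · intro sl hsl
      simp only at hsl ⊢
      exact (h.slice sl (List.mem_filter.1 hsl).1).mono le_rfl (by omega)
  | nil =>
    cases hM : M.isApp with
    | true =>
      rw [synthLam_of_isApp hb hM]
      refine ⟨?_, ?_, ?_, ?_⟩
      · simp only; omega
      · intro e he
        have := hocc e he
        simp only; omega
      · intro a ha
        simp only [List.mem_append, List.mem_singleton] at ha ⊢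
        rcases ha with ha | rfl
        · have := hrow a ha; omega
        · simp only; omega
      · intro sl hsl
        simp only at hsl ⊢
        rcases allowed_append_bodySlice (.inl hsl) with h' | rfl
        · exact (h.allowed h').mono le_rfl (by omega)
        · refine Slice.inRange_point (by omega) fun o ho => ?_
          obtain ⟨e, he, rfl⟩ := List.mem_map.1 ho
          have := h.boxed_occ M e he; omega
    | false =>
      rw [synthLam_of_not_isApp hb hM]
      refine ⟨?_, ?_, ?_, ?_⟩
      · simp only; omega
      · intro e he
        have := hocc e he
        simp only; omega
      · intro a ha
        have := hrow a ha
        simp only; omega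
      · intro sl hsl
        exact (h.slice sl hsl).mono le_rfl (by simp only; omega)

theorem base_synthLam : (synthLam M r).base = unbound (r.boxed M).base := by
  cases hb : boundTypes (r.boxed M).base with
  | cons Θ₁ Θs => rw [synthLam_of_cons hb]
  | nil =>
    cases hM : M.isApp with
    | true => rw [synthLam_of_isApp hb hM]
    | false => rw [synthLam_of_not_isApp hb hM]

end Lam

/-! #### All terms -/

theorem inRange_synth {M : Term} (d : SDer E M σ) (n : ℕ) : (synth d n).InRange n := by
  induction d generalizing n with
  | var E x =>
    have := le_process_next (E x) n
    refine ⟨?_, ?_, ?_, ?_⟩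
    · simp only [synth, synthVar]; omega
    · intro e he
      obtain rfl := List.mem_singleton.1 he
      simp only [synth, synthVar]; omega
    · intro a ha
      exact absurd ha List.not_mem_nil
    · intro sl hsl
      exact absurd hsl List.not_mem_nil
  | lam d ih => exact inRange_synthLam (ih n)
  | app d₁ d₂ ih₁ ih₂ => exact inRange_synthApp (ih₁ n) (ih₂ _)

theorem map_var_base_synth {M : Term} (d : SDer E M σ) (n : ℕ) :
    (synth d n).base.map Entry.var = M.fvs := by
  induction d generalizing n with
  | var E x => rfl
  | @lam E M σ τ d ih =>
    rw [synth, base_synthLam, map_var_unbound, Synth.boxed, box_base_map_var, ih]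
    rfl
  | @app E M N σ τ d₁ d₂ ih₁ ih₂ =>
    rw [synth, synthApp_eq]
    simp only [List.map_append]
    rw [Synth.boxed, box_base_map_var, ih₁, ih₂]
    rfl

end

end EAL

namespace EAL

section

variable {ι : Type*} {E : ℕ → STy ι} {σ τ : STy ι} {X : ℕ → ℕ}

/-! ### From solutions of the constraints to leveled typings -/

theorem allowed_of_mem_addedBoxes {M : Term} {cpts : List Slice} {n : ℕ} {sl : Slice}
    (h : sl ∈ addedBoxes X M cpts n) : Slice.Allowed cpts sl := by
  have key : ∀ (cpts : List Slice) (n : ℕ), sl ∈ sliceBoxes X cpts n → sl ∈ cpts := by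
    intro cpts
    induction cpts with
    | nil => intro n h; exact h
    | cons s cpts ih =>
      intro n h
      rcases List.mem_append.1 h with h | h
      · exact List.mem_cons.2 (.inl (List.eq_of_mem_replicate h))
      · exact List.mem_cons_of_mem _ (ih _ h)
  rw [addedBoxes] at h
  split_ifs at h
  · exact absurd h List.not_mem_nil
  · rcases List.mem_append.1 h with h | h
    · exact .inl (key _ _ h)
    · exact .inr (List.eq_of_mem_replicate h)

theorem Synth.inst_boxed_ty (M : Term) (r : Synth E σ) :
    (r.boxed M).ty.inst X = Formula.bang^[(r.added X M).length] (r.ty.inst X) := inst_box_ty ..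

theorem Synth.forall_mem_boxed_base {M : Term} {r : Synth E σ} {p : ℕ → ℕ → Prop} :
    (∀ e ∈ (r.boxed M).base, p e.var e.occ) ↔ ∀ e ∈ r.base, p e.var e.occ :=
  forall_mem_box_base ..

theorem length_boundTypes_boxed {M : Term} {r : Synth (envCons σ E) τ}
    (hfv : r.base.map Entry.var = M.fvs) :
    (boundTypes (r.boxed M).base).length = M.fvs.count 0 := by
  rw [length_boundTypes, Synth.boxed, box_base_map_var, hfv]

/-- The level of a node is the number of boxes around it. By `hℓ`, at least as many of these boxes
contain an occurrence of a variable as there are boxes around its binder; this gives the level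
condition at the root and passes on to subterms. -/
theorem leveled_of_fits {M : Term} (der : SDer E M σ) (n : ℕ) (W : List Slice)
    (hW : ∀ sl ∈ W, Slice.Allowed (synth der n).cpts sl) (T : ℕ → Formula ι) (ℓ : ℕ → ℕ)
    (hℓ : ∀ e ∈ (synth der n).base, ℓ e.var ≤ W.countP fun sl => !sl.hasOcc e.occ)
    (hF : (synth der n).Fits X W T) :
    Leveled ℓ T W.length M (Formula.bang^[W.length] ((synth der n).ty.inst X)) := by
  induction der generalizing n W T ℓ with
  | var E x =>
    have hlen : W.countP (fun sl => !sl.hasOcc (process (E x) n).2) = W.length :=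
      List.countP_eq_length.2 fun sl hsl => by
        obtain rfl := (hW sl hsl).resolve_left List.not_mem_nil
        rfl
    have := hF.2 _ (List.mem_singleton_self _)
    simp only [hlen] at this
    exact Leveled.var_of_eq this
  | @lam E M σ τ der ih =>
    have hr := inRange_synth der n
    have hfv := map_var_base_synth der n
    have hfvl := map_var_base_synth (.lam der) n
    simp only [synth] at hW hℓ hF hfvl ⊢
    set r := synth der n with hrdef
    have hlev : ∀ x ∈ (Term.lam M).fvs, ℓ x ≤ W.length := by
      rw [← hfvl]
      intro x hx
      obtain ⟨e, he, rfl⟩ := List.mem_map.1 hx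
      exact (hℓ e he).trans List.countP_le_length
    have hadd : ∀ {W' : List Slice}, (∀ sl ∈ W', Slice.Allowed r.cpts sl) →
        ∀ sl ∈ W' ++ r.added X M, Slice.Allowed r.cpts sl := fun h sl hsl =>
      (List.mem_append.1 hsl).elim (h sl) allowed_of_mem_addedBoxes
    -- The inequality for the body: `t` is the level of the new binder, and boxing can only increase
    -- the counts.
    have hocc : ∀ {W' : List Slice} {t : ℕ},
        (∀ (o : ℕ) (Θ : GTy σ), (⟨0, o, Θ⟩ : Entry (envCons σ E)) ∈ (r.boxed M).base →
          t ≤ W'.countP fun sl => !sl.hasOcc o) →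
        (∀ e ∈ unbound (r.boxed M).base, ℓ e.var ≤ W'.countP fun sl => !sl.hasOcc e.occ) →
        ∀ e ∈ r.base, scons t ℓ e.var ≤
          (W' ++ r.added X M).countP fun sl => !sl.hasOcc e.occ := by
      intro W' t h₁ h₂
      refine (Synth.forall_mem_boxed_base (M := M)
        (p := fun x o => scons t ℓ x ≤ (W' ++ r.added X M).countP fun sl => !sl.hasOcc o)).1 ?_
      rintro ⟨x, o, Θ⟩ he
      rw [List.countP_append]
      cases x with
      | zero => exact (h₁ o Θ he).trans (Nat.le_add_right _ _)
      | succ x => exact (h₂ _ (mem_unbound.2 he)).trans (Nat.le_add_right _ _)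
    rw [base_synthLam] at hℓ
    cases hb : boundTypes (r.boxed M).base with
    | cons Θ₁ Θs =>
      rw [synthLam_of_cons hb] at hW ⊢
      simp only at hW
      rw [fits_synthLam_of_cons hr hb hW] at hF
      have key := ih n (W ++ r.added X M) (hadd fun sl hsl => (allowed_keptSlices (hW sl hsl)).1)
        _ (scons W.length ℓ) (hocc (fun o Θ ho => ?_) hℓ) hF.1
      · refine Leveled.lam hlev (fun h2 => hF.2 ?_) (B := (r.boxed M).ty.inst X)
          (d' := (W ++ r.added X M).length) ?_
        · rintro rfl
          rw [← length_boundTypes_boxed hfv, hb] at h2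
          simp at h2
        · rw [Synth.inst_boxed_ty, ← Formula.iterate_bang_add, ← List.length_append]
          exact key
      · refine ge_of_eq (List.countP_eq_length.2 fun sl hsl => ?_)
        simp [(allowed_keptSlices (hW sl hsl)).2 o (mem_boundOccs.2 ⟨Θ, ho⟩)]
    | nil =>
      have hnone : ∀ (o : ℕ) (Θ : GTy σ),
          (⟨0, o, Θ⟩ : Entry (envCons σ E)) ∉ (r.boxed M).base := fun o Θ ho => by
        have := mem_boundTypes.2 ⟨o, ho⟩
        rw [hb] at this
        exact List.not_mem_nil this
      have hcount : ¬ 2 ≤ M.fvs.count 0 := by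
        rw [← length_boundTypes_boxed hfv, hb]; simp
      cases hM : M.isApp with
      | true =>
        rw [synthLam_of_isApp hb hM] at hW ⊢
        simp only at hW
        rw [fits_synthLam_of_isApp hr hb hM hW
          (Formula.bang^[W.length] ((dummyType M r).1.inst X))] at hF
        have key := ih n _ (hadd (bodyBoxes_allowed hW)) _ (scons W.length ℓ)
          (hocc (fun o Θ ho => absurd ho (hnone o Θ)) fun e he => ?_) hF.1
        · refine Leveled.lam hlev (fun h2 => absurd h2 hcount) (A := (dummyType M r).1.inst X)
            (B := ((r.boxed M).ty.setOuter [(dummyType M r).2]).inst X)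
            (d' := (bodyBoxes M r W ++ r.added X M).length) ?_
          rw [← hF.2]
          exact key
        · obtain ⟨x, o, Θ⟩ := e
          rw [← countP_not_hasOcc_body hr hW (List.mem_map.2 ⟨_, mem_unbound.1 he, rfl⟩)]
          exact hℓ _ he
      | false =>
        rw [synthLam_of_not_isApp hb hM] at hW ⊢
        simp only at hW
        rw [fits_synthLam_of_not_isApp hb hM
          (Formula.bang^[W.length] ((dummyType M r).1.inst X))] at hF
        have key := ih n _ (hadd hW) _ (scons W.length ℓ)
          (hocc (fun o Θ ho => absurd ho (hnone o Θ)) hℓ) hF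
        refine Leveled.lam hlev (fun h2 => absurd h2 hcount) (A := (dummyType M r).1.inst X)
          (B := (r.boxed M).ty.inst X) ?_ (d' := (W ++ r.added X M).length)
        rw [Synth.inst_boxed_ty, ← Formula.iterate_bang_add, ← List.length_append]
        exact key
  | @app E M N σ τ d₁ d₂ ih₁ ih₂ =>
    have h₁ := inRange_synth d₁ n
    have h₂ := inRange_synth d₂ (synth d₁ n).next
    have hfv := map_var_base_synth (.app d₁ d₂) n
    simp only [synth] at hW hℓ hF hfv ⊢
    have ih₁ := ih₁ n
    have ih₂ := ih₂ (synth d₁ n).next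
    generalize synth d₁ n = r₁ at *
    generalize synth d₂ r₁.next = r₂ at *
    have hlev : ∀ x ∈ (Term.app M N).fvs, ℓ x ≤ W.length := by
      rw [← hfv]
      intro x hx
      obtain ⟨e, he, rfl⟩ := List.mem_map.1 hx
      exact (hℓ e he).trans List.countP_le_length
    -- Every box around the application splits into its traces on the head and on the argument.
    have hZ : ∃ Z, SlicePairs M N r₁ r₂ Z ∧ W = Z.map fun z => z.1 ++ z.2 := by
      clear hℓ hF hlev
      induction W with
      | nil => exact ⟨[], fun z hz => absurd hz List.not_mem_nil, rfl⟩
      | cons sl W ih =>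
        obtain ⟨Z, hZ, rfl⟩ := ih fun sl hsl => hW sl (List.mem_cons_of_mem _ hsl)
        obtain ⟨s, t, hs, ht, rfl⟩ :=
          Slice.allowed_productUnion.1 (hW _ (List.mem_cons_self ..))
        exact ⟨(s, t) :: Z, List.forall_mem_cons.2 ⟨⟨hs, ht⟩, hZ⟩, rfl⟩
    obtain ⟨Z, hZ, rfl⟩ := hZ
    rw [fits_synthApp h₁ h₂ hZ] at hF
    obtain ⟨⟨hF₁, hF₂⟩, hty₁, hty₂⟩ := hF
    rw [synthApp_eq] at hℓ ⊢
    simp only [List.mem_append, or_imp, forall_and] at hℓ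
    have k₁ := ih₁ _ hZ.headBoxes_allowed T ℓ (fun e he => by
      rw [← countP_not_hasOcc_head h₁ h₂ hZ (List.mem_map_of_mem he)]
      exact hℓ.1 e he) hF₁
    have k₂ := ih₂ (argBoxes N r₂ Z ++ r₂.added X N) (fun sl hsl =>
      (List.mem_append.1 hsl).elim (hZ.argBoxes_allowed sl) allowed_of_mem_addedBoxes) T ℓ
      (fun e he => by
        have := (Synth.forall_mem_boxed_base (p := fun x o => ℓ x ≤
          (Z.map fun z => z.1 ++ z.2).countP fun sl => !sl.hasOcc o)).1 hℓ.2 e he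
        rw [countP_not_hasOcc_arg h₁ h₂ hZ (List.mem_map_of_mem he)] at this
        rw [List.countP_append]
        exact this.trans (Nat.le_add_right _ _)) hF₂
    rw [hty₁] at k₁
    rw [hty₂] at k₂
    rw [List.length_map] at hlev ⊢
    exact .app hlev k₁ k₂

end

end EAL

namespace EAL

section

variable {ι : Type*} {E : ℕ → STy ι} {σ τ : STy ι}

/-! ### From leveled typings to solutions of the constraints -/

/-- This bounds levels in both directions: an abstraction whose type starts with p signs ! has level
at least p, and a head has at most the level of its application. -/
theorem Formula.le_of_iterate_bang_eq {A B : Formula ι} {m n : ℕ} (hA : A.IsCore)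
    (h : bang^[m] A = bang^[n] B) : n ≤ m := by
  obtain ⟨k, B₀, rfl, hB⟩ := B.exists_eq_iterate_bang
  rw [← iterate_bang_add] at h
  have := (iterate_bang_inj hA hB h).1
  omega

/-- The boxes `W` around `M`, from the outermost one to the innermost one, and the values of `X`
below `r.next` give the variables the types `T` and the term the type `C` outside the boxes. -/
structure Synth.RealizedBy (M : Term) (r : Synth E σ) (ℓ : ℕ → ℕ) (T : ℕ → Formula ι)
    (C : Formula ι) (X : ℕ → ℕ) (W : List Slice) : Prop where
  allowed : ∀ sl ∈ W, Slice.Allowed r.cpts sl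
  level : ∀ x ∈ M.fvs, ℓ x ≤ W.length
  take : ∀ e ∈ r.base, ∀ sl ∈ W.take (ℓ e.var), sl.hasOcc e.occ = false
  fits : ∀ X' : ℕ → ℕ, (∀ i < r.next, X' i = X i) →
    r.Fits X' W T ∧ Formula.bang^[W.length] (r.ty.inst X') = C

theorem Synth.RealizedBy.take_boxed {M : Term} {r : Synth E σ} {ℓ : ℕ → ℕ} {T : ℕ → Formula ι}
    {C : Formula ι} {X : ℕ → ℕ} {W : List Slice} (h : r.RealizedBy M ℓ T C X W) :
    ∀ e ∈ (r.boxed M).base, ∀ sl ∈ W.take (ℓ e.var), sl.hasOcc e.occ = false :=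
  (Synth.forall_mem_boxed_base
    (p := fun x o => ∀ sl ∈ W.take (ℓ x), Slice.hasOcc sl o = false)).2 h.take

/-- The inner boxes around `M` can be left to boxing. -/
theorem Synth.RealizedBy.exists_boxed {M : Term} {r : Synth E σ} {ℓ : ℕ → ℕ} {T : ℕ → Formula ι}
    {C : Formula ι} {X : ℕ → ℕ} {W : List Slice} (h : r.RealizedBy M ℓ T C X W) (d : ℕ)
    (hd : M.isVar = true → W.length = d) :
    ∃ X₁ : ℕ → ℕ, (∀ i < r.next, X₁ i = X i) ∧
      ∀ X' : ℕ → ℕ, (∀ i < (r.boxed M).next, X' i = X₁ i) →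
        r.Fits X' (W.take d ++ r.added X' M) T ∧
        Formula.bang^[(W.take d ++ r.added X' M).length] (r.ty.inst X') = C := by
  obtain ⟨X₁, h₁, h₂⟩ := exists_addedBoxes_perm M r.cpts r.next X (W.drop d)
    (fun sl hsl => h.allowed sl (List.mem_of_mem_drop hsl))
    (fun hv => by rw [← hd hv, List.drop_length]) r.base r.ty r.rows
  refine ⟨X₁, h₁, fun X' hX' => ?_⟩
  have hp : (W.take d ++ r.added X' M).Perm W :=
    (List.Perm.append_left _ (h₂ X' hX')).trans (by rw [List.take_append_drop])
  have hle := Synth.le_boxed_next M r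
  obtain ⟨hf, hty⟩ := h.fits X' fun i hi => by rw [hX' i (by omega), h₁ i hi]
  refine ⟨hf.perm hp.symm, ?_⟩
  rw [hp.length_eq, hty]

theorem filter_take_append_replicate {p : Slice → Bool} {W : List Slice} {d k : ℕ} {c : Slice}
    (hW : ∀ sl ∈ W, p sl = true) (hc : p c = false) :
    (W.take d ++ List.replicate k c).filter p = W.take d := by
  rw [List.filter_append, List.filter_replicate, hc,
    List.filter_eq_self.2 fun sl hsl => hW sl (List.mem_of_mem_take hsl)]
  simp

/-- The boxes of a child are brought to the number `d` of boxes of its parent: surplus inner boxes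
are cut off, and missing ones are replaced by boxes `c` that stop at the child. -/
theorem length_take_append_replicate {W : List Slice} {d : ℕ} {c : Slice} :
    (W.take d ++ List.replicate (d - W.length) c).length = d := by
  rw [List.length_append, List.length_take, List.length_replicate]
  omega

/-- Applied to the first `j` boxes, those around the binder of a variable: they are neither cut off
nor part of the padding. -/
theorem take_take_append {W V : List Slice} {d j : ℕ} (hj : j ≤ d) (hj' : j ≤ W.length) :
    (W.take d ++ V).take j = W.take j := by
  rw [List.take_append_of_le_length (by rw [List.length_take]; omega), List.take_take,
    Nat.min_eq_left hj]

/-- The outer `d` boxes of the body surround the abstraction as well, and the rest is left to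
boxing. A body with fewer than `d` boxes is an application that does not use the abstracted
variable, and this is the case in which synthesis offers a critical point at the body. -/
theorem Synth.RealizedBy.lam {M : Term} {r : Synth (envCons σ E) τ} {ℓ : ℕ → ℕ}
    {T : ℕ → Formula ι} {A B : Formula ι} {X : ℕ → ℕ} {W : List Slice} {n d : ℕ}
    (hr : r.InRange n) (hfv : r.base.map Entry.var = M.fvs)
    (h : r.RealizedBy M (scons d ℓ) (scons (Formula.bang^[d] A) T) (Formula.bang^[d] B) X W)
    (hApp : M.isApp = false → d ≤ W.length) (hVar : M.isVar = true → W.length = d)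
    (hℓ : ∀ x ∈ (Term.lam M).fvs, ℓ x ≤ d) (hc : 2 ≤ M.fvs.count 0 → ∃ A', A = .bang A')
    (hA : A.erase = σ) :
    ∃ (X₁ : ℕ → ℕ) (W₁ : List Slice), (∀ i < r.next, X₁ i = X i) ∧ W₁.length = d ∧
      (synthLam M r).RealizedBy (.lam M) ℓ T (Formula.bang^[d] (.lolli A B)) X₁ W₁ := by
  obtain ⟨X₁, hX₁, hbox⟩ := h.exists_boxed d hVar
  have hle := Synth.le_boxed_next M r
  have hle' := boxed_next_le_dummyType (M := M) (r := r)
  have htake : ∀ e ∈ unbound (r.boxed M).base, ∀ (V : List Slice),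
      ∀ sl ∈ (W.take d ++ V).take (ℓ e.var), sl.hasOcc e.occ = false := by
    rintro ⟨x, o, Θ⟩ he V sl hsl
    have he := mem_unbound.1 he
    have hx : x + 1 ∈ M.fvs := by
      rw [← hfv, ← box_base_map_var M r.base r.ty r.cpts r.rows r.next]
      exact List.mem_map_of_mem (f := Entry.var) he
    rw [take_take_append (hℓ x (mem_filterMap_lower.2 hx)) (h.level (x + 1) hx)] at hsl
    exact h.take_boxed _ he sl hsl
  have hty : ∀ X', (∀ i < (r.boxed M).next, X' i = X₁ i) →
      Formula.bang^[(W.take d).length] ((r.boxed M).ty.inst X') = Formula.bang^[d] B := by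
    intro X' hX'
    rw [Synth.inst_boxed_ty, ← Formula.iterate_bang_add, ← List.length_append]
    exact (hbox X' hX').2
  cases hb : boundTypes (r.boxed M).base with
  | cons Θ₁ Θs =>
    have h0 : 0 ∈ M.fvs := by
      rw [← List.count_pos_iff, ← length_boundTypes_boxed hfv, hb]
      simp
    -- The body contains a variable bound at level `d`, so it has at least `d` boxes.
    have hdW : d ≤ W.length := h.level 0 h0
    have hlen : (W.take d).length = d := by rw [List.length_take]; omega
    have hocc : ∀ o ∈ boundOccs (r.boxed M).base, ∀ sl ∈ W.take d, sl.hasOcc o = false := by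
      intro o ho
      obtain ⟨Θ, ho⟩ := mem_boundOccs.1 ho
      exact h.take_boxed _ ho
    have hkept : ∀ sl ∈ W.take d, Slice.Allowed (keptSlices M r) sl := by
      intro sl hsl
      refine (h.allowed sl (List.mem_of_mem_take hsl)).imp_left fun h' => ?_
      simp only [keptSlices, List.mem_filter, Bool.not_eq_true', List.any_eq_false,
        Bool.not_eq_true]
      exact ⟨h', fun o ho => hocc o ho sl hsl⟩
    refine ⟨X₁, W.take d, hX₁, hlen, ?_, ?_, ?_, ?_⟩
    · rw [synthLam_of_cons hb]; exact hkept
    · rw [hlen]; exact hℓ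
    · rw [base_synthLam]
      intro e he
      simpa using htake e he []
    · intro X' hX'
      replace hX' : ∀ i < (r.boxed M).next, X' i = X₁ i := fun i hi => hX' i (by
        rw [synthLam_of_cons hb]; simp only; omega)
      have hf := (hbox X' hX').1
      have hΘ : Θ₁.inst X' = A := by
        obtain ⟨o, ho⟩ := mem_boundTypes.1 (hb ▸ List.mem_cons_self (a := Θ₁) (l := Θs))
        have := (baseFits_scons.1 (Synth.fits_boxed.2 hf).2).2 o Θ₁ ho
        rw [List.countP_eq_length.2 fun sl hsl => by
          simp [hocc o (mem_boundOccs.2 ⟨Θ₁, ho⟩) sl hsl], hlen] at this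
        exact Formula.iterate_bang_left_cancel this
      have hty := hty X' hX'
      rw [hlen] at hty ⊢
      rw [fits_synthLam_of_cons hr hb hkept, hΘ, hlen]
      refine ⟨⟨hf, fun hΘs => hc ?_⟩, ?_⟩
      · rw [← length_boundTypes_boxed hfv, hb, List.length_cons]
        have := List.length_pos_iff.2 hΘs
        omega
      · rw [synthLam_of_cons hb]
        simp only [GTy.inst, List.map_nil, List.sum_nil, Function.iterate_zero_apply, hΘ]
        rw [Formula.iterate_bang_left_cancel hty]
  | nil =>
    obtain ⟨X₂, hX₂, hproc⟩ := exists_inst_process σ A hA (r.boxed M).next X₁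
    cases hM : M.isApp with
    | true =>
      -- The fresh exponent n takes the value `m`, the number of leading ! in the type of the body
      -- as seen at the abstraction.
      obtain ⟨m, B₀, rfl, hB₀⟩ := B.exists_eq_iterate_bang
      have hbody : ∀ sl ∈ W.take d ++ List.replicate (d - W.length) (bodySlice M r),
          Slice.Allowed (r.cpts ++ [bodySlice M r]) sl := by
        intro sl hsl
        rcases List.mem_append.1 hsl with hsl | hsl
        · exact (h.allowed sl (List.mem_of_mem_take hsl)).imp_left (List.mem_append_left _)
        · rw [List.eq_of_mem_replicate hsl]
          exact .inl (List.mem_append_right _ (List.mem_singleton_self _))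
      have hbb : bodyBoxes M r (W.take d ++ List.replicate (d - W.length) (bodySlice M r)) =
          W.take d := by
        refine filter_take_append_replicate (fun sl hsl => ?_) ?_
        · rw [(hr.allowed (h.allowed sl hsl)).hasRow_eq_false (.inr (by omega))]; rfl
        · simp [bodySlice, Slice.hasRow_point]
      refine ⟨Function.update X₂ (dummyType M r).2 m,
        W.take d ++ List.replicate (d - W.length) (bodySlice M r), fun i hi => ?_,
        length_take_append_replicate, ?_, ?_, ?_, ?_⟩
      · rw [Function.update_of_ne (by omega), hX₂ i (by omega), hX₁ i hi]
      · rw [synthLam_of_isApp hb hM]; exact hbody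
      · rw [length_take_append_replicate]; exact hℓ
      · rw [base_synthLam]
        exact fun e he => htake e he _
      · intro X' hX'
        rw [synthLam_of_isApp hb hM] at hX'
        simp only at hX'
        have hm : X' (dummyType M r).2 = m := by
          rw [hX' _ (by omega), Function.update_self]
        have hX₂' : ∀ i < (dummyType M r).2, X' i = X₂ i := fun i hi => by
          rw [hX' i (by omega), Function.update_of_ne (by omega)]
        have hX₁' : ∀ i < (r.boxed M).next, X' i = X₁ i := fun i hi => by
          rw [hX₂' i (by omega), hX₂ i hi]
        have hΘ : (dummyType M r).1.inst X' = A := hproc X' hX₂'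
        have hcore : (r.boxed M).ty.core X' = B₀ := by
          have := hty X' hX₁'
          rw [GTy.inst_eq, ← Formula.iterate_bang_add, ← Formula.iterate_bang_add] at this
          exact (Formula.iterate_bang_inj (GTy.isCore_core _) hB₀ this).2
        have hout : ((r.boxed M).ty.setOuter [(dummyType M r).2]).inst X' =
            Formula.bang^[m] B₀ := by
          rw [GTy.inst_eq, GTy.core_setOuter, GTy.outer_setOuter, hcore]
          simp [hm]
        rw [fits_synthLam_of_isApp hr hb hM hbody (Formula.bang^[d] A), hbb, hout,
          length_take_append_replicate]
        refine ⟨hbox X' hX₁', ?_⟩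
        rw [synthLam_of_isApp hb hM]
        simp only [GTy.inst, List.map_nil, List.sum_nil, Function.iterate_zero_apply, hΘ, hout]
    | false =>
      have hdW := hApp hM
      have hlen : (W.take d).length = d := by rw [List.length_take]; omega
      refine ⟨X₂, W.take d, fun i hi => ?_, hlen, ?_, ?_, ?_, ?_⟩
      · rw [hX₂ i (by omega), hX₁ i hi]
      · rw [synthLam_of_not_isApp hb hM]
        exact fun sl hsl => h.allowed sl (List.mem_of_mem_take hsl)
      · rw [hlen]; exact hℓ
      · rw [base_synthLam]
        intro e he
        simpa using htake e he []
      · intro X' hX'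
        rw [synthLam_of_not_isApp hb hM] at hX'
        simp only at hX'
        have hX₁' : ∀ i < (r.boxed M).next, X' i = X₁ i := fun i hi => by
          rw [hX' i (by omega), hX₂ i hi]
        have hΘ : (dummyType M r).1.inst X' = A := hproc X' hX'
        have hty := hty X' hX₁'
        rw [hlen] at hty ⊢
        rw [fits_synthLam_of_not_isApp hb hM (Formula.bang^[d] A)]
        refine ⟨(hbox X' hX₁').1, ?_⟩
        rw [synthLam_of_not_isApp hb hM]
        simp only [GTy.inst, List.map_nil, List.sum_nil, Function.iterate_zero_apply, hΘ]
        rw [Formula.iterate_bang_left_cancel hty]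

/-- The boxes of head and argument, brought to length `d`, are paired position by position from the
outermost one on, so the boxes around a binder keep their places. Only applications need padding.
The head never has surplus boxes, which is why only the argument is boxed. -/
theorem Synth.RealizedBy.app {M N : Term} {r₁ : Synth E (.arr σ τ)} {r₂ : Synth E σ} {ℓ : ℕ → ℕ}
    {T : ℕ → Formula ι} {A B : Formula ι} {X₁ X₂ : ℕ → ℕ} {W₁ W₂ : List Slice} {n d : ℕ}
    (hr₁ : r₁.InRange n) (hr₂ : r₂.InRange r₁.next)
    (hfv₁ : r₁.base.map Entry.var = M.fvs) (hfv₂ : r₂.base.map Entry.var = N.fvs)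
    (h₁ : r₁.RealizedBy M ℓ T (Formula.bang^[d] (.lolli A B)) X₁ W₁)
    (h₂ : r₂.RealizedBy N ℓ T (Formula.bang^[d] A) X₂ W₂)
    (hX : ∀ i < r₁.next, X₂ i = X₁ i)
    (hApp₁ : M.isApp = false → d ≤ W₁.length) (hApp₂ : N.isApp = false → d ≤ W₂.length)
    (hVar : N.isVar = true → W₂.length = d) (hℓ : ∀ x ∈ (Term.app M N).fvs, ℓ x ≤ d) :
    ∃ (X : ℕ → ℕ) (W : List Slice), (∀ i < r₁.next, X i = X₁ i) ∧ W.length = d ∧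
      (synthApp M N r₁ r₂).RealizedBy (.app M N) ℓ T (Formula.bang^[d] B) X W := by
  obtain ⟨X₃, hX₃, hbox⟩ := h₂.exists_boxed d hVar
  have hle := Synth.le_boxed_next N r₂
  have hle' := hr₂.le
  have hk := boxed_next_lt_appKey (N := N) (r₁ := r₁) (r₂ := r₂)
  -- From outside, the type of the head starts with exactly `d` signs !, and each of its boxes
  -- accounts for one.
  have hW₁d : W₁.length ≤ d :=
    Formula.le_of_iterate_bang_eq (show (Formula.lolli A B).IsCore from trivial)
      (h₁.fits X₁ fun _ _ => rfl).2.symm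
  let c₁ := Slice.point (appKey N r₁ r₂) (occurrences r₁.base)
  let c₂ := Slice.point (r₂.boxed N).next (occurrences r₂.base)
  let V₁ := W₁.take d ++ List.replicate (d - W₁.length) c₁
  let V₂ := W₂.take d ++ List.replicate (d - W₂.length) c₂
  have hV₁ : V₁.length = d := length_take_append_replicate
  have hV₂ : V₂.length = d := length_take_append_replicate
  let Z := V₁.zip V₂
  have hZ₁ : Z.map Prod.fst = V₁ := List.map_fst_zip (by omega)
  have hZ₂ : Z.map Prod.snd = V₂ := List.map_snd_zip (by omega)
  have hZlen : Z.length = d := by rw [List.length_zip]; omega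
  have hV₁a : ∀ sl ∈ V₁, Slice.Allowed (headSlices M N r₁ r₂) sl := by
    intro sl hsl
    rw [headSlices]
    rcases List.mem_append.1 hsl with hsl | hsl
    · have := h₁.allowed sl (List.mem_of_mem_take hsl)
      split_ifs
      · exact this.imp_left (List.mem_append_left _)
      · exact this
    · have hlt : 0 < d - W₁.length := by
        rw [List.mem_replicate] at hsl; omega
      have hM : M.isApp = true := by
        by_contra hM
        have := hApp₁ (by simpa using hM)
        omega
      rw [List.eq_of_mem_replicate hsl, if_pos hM]
      exact .inl (List.mem_append_right _ (List.mem_singleton_self _))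
  have hV₂a : ∀ sl ∈ V₂, Slice.Allowed (argSlices N r₂) sl := by
    intro sl hsl
    rw [argSlices]
    rcases List.mem_append.1 hsl with hsl | hsl
    · have := h₂.allowed sl (List.mem_of_mem_take hsl)
      split_ifs
      · exact this.imp_left (List.mem_append_left _)
      · exact this
    · have hlt : 0 < d - W₂.length := by
        rw [List.mem_replicate] at hsl; omega
      have hN : N.isApp = true := by
        by_contra hN
        have := hApp₂ (by simpa using hN)
        omega
      rw [List.eq_of_mem_replicate hsl, if_pos hN]
      exact .inl (List.mem_append_right _ (List.mem_singleton_self _))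
  have hZ : SlicePairs M N r₁ r₂ Z := fun z hz =>
    ⟨hV₁a z.1 (hZ₁ ▸ List.mem_map_of_mem hz), hV₂a z.2 (hZ₂ ▸ List.mem_map_of_mem hz)⟩
  have hhead : headBoxes N r₁ r₂ Z = W₁ := by
    rw [headBoxes, hZ₁]
    refine (filter_take_append_replicate (fun sl hsl => ?_) ?_).trans
      (List.take_of_length_le hW₁d)
    · rw [(hr₁.allowed (h₁.allowed sl hsl)).hasRow_eq_false (.inr (by omega))]; rfl
    · simp [c₁, Slice.hasRow_point]
  have harg : argBoxes N r₂ Z = W₂.take d := by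
    rw [argBoxes, hZ₂]
    refine filter_take_append_replicate (fun sl hsl => ?_) ?_
    · rw [(hr₂.allowed (h₂.allowed sl hsl)).hasRow_eq_false (.inr (by omega))]; rfl
    · simp [c₂, Slice.hasRow_point]
  have htake : ∀ j, ∀ sl ∈ (Z.map fun z => z.1 ++ z.2).take j,
      ∃ s ∈ V₁.take j, ∃ t ∈ V₂.take j, sl = s ++ t := by
    intro j sl hsl
    rw [← List.map_take] at hsl
    obtain ⟨z, hz, rfl⟩ := List.mem_map.1 hsl
    refine ⟨z.1, ?_, z.2, ?_, rfl⟩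
    · rw [← hZ₁, ← List.map_take]; exact List.mem_map_of_mem hz
    · rw [← hZ₂, ← List.map_take]; exact List.mem_map_of_mem hz
  refine ⟨X₃, Z.map fun z => z.1 ++ z.2, fun i hi => by rw [hX₃ i (by omega), hX i hi],
    by rw [List.length_map, hZlen], ?_, ?_, ?_, ?_⟩
  · rw [synthApp_eq]
    intro sl hsl
    obtain ⟨z, hz, rfl⟩ := List.mem_map.1 hsl
    exact Slice.allowed_productUnion.2 ⟨z.1, z.2, (hZ z hz).1, (hZ z hz).2, rfl⟩
  · rw [List.length_map, hZlen]; exact hℓ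
  · rw [synthApp_eq]
    intro e he sl hsl
    obtain ⟨s, hs, t, ht, rfl⟩ := htake _ sl hsl
    rw [Slice.hasOcc_append]
    rcases List.mem_append.1 he with he | he
    · have hx : e.var ∈ M.fvs := hfv₁ ▸ List.mem_map_of_mem he
      rw [take_take_append (hℓ _ (List.mem_append_left _ hx)) (h₁.level _ hx)] at hs
      rw [h₁.take e he s hs,
        (argSlices_spec hr₂ (hV₂a t (List.mem_of_mem_take ht))).2.1 _ (hr₁.occ e he).2]
      rfl
    · have hx : e.var ∈ N.fvs := by
        rw [← hfv₂, ← box_base_map_var N r₂.base r₂.ty r₂.cpts r₂.rows r₂.next]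
        exact List.mem_map_of_mem he
      rw [take_take_append (hℓ _ (List.mem_append_right _ hx)) (h₂.level _ hx)] at ht
      rw [h₂.take_boxed e he t ht,
        (headSlices_spec hr₁ hr₂ (hV₁a s (List.mem_of_mem_take hs))).2.1 _
          (hr₂.boxed_occ N e he).1]
      rfl
  · intro X' hX'
    rw [synthApp_eq] at hX'
    simp only at hX'
    have hX₃' : ∀ i < (r₂.boxed N).next, X' i = X₃ i := fun i hi => hX' i (by omega)
    obtain ⟨hf₁, hty₁⟩ := h₁.fits X' fun i hi => by
      rw [hX' i (by omega), hX₃ i (by omega), hX i hi]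
    obtain ⟨hf₂, hty₂⟩ := hbox X' hX₃'
    have hinv : (r₁.ty.dom.inst X') = A ∧ r₁.ty.cod.inst X' = B := by
      have := hty₁
      rw [GTy.inst_eq, ← Formula.iterate_bang_add] at this
      have := (Formula.iterate_bang_inj (GTy.isCore_core _)
        (show (Formula.lolli A B).IsCore from trivial) this).2
      rw [GTy.core_eq_lolli] at this
      exact Formula.lolli.inj this
    rw [fits_synthApp hr₁ hr₂ hZ, hhead, harg, hZlen, List.length_map, hZlen, hinv.1, hinv.2]
    refine ⟨⟨⟨hf₁, hf₂⟩, hty₁, hty₂⟩, ?_⟩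
    rw [synthApp_eq, hinv.2]

/-- Every leveled typing is found by type synthesis. -/
theorem Leveled.exists_realizedBy {M : Term} {ℓ : ℕ → ℕ} {T : ℕ → Formula ι} {d : ℕ}
    {C : Formula ι} (h : Leveled ℓ T d M C) {E : ℕ → STy ι} (hE : ∀ x, E x = (T x).erase)
    {σ : STy ι} (hσ : C.erase = σ) :
    ∃ der : SDer E M σ, ∀ (p : ℕ) (B : Formula ι), C = Formula.bang^[p] B →
      (∀ x ∈ M.fvs, ℓ x ≤ p) → ∀ (n : ℕ) (X₀ : ℕ → ℕ), ∃ (X : ℕ → ℕ) (W : List Slice),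
        (∀ i < n, X i = X₀ i) ∧ (M.isVar = true → W.length = p) ∧
        (M.isApp = false → p ≤ W.length) ∧ (synth der n).RealizedBy M ℓ T C X W := by
  induction h generalizing E σ with
  | var ℓ T d x =>
    obtain rfl : E x = σ := (hE x).trans hσ
    refine ⟨.var E x, fun p B hC hℓ n X₀ => ?_⟩
    obtain ⟨X, hX, hproc⟩ := exists_inst_process (E x) B
      (by rw [hE, hC, Formula.erase_iterate_bang]) n X₀
    -- A variable node has no level of its own and is put into `p` boxes: the level of the node
    -- above it, or 0 at the root. Boxing adds none around a variable, so all must be there already.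
    refine ⟨X, List.replicate p [], hX, fun _ => List.length_replicate,
      fun _ => List.length_replicate.ge, ?_, ?_, ?_, ?_⟩
    · exact fun sl hsl => .inr (List.eq_of_mem_replicate hsl)
    · rw [List.length_replicate]; exact hℓ
    · intro e _ sl hsl
      rw [List.eq_of_mem_replicate (List.mem_of_mem_take hsl)]
      rfl
    · intro X' hX'
      have hB : (process (E x) n).1.inst X' = B :=
        hproc X' fun i hi => hX' i (by simp only [synth, synthVar]; omega)
      refine ⟨⟨fun a ha => absurd ha List.not_mem_nil, fun e he => ?_⟩, ?_⟩
      · obtain rfl := List.mem_singleton.1 he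
        simp only [hB, hC, List.countP_replicate]
        rfl
      · rw [List.length_replicate, hC]
        exact congrArg _ hB
  | @lam ℓ T d d' M A B h₁ h₂ _ ih =>
    rw [Formula.erase_iterate_bang] at hσ
    obtain rfl : STy.arr A.erase B.erase = σ := hσ
    obtain ⟨der, hder⟩ := @ih (envCons A.erase E) (fun x => by
      cases x with
      | zero => exact (Formula.erase_iterate_bang _ _).symm
      | succ x => exact hE x) B.erase (Formula.erase_iterate_bang _ _)
    refine ⟨.lam der, fun p B' hC hℓ n X₀ => ?_⟩
    obtain ⟨X, W, hX, hv, ha, hreal⟩ := hder d B rfl (fun x hx => by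
      cases x with
      | zero => exact le_rfl
      | succ x => exact h₁ x (mem_filterMap_lower.2 hx)) n X₀
    obtain ⟨X₁, W₁, hX₁, hlen, hreal₁⟩ := Synth.RealizedBy.lam (inRange_synth der n)
      (map_var_base_synth der n) hreal ha hv h₁ h₂ rfl
    have hle := (inRange_synth der n).le
    refine ⟨X₁, W₁, fun i hi => by rw [hX₁ i (by omega), hX i hi], fun h => (by cases h),
      fun _ => ?_, hreal₁⟩
    rw [hlen]
    exact Formula.le_of_iterate_bang_eq (show (Formula.lolli A B).IsCore from trivial) hC
  | @app ℓ T d d₁ d₂ M N A B h₁ _ _ ih₁ ih₂ =>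
    rw [Formula.erase_iterate_bang] at hσ
    subst hσ
    obtain ⟨der₁, hder₁⟩ := @ih₁ E hE (.arr A.erase B.erase) (Formula.erase_iterate_bang _ _)
    obtain ⟨der₂, hder₂⟩ := @ih₂ E hE A.erase (Formula.erase_iterate_bang _ _)
    refine ⟨.app der₁ der₂, fun p B' _ hℓ n X₀ => ?_⟩
    obtain ⟨X₁, W₁, hX₁, -, ha₁, hreal₁⟩ := hder₁ d _ rfl
      (fun x hx => h₁ x (List.mem_append_left _ hx)) n X₀
    obtain ⟨X₂, W₂, hX₂, hv₂, ha₂, hreal₂⟩ := hder₂ d _ rfl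
      (fun x hx => h₁ x (List.mem_append_right _ hx)) (synth der₁ n).next X₁
    obtain ⟨X, W, hX, hlen, hreal⟩ := Synth.RealizedBy.app (inRange_synth der₁ n)
      (inRange_synth der₂ _) (map_var_base_synth der₁ n) (map_var_base_synth der₂ _)
      hreal₁ hreal₂ hX₂ ha₁ ha₂ hv₂ h₁
    have hle := (inRange_synth der₁ n).le
    exact ⟨X, W, fun i hi => by rw [hX i (by omega), hX₁ i hi], fun h => (by cases h),
      fun h => (by cases h), hreal⟩

/-! ### The algorithm -/

theorem mem_typesOf {B : List (Entry E)} {x : ℕ} {Θ : GTy (E x)} :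
    Θ ∈ typesOf B x ↔ ∃ o, (⟨x, o, Θ⟩ : Entry E) ∈ B := by
  simp only [typesOf, List.mem_filterMap]
  constructor
  · rintro ⟨⟨y, o, Θ'⟩, he, h⟩
    split_ifs at h with hy
    simp only at hy
    subst hy
    exact ⟨o, by cases h; exact he⟩
  · rintro ⟨o, h⟩
    exact ⟨_, h, by simp⟩

theorem length_typesOf (B : List (Entry E)) (x : ℕ) :
    (typesOf B x).length = (B.map Entry.var).count x := by
  induction B with
  | nil => rfl
  | cons e B ih =>
    rw [typesOf, List.map_cons, List.count_cons, ← ih]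
    by_cases h : e.var = x
    · rw [List.filterMap_cons_some (b := h ▸ e.ty) (by simp [h])]
      simp [h, typesOf]
    · rw [List.filterMap_cons_none (by simp [h])]
      simp [h, typesOf]

/-- After the final boxing no boxes remain outside, so the rows are not shifted any more. -/
theorem solves_algorithm {M : Term} (der : SDer E M σ) {X : ℕ → ℕ} :
    Solves X (algorithm der).constraints ↔
      RowsHold X [] ((synth der 0).boxed M).rows ∧
      ∀ x ∈ M.fvs, ∀ c ∈ contraction (typesOf ((synth der 0).boxed M).base x), c.Holds X := by
  have hv : ∀ x, x ∈ (((synth der 0).boxed M).base.map Entry.var).dedup ↔ x ∈ M.fvs := by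
    intro x
    rw [List.mem_dedup, Synth.boxed, box_base_map_var, map_var_base_synth]
  have hc : (algorithm der).constraints = ((synth der 0).boxed M).rows.map Row.lin ++
    (((synth der 0).boxed M).base.map Entry.var).dedup.flatMap fun x =>
      contraction (typesOf ((synth der 0).boxed M).base x) := rfl
  rw [Solves, hc, List.forall_mem_append, List.forall_mem_map]
  refine and_congr ?_ ?_
  · refine forall₂_congr fun a _ => ?_
    rw [List.countP_nil, Constraint.holdsSub_zero]
  · simp only [List.mem_flatMap, hv]
    exact ⟨fun h x hx c hc => h c ⟨x, hx, hc⟩, fun h c ⟨x, hx, hc⟩ => h x hx c hc⟩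

theorem exists_typesOf_eq_cons {M : Term} (der : SDer E M σ) {x : ℕ} (hx : x ∈ M.fvs) :
    ∃ Θ Θs, typesOf ((synth der 0).boxed M).base x = Θ :: Θs ∧
      (Θs ≠ [] ↔ 2 ≤ M.fvs.count x) ∧ ⟨x, Θ⟩ ∈ (algorithm der).base := by
  have hlen : (typesOf ((synth der 0).boxed M).base x).length = M.fvs.count x := by
    rw [length_typesOf, Synth.boxed, box_base_map_var, map_var_base_synth]
  have hpos := List.count_pos_iff.2 hx
  cases h : typesOf ((synth der 0).boxed M).base x with
  | nil => rw [h] at hlen; simp only [List.length_nil] at hlen; omega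
  | cons Θ Θs =>
    refine ⟨Θ, Θs, rfl, ?_, ?_⟩
    · rw [h, List.length_cons] at hlen
      rw [← hlen, ← List.length_pos_iff]
      omega
    · have hb : (algorithm der).base =
          (((synth der 0).boxed M).base.map Entry.var).dedup.flatMap fun x =>
            ((typesOf ((synth der 0).boxed M).base x).take 1).map fun Θ => ⟨x, Θ⟩ := rfl
      rw [hb, List.mem_flatMap]
      refine ⟨x, ?_, ?_⟩
      · rwa [List.mem_dedup, Synth.boxed, box_base_map_var, map_var_base_synth]
      · rw [h]; simp

theorem mem_algorithm_base {M : Term} (der : SDer E M σ) {p : (x : ℕ) × GTy (E x)}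
    (hp : p ∈ (algorithm der).base) :
    p.1 ∈ M.fvs ∧ ∃ o, (⟨p.1, o, p.2⟩ : Entry E) ∈ ((synth der 0).boxed M).base := by
  have hb : (algorithm der).base =
      (((synth der 0).boxed M).base.map Entry.var).dedup.flatMap fun x =>
        ((typesOf ((synth der 0).boxed M).base x).take 1).map fun Θ => ⟨x, Θ⟩ := rfl
  rw [hb, List.mem_flatMap] at hp
  obtain ⟨x, hx, hp⟩ := hp
  obtain ⟨Θ, hΘ, rfl⟩ := List.mem_map.1 hp
  rw [List.mem_dedup, Synth.boxed, box_base_map_var, map_var_base_synth] at hx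
  exact ⟨hx, mem_typesOf.1 (List.mem_of_mem_take hΘ)⟩

/-- The final boxing supplies all boxes around `M`. The contraction constraints extend the type kept
in the resulting base to every occurrence of the variable and make it start with ! if there are
several. -/
theorem LeveledTyping.of_algorithm {M : Term} {Γ : Ctx ι} (der : SDer E M σ) {X : ℕ → ℕ}
    (hX : Solves X (algorithm der).constraints) (hΓ : InstSubset X (algorithm der).base Γ) :
    LeveledTyping Γ M ((algorithm der).ty.inst X) := by
  rw [solves_algorithm] at hX
  obtain ⟨hrows, hcontr⟩ := hX
  -- Outside the free variables of `M` the value is irrelevant, so any formula can be the default.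
  let T : ℕ → Formula ι := fun x => (Γ x).getD ((algorithm der).ty.inst X)
  have hT : ∀ x ∈ M.fvs, Γ x = some (T x) ∧
      (2 ≤ M.fvs.count x → ∃ A, T x = .bang A) ∧
      ∀ Θ ∈ typesOf ((synth der 0).boxed M).base x, Θ.inst X = T x := by
    intro x hx
    obtain ⟨Θ, Θs, h₁, h₂, h₃⟩ := exists_typesOf_eq_cons der hx
    have h₄ : Γ x = some (Θ.inst X) := hΓ _ h₃
    have h₅ : T x = Θ.inst X := by simp [T, h₄]
    have h₆ := hcontr x hx
    rw [h₁, solves_contraction] at h₆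
    rw [h₅]
    refine ⟨h₄, fun h => h₆.1 (h₂.2 h), ?_⟩
    rw [h₁, List.forall_mem_cons]
    exact ⟨rfl, h₆.2⟩
  have hbase : BaseFits X [] ((synth der 0).boxed M).base T := by
    rintro ⟨x, o, Θ⟩ he
    have hx : x ∈ M.fvs := by
      rw [← map_var_base_synth der 0, ← box_base_map_var M (synth der 0).base (synth der 0).ty
        (synth der 0).cpts (synth der 0).rows (synth der 0).next]
      exact List.mem_map_of_mem (f := Entry.var) he
    exact (hT x hx).2.2 Θ (mem_typesOf.2 ⟨o, he⟩)
  have hF := Synth.fits_boxed.1 ⟨hrows, hbase⟩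
  rw [List.nil_append] at hF
  have key := leveled_of_fits der 0 ((synth der 0).added X M) (fun sl hsl => allowed_of_mem_addedBoxes hsl) T
    (fun _ => 0) (fun _ _ => Nat.zero_le _) hF
  have hty : (algorithm der).ty.inst X = ((synth der 0).boxed M).ty.inst X := rfl
  rw [← Synth.inst_boxed_ty, ← hty] at key
  refine ⟨T, _, fun x hx => (hT x hx).1, fun x hx => ?_, key⟩
  exact (hT x (List.count_pos_iff.1 (by omega))).2.1 hx

theorem LeveledTyping.exists_algorithm {M : Term} {Γ : Ctx ι} {C : Formula ι}
    (h : LeveledTyping Γ M C) :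
    ∃ (E : ℕ → STy ι) (der : SDer E M C.erase) (X : ℕ → ℕ),
      Solves X (algorithm der).constraints ∧ InstSubset X (algorithm der).base Γ ∧
      C = (algorithm der).ty.inst X := by
  obtain ⟨T, d, hT, hc, hL⟩ := h
  obtain ⟨der, hder⟩ := hL.exists_realizedBy (fun _ => rfl) rfl
  obtain ⟨X₀, W, -, hv, -, hreal⟩ := hder 0 C rfl (fun _ _ => Nat.zero_le _) 0 fun _ => 0
  -- The whole term has no parent to share boxes with, so all its boxes are left to the final
  -- boxing.
  obtain ⟨X, -, hX⟩ := hreal.exists_boxed 0 hv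
  obtain ⟨hF, hty⟩ := hX X fun _ _ => rfl
  rw [List.take_zero, List.nil_append] at hF hty
  obtain ⟨hrows, hbase⟩ := (Synth.fits_boxed (W := [])).2 (by rwa [List.nil_append])
  refine ⟨_, der, X, ?_, ?_, ?_⟩
  · rw [solves_algorithm]
    refine ⟨hrows, fun x hx => ?_⟩
    obtain ⟨Θ, Θs, h₁, h₂, -⟩ := exists_typesOf_eq_cons der hx
    have h₃ : ∀ Θ ∈ typesOf ((synth der 0).boxed M).base x, Θ.inst X = T x := by
      intro Θ hΘ
      obtain ⟨o, ho⟩ := mem_typesOf.1 hΘ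
      exact hbase _ ho
    rw [h₁, List.forall_mem_cons] at h₃
    rw [h₁, solves_contraction, h₃.1]
    exact ⟨fun h => hc x (h₂.1 h), h₃.2⟩
  · intro p hp
    obtain ⟨hx, o, ho⟩ := mem_algorithm_base der hp
    rw [hT _ hx]
    exact congrArg some (hbase _ ho).symm
  · exact hty.symm.trans (Synth.inst_boxed_ty M (synth der 0)).symm

end

end EAL

theorem mainTheorem1 {ι : Type*} (M : EAL.Term) (hM : EAL.SimplyTypeable ι M)
    (Γ : EAL.Ctx ι) (hΓ : Γ.dom.Finite) (C : EAL.Formula ι) :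
    EAL.Typing Γ M C ↔
      ∃ (E : ℕ → EAL.STy ι) (d : EAL.SDer E M C.erase) (X : ℕ → ℕ),
        EAL.Solves X (EAL.algorithm d).constraints ∧
        EAL.InstSubset X (EAL.algorithm d).base Γ ∧
        C = (EAL.algorithm d).ty.inst X := by
  constructor
  · exact fun h => h.leveledTyping.exists_algorithm
  · rintro ⟨E, d, X, hX, hB, hC⟩
    rw [hC]
    exact (EAL.LeveledTyping.of_algorithm d hX hB).typing hΓ
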